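/- Let $d\ge 1$ and let $\mathcal L\subset\mathbb R^d$ be a lattice, i.e. the set of all integer linear combinations of a basis $(\lambda_1,\dots,\lambda_d)$ of $\mathbb R^d$, with fundamental domain $\mathcal D=\{\sum_i t_i\lambda_i:\ t_i\in[0,1)\}$. Let $\mathrm p=(\mathrm p_x)_{x\in\mathcal L}$ be a family of (possibly dependent) $\mathbb R^d$-valued random variables whose joint law is $\mathcal L$-invariant: for every $x_\star\in\mathcal L$, $(\mathrm p_{x+x_\star})_{x\in\mathcal L}$ has the same distribution as $(\mathrm p_x)_{x\in\mathcal L}$ (in particular the $\mathrm p_x$ are identically distributed). Let $U$ be uniformly distributed in $\mathcal D$ and independent of $\mathrm p$. The associated perturbed lattice is the point process $\mathbf{PL}=\{x+U+\mathrm p_x:\ x\in\mathcal L\}$, points being counted with multiplicity. For a bounded Borel set $B$, $|\mathbf{PL}\cap B|$ is the number of its points in $B$ and $\mathrm{Var}[|\mathbf{PL}\cap B|]\in[0,\infty]$ is the number variance in $B$. Let $\mathrm B_r$ be the closed Euclidean ball of radius $r$ centred at the origin and $|\mathrm B_r|$ its volume. $\mathbf{PL}$ is called hyperuniform if $\mathrm{Var}[|\mathbf{PL}\cap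 \mathrm B_r|]/|\mathrm B_r|\to0$ as $r\to\infty$. For perturbations of $\mathbb Z^d$ below, $\mathcal L=\mathbb Z^d$ and $\mathcal D=[0,1)^d$. **Theorem 1.1.** (i) For all $d\ge1$ and all lattices $\mathcal L$: if $\mathbb E[|\mathrm p_0|^d]<\infty$, then the number variance of $\mathbf{PL}$ is finite in every closed ball of radius $r>0$ (with any centre, in particular in $\mathrm B_r$). (ii) For $d=1$ or $2$ and all lattices $\mathcal L$: if $\mathbb E[|\mathrm p_0|^d]<\infty$, then $\mathbf{PL}$ is hyperuniform. (iii) For all $d\ge1$: if $X$ is an almost surely non-negative real random variable with $\mathbb E[X^d]=+\infty$, then, after possibly enlarging the probability space on which $X$ is defined, there exist perturbations $(\mathrm p_x)_{x\in\mathbb Z^d}$ and $U$ as above with $|\mathrm p_0|\le X$ almost surely, such that the resulting perturbed lattice has infinite number variance in every closed ball of radius $r>0$ (with any centre). (iv) For all $d\ge3$ and all $\epsilon>0$: there exist perturbations $(\mathrm p_x)_{x\in\mathbb Z^d}$ and $U$ as above with $|\mathrm p_0|\le\epsilon$ almost surely, such that the resulting perturbed lattice satisfies $$\lim_{r\to+\infty}\frac{\mathrm{Var}[|\mathbf{PL}\cap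 \mathrm B_r|]}{|\mathrm B_r|}=+\infty.$$ -/

import Mathlib

open MeasureTheory ProbabilityTheory Filter Topology
open scoped ENNReal

universe u v

namespace PertLattice

/-- The ambient Euclidean space of dimension `d`. -/
abbrev E (d : ℕ) : Type := EuclideanSpace ℝ (Fin d)

/-- The (full-rank) lattice of all integer linear combinations of a basis `b`. -/
abbrev lattice {d : ℕ} (b : Module.Basis (Fin d) ℝ (E d)) : Submodule ℤ (E d) :=
  Submodule.span ℤ (Set.range b)

/-- The canonical basis of `ℝ^d`; its lattice is the integer lattice `ℤ^d`. -/
noncomputable abbrev stdBasis (d : ℕ) : Module.Basis (Fin d) ℝ (E d) :=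
  (EuclideanSpace.basisFun (Fin d) ℝ).toBasis

section

variable {d : ℕ} {Ω : Type u} [MeasurableSpace Ω]

/-- The standing assumptions on the perturbations `p` and the global shift `U` of the lattice
generated by `b`. The field `invariant` contains in particular that all the `p x` have the same
distribution. -/
structure IsPerturbation (b : Module.Basis (Fin d) ℝ (E d)) (P : Measure Ω)
    (p : lattice b → Ω → E d) (U : Ω → E d) : Prop where
  measurable_pert : ∀ x, Measurable (p x)
  measurable_shift : Measurable U
  /-- The joint law of the perturbations is invariant under the translations of the lattice. -/
  invariant : ∀ a : lattice b,
    IdentDistrib (fun ω (x : lattice b) => p x ω) (fun ω (x : lattice b) => p (x + a) ω) P P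
  /-- `U` is uniformly distributed in the half-open parallelotope spanned by the basis. -/
  uniform : pdf.IsUniform U (ZSpan.fundamentalDomain b) P volume
  indep : IndepFun (fun ω (x : lattice b) => p x ω) U P

/-- The perturbed lattice `{x + U + p_x}`, points being counted with multiplicity, as a random
sum of Dirac masses. -/
noncomputable def perturbedLattice (b : Module.Basis (Fin d) ℝ (E d))
    (p : lattice b → Ω → E d) (U : Ω → E d) (ω : Ω) : Measure (E d) :=
  Measure.sum fun x : lattice b => Measure.dirac ((x : E d) + U ω + p x ω)

/-- The variance, in `[0, ∞]`, of the number of points of the perturbed lattice in the set `B`.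
Under `IsPerturbation`, for bounded Borel `B`, this number is almost surely finite with finite
mean, so that `toReal` and the mean used in `evariance` are not degenerate. -/
noncomputable def numberVariance (b : Module.Basis (Fin d) ℝ (E d)) (P : Measure Ω)
    (p : lattice b → Ω → E d) (U : Ω → E d) (B : Set (E d)) : ℝ≥0∞ :=
  evariance (fun ω => (perturbedLattice b p U ω B).toReal) P

/-- The rescaled number variance `σ(r) = Var[|PL ∩ B_r|] / |B_r|`, for the closed ball `B_r` of
radius `r` centred at the origin. -/
noncomputable def rescaledVariance (b : Module.Basis (Fin d) ℝ (E d)) (P : Measure Ω)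
    (p : lattice b → Ω → E d) (U : Ω → E d) (r : ℝ) : ℝ≥0∞ :=
  numberVariance b P p U (Metric.closedBall 0 r) / volume (Metric.closedBall (0 : E d) r)

/-- Hyperuniformity: `σ(r) → 0` as `r → ∞`. -/
def Hyperuniform (b : Module.Basis (Fin d) ℝ (E d)) (P : Measure Ω)
    (p : lattice b → Ω → E d) (U : Ω → E d) : Prop :=
  Tendsto (rescaledVariance b P p U) atTop (𝓝 0)

end

end PertLattice

/-!
Everything rests on the Campbell formula `campbell`: by stationarity and by uniformity of the
shift, a sum over the points of the process has expectation an integral over the position of the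
point with index zero. It gives the mean number of points in a set (`mean_count`) and its second
moment (`lintegral_sq_tsum`), where only the relative perturbations `p z - p 0` matter.

*Finite variance.* In the second moment, each pair of points can be charged to the one with the
larger perturbation (`lintegral_sq_tsum_le`); a point with perturbation `v` is then counted with
the lattice points within `‖v‖` of the ball, whose number is of order `1 + ‖v‖ ^ d`.

*Counterexamples.* Reading a profile on the torus at phase `w + s x`, with `w` uniform, gives a
stationary family (`isPerturbation_phasePert`). A sawtooth profile at random scale `M`, proportional
to `X`, brings about `M ^ d` points to the place of the point of index zero (`le_tsum_sawtooth`),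
so that the second moment is at least of order `E[M ^ d]`. For `d ≥ 3`, a square wave of
amplitude `ε` in one coordinate, at scale `r`, creates around a hyperplane an excess of order
`ε r ^ (d - 1)` points (`mean_excess`); with a random scale, of order
`r` with probability of order `r ^ (-1 / 2)`, this gives for all large `r`
a variance of order at least `r ^ (2 d - 5 / 2)`, which is larger than `r ^ d`.

*Hyperuniformity.* For `d ≤ 2` the points whose membership of a ball is changed by truncating the
perturbations have a mean square count of order `r ^ d` times the tail of the `d`-th moment
(`hyperuniform_of_truncate`), so that bounded perturbations suffice. For `d = 1` the number of
points of a ball then differs from its mean by a bounded amount. For `d = 2` the variance is, up to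
a constant factor, `∑ z, E[g (z + p z - p 0)] - ∑ z, E[g (z + t - c)]`, where `g` is
the area of the intersection of two discs of radius `r` whose centres differ by the given vector,
`t` is uniform in the fundamental domain and `c` is its mean: the second sum is the
squared mean. Both sums are compared with `∑ z, g z`
(`tendsto_lens_sum`). The first order terms vanish because the perturbations are centred. The
second order terms are averages, over the lattice at scale `r`, of second derivatives of the
profile of `g`, which have zero integral, against covariances; by a mean ergodic argument in
`L²` (`tendsto_latticeAvg_inner`) they tend to zero. The profile is not twice differentiable at
distances `0` and `2 r`; near these it is cut off (`SmoothApprox`), and the remaining part of its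
derivative is a combination of monotone functions, whose oscillations telescope over shells
(`exists_sum_osc_le`).
-/

namespace PertLattice

/-! ### The Campbell formula and the second moment of the number of points -/

section General

lemma measurable_comp₂ {α β γ δ : Type*} [MeasurableSpace α] [MeasurableSpace β]
    [MeasurableSpace γ] [MeasurableSpace δ] {a : α → β → γ} (ha : Measurable (Function.uncurry a))
    {f : δ → α} {g : δ → β} (hf : Measurable f) (hg : Measurable g) :
    Measurable fun x => a (f x) (g x) :=
  ha.comp (hf.prodMk hg)

variable {d : ℕ} (b : Module.Basis (Fin d) ℝ (E d))

lemma lintegral_eq_tsum_lattice (f : E d → ℝ≥0∞) :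
    ∫⁻ x, f x = ∑' z : lattice b, ∫⁻ x in ZSpan.fundamentalDomain b, f ((z : E d) + x) :=
  haveI : Countable (lattice b).toAddSubgroup := inferInstanceAs (Countable (lattice b))
  (ZSpan.isAddFundamentalDomain' b (volume : Measure (E d))).lintegral_eq_tsum'' f

lemma volume_fundamentalDomain_ne_zero : volume (ZSpan.fundamentalDomain b) ≠ 0 :=
  ZSpan.measure_fundamentalDomain_ne_zero b

lemma volume_fundamentalDomain_ne_top : volume (ZSpan.fundamentalDomain b) ≠ ∞ :=
  (ZSpan.fundamentalDomain_isBounded b).measure_lt_top.ne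

/-- A bound for the norms of the points of the fundamental domain. -/
noncomputable def cellRadius : ℝ := ∑ i, ‖b i‖

lemma cellRadius_nonneg : 0 ≤ cellRadius b := Finset.sum_nonneg fun _ _ => norm_nonneg _

lemma norm_le_cellRadius {t : E d} (ht : t ∈ ZSpan.fundamentalDomain b) :
    ‖t‖ ≤ cellRadius b := by
  have := ZSpan.norm_fract_le b t
  rwa [ZSpan.fract_eq_self.2 ht] at this

variable {Ω : Type u} [MeasurableSpace Ω] {P : Measure Ω}
  {p : lattice b → Ω → E d} {U : Ω → E d}

/-- The number of lattice points in a translate of `A` is at most the volume of a neighbourhood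
of `A` divided by the volume of the fundamental domain. -/
lemma tsum_indicator_le (A A' : Set (E d)) (hA' : MeasurableSet A') (c : E d)
    (h : ∀ y ∈ A, ∀ t : E d, ‖t‖ ≤ cellRadius b → y + t ∈ A') :
    ∑' z : lattice b, A.indicator (1 : E d → ℝ≥0∞) (c + (z : E d)) ≤
      volume A' / volume (ZSpan.fundamentalDomain b) := by
  set D := ZSpan.fundamentalDomain b
  have hD0 : volume D ≠ 0 := volume_fundamentalDomain_ne_zero b
  have hDt : volume D ≠ ∞ := volume_fundamentalDomain_ne_top b
  have hDm : MeasurableSet D := ZSpan.fundamentalDomain_measurableSet b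
  have h1 : ∀ z : lattice b, A.indicator (1 : E d → ℝ≥0∞) (c + (z : E d)) * volume D ≤
      ∫⁻ x in D, A'.indicator (1 : E d → ℝ≥0∞) (c + ((z : E d) + x)) := by
    intro z
    by_cases hz : c + (z : E d) ∈ A
    · rw [Set.indicator_of_mem hz]
      simp only [Pi.one_apply, one_mul]
      rw [← setLIntegral_one]
      refine setLIntegral_mono_ae' hDm (Eventually.of_forall fun x hx => ?_)
      rw [← add_assoc, Set.indicator_of_mem (h _ hz x (norm_le_cellRadius b hx))]
      simp
    · rw [Set.indicator_of_notMem hz]; simp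
  rw [ENNReal.le_div_iff_mul_le (Or.inl hD0) (Or.inl hDt), ← ENNReal.tsum_mul_right]
  calc _ ≤ ∑' z : lattice b, ∫⁻ x in D, A'.indicator (1 : E d → ℝ≥0∞) (c + ((z : E d) + x)) :=
        ENNReal.tsum_le_tsum h1
    _ = ∫⁻ x, A'.indicator (1 : E d → ℝ≥0∞) (c + x) :=
        (lintegral_eq_tsum_lattice b fun x => A'.indicator (1 : E d → ℝ≥0∞) (c + x)).symm
    _ = ∫⁻ x, A'.indicator (1 : E d → ℝ≥0∞) x :=
        lintegral_add_left_eq_self (A'.indicator (1 : E d → ℝ≥0∞)) c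
    _ = volume A' := lintegral_indicator_one hA'

lemma IsPerturbation.measurable_field (h : IsPerturbation b P p U) :
    Measurable fun ω (x : lattice b) => p x ω :=
  measurable_pi_lambda _ h.measurable_pert

/-- The perturbations seen from `x` and the shift have the same joint law as the perturbations and
an independent uniform point of the fundamental domain. -/
lemma map_field_shift [IsProbabilityMeasure P] (h : IsPerturbation b P p U) (x : lattice b) :
    P.map (fun ω => ((fun y : lattice b => p (y + x) ω), U ω)) =
      (P.map fun ω (y : lattice b) => p y ω).prod
        (ProbabilityTheory.cond volume (ZSpan.fundamentalDomain b)) := by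
  have hm := h.measurable_field
  have hx : Measurable fun ω (y : lattice b) => p (y + x) ω :=
    measurable_pi_lambda _ fun y => h.measurable_pert _
  have hind : IndepFun (fun ω (y : lattice b) => p (y + x) ω) U P := by
    have := h.indep.comp (φ := fun (q : lattice b → E d) (y : lattice b) => q (y + x)) (ψ := id)
      (measurable_pi_lambda _ fun y => measurable_pi_apply _) measurable_id
    exact this
  rw [(indepFun_iff_map_prod_eq_prod_map_map hx.aemeasurable h.measurable_shift.aemeasurable).1
    hind, ← (h.invariant x).map_eq, show P.map U = _ from h.uniform]

/-- The Campbell (mass transport) formula: because the perturbations are stationary and the shift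
is uniform in the cell, a sum over the lattice of a covariant functional has the mean of a
Lebesgue integral over the whole space. -/
lemma campbell [IsProbabilityMeasure P] (h : IsPerturbation b P p U)
    {F : (lattice b → E d) → E d → ℝ≥0∞} (hF : Measurable (Function.uncurry F)) :
    ∫⁻ ω, ∑' x : lattice b, F (fun y => p (y + x) ω) ((x : E d) + U ω) ∂P =
      (∫⁻ ω, (∫⁻ u, F (fun y => p y ω) u) ∂P) / volume (ZSpan.fundamentalDomain b) := by
  set D := ZSpan.fundamentalDomain b
  have hm := h.measurable_field
  have hDm : MeasurableSet D := ZSpan.fundamentalDomain_measurableSet b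
  have hmx : ∀ x : lattice b, Measurable fun ω => ((fun y : lattice b => p (y + x) ω), U ω) :=
    fun x => (measurable_pi_lambda _ fun y => h.measurable_pert _).prodMk h.measurable_shift
  have hFx : ∀ x : lattice b, Measurable fun q : (lattice b → E d) × E d =>
      F q.1 ((x : E d) + q.2) := fun x =>
    measurable_comp₂ hF measurable_fst (measurable_snd.const_add _)
  have key : ∀ x : lattice b, ∫⁻ ω, F (fun y => p (y + x) ω) ((x : E d) + U ω) ∂P =
      ∫⁻ ω, ((volume D)⁻¹ * ∫⁻ u in D, F (fun y => p y ω) ((x : E d) + u)) ∂P := by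
    intro x
    rw [← lintegral_map (f := fun q : (lattice b → E d) × E d => F q.1 ((x : E d) + q.2))
      (hFx x) (hmx x), map_field_shift b h x, lintegral_prod _ (hFx x).aemeasurable,
      lintegral_map (Measurable.lintegral_prod_right' (hFx x)) hm]
    refine lintegral_congr fun ω => ?_
    simp only [ProbabilityTheory.cond, lintegral_smul_measure, smul_eq_mul]
    rfl
  have hmeas : ∀ x : lattice b, Measurable fun ω =>
      ∫⁻ u in D, F (fun y => p y ω) ((x : E d) + u) := fun x =>
    (Measurable.lintegral_prod_right' (ν := volume.restrict D) (hFx x)).comp hm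
  have hFU : ∀ x : lattice b, AEMeasurable
      (fun ω => F (fun y => p (y + x) ω) ((x : E d) + U ω)) P := fun x =>
    ((hFx x).comp (hmx x)).aemeasurable
  rw [lintegral_tsum hFU]
  simp_rw [key]
  rw [← lintegral_tsum fun x => ((hmeas x).const_mul _).aemeasurable]
  simp_rw [ENNReal.tsum_mul_left]
  rw [lintegral_const_mul' _ _ (ENNReal.inv_ne_top.2 (volume_fundamentalDomain_ne_zero b)),
    mul_comm, ENNReal.div_eq_inv_mul, mul_comm]
  congr 1
  exact lintegral_congr fun ω => (lintegral_eq_tsum_lattice b _).symm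

lemma perturbedLattice_apply {S : Type*} {p : lattice b → S → E d} {U : S → E d}
    {B : Set (E d)} (hB : MeasurableSet B) (ω : S) :
    perturbedLattice b p U ω B =
      ∑' x : lattice b, B.indicator (1 : E d → ℝ≥0∞) ((x : E d) + U ω + p x ω) := by
  rw [perturbedLattice, Measure.sum_apply _ hB]
  exact tsum_congr fun x => Measure.dirac_apply' _ hB

lemma measurable_count (h : IsPerturbation b P p U) {B : Set (E d)} (hB : MeasurableSet B) :
    Measurable fun ω => perturbedLattice b p U ω B := by
  simp_rw [perturbedLattice_apply b hB]
  exact Measurable.tsum fun x => (measurable_one.indicator hB).comp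
    ((h.measurable_shift.const_add _).add (h.measurable_pert x))

lemma lintegral_tsum_pert [IsProbabilityMeasure P] (h : IsPerturbation b P p U)
    {a : E d → E d → ℝ≥0∞} (ha : Measurable (Function.uncurry a)) :
    ∫⁻ ω, ∑' x : lattice b, a (p x ω) ((x : E d) + U ω) ∂P =
      (∫⁻ ω, (∫⁻ u, a (p 0 ω) u) ∂P) / volume (ZSpan.fundamentalDomain b) := by
  have := campbell b h (F := fun q u => a (q 0) u)
    (measurable_comp₂ ha ((measurable_pi_apply 0).comp measurable_fst) measurable_snd)
  simpa using this

lemma mean_count [IsProbabilityMeasure P] (h : IsPerturbation b P p U)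
    {B : Set (E d)} (hB : MeasurableSet B) :
    ∫⁻ ω, perturbedLattice b p U ω B ∂P =
      volume B / volume (ZSpan.fundamentalDomain b) := by
  simp_rw [perturbedLattice_apply b hB]
  have := lintegral_tsum_pert b h (a := fun v u => B.indicator (1 : E d → ℝ≥0∞) (u + v))
    ((measurable_one.indicator hB).comp (measurable_snd.add measurable_fst))
  rw [this]
  congr 1
  have h2 : ∀ ω, ∫⁻ u, B.indicator (1 : E d → ℝ≥0∞) (u + p 0 ω) = volume B := fun ω => by
    rw [lintegral_add_right_eq_self (B.indicator (1 : E d → ℝ≥0∞)), lintegral_indicator_one hB]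
  simp [h2]

lemma tsum_mul_tsum_shift (a : lattice b → ℝ≥0∞) :
    (∑' x, a x) ^ 2 = ∑' x, a x * ∑' z, a (z + x) := by
  rw [sq, ← ENNReal.tsum_mul_right]
  refine tsum_congr fun x => ?_
  congr 1
  exact ((Equiv.addRight x).tsum_eq a).symm

/-- The second moment of a sum over the points of the process. -/
lemma lintegral_sq_tsum [IsProbabilityMeasure P] (h : IsPerturbation b P p U)
    {a : E d → E d → ℝ≥0∞} (ha : Measurable (Function.uncurry a)) :
    ∫⁻ ω, (∑' x : lattice b, a (p x ω) ((x : E d) + U ω)) ^ 2 ∂P =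
      (∫⁻ ω, (∫⁻ u, a (p 0 ω) u * ∑' z : lattice b, a (p z ω) ((z : E d) + u)) ∂P) /
        volume (ZSpan.fundamentalDomain b) := by
  have hm : ∀ z : lattice b, Measurable fun q : (lattice b → E d) × E d =>
      a (q.1 z) ((z : E d) + q.2) := fun z =>
    measurable_comp₂ ha ((measurable_pi_apply z).comp measurable_fst) (measurable_snd.const_add _)
  have := campbell b h (F := fun q u => a (q 0) u * ∑' z : lattice b, a (q z) ((z : E d) + u))
    ((measurable_comp₂ ha ((measurable_pi_apply 0).comp measurable_fst) measurable_snd).mul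
      (Measurable.tsum hm))
  rw [← this]
  refine lintegral_congr fun ω => ?_
  rw [tsum_mul_tsum_shift]
  simp [add_assoc]

/-- Second moment bound. Ordering each pair of points by the sizes of their perturbations leaves
only pairs in which the second point moves less than the first, so that the number of
possible partners is controlled by the perturbation at the origin alone. -/
lemma lintegral_sq_tsum_le [IsProbabilityMeasure P] (h : IsPerturbation b P p U)
    {a : E d → E d → ℝ≥0∞} (ha : Measurable (Function.uncurry a)) :
    ∫⁻ ω, (∑' x : lattice b, a (p x ω) ((x : E d) + U ω)) ^ 2 ∂P ≤
      2 * ((∫⁻ ω, (∫⁻ u, a (p 0 ω) u * ∑' z : lattice b,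
        {v | ‖v‖ ≤ ‖p 0 ω‖}.indicator (fun v => a v ((z : E d) + u)) (p z ω)) ∂P) /
        volume (ZSpan.fundamentalDomain b)) := by
  classical
  have hm : ∀ z : lattice b, Measurable fun q : (lattice b → E d) × E d =>
      {v | ‖v‖ ≤ ‖q.1 0‖}.indicator (fun v => a v ((z : E d) + q.2)) (q.1 z) := by
    intro z
    have h1 : Measurable fun q : (lattice b → E d) × E d => a (q.1 z) ((z : E d) + q.2) :=
      measurable_comp₂ ha ((measurable_pi_apply z).comp measurable_fst)
        (measurable_snd.const_add _)
    have h2 : MeasurableSet {q : (lattice b → E d) × E d | ‖q.1 z‖ ≤ ‖q.1 0‖} :=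
      measurableSet_le ((measurable_pi_apply z).comp measurable_fst).norm
        ((measurable_pi_apply 0).comp measurable_fst).norm
    have := h1.indicator h2
    convert this using 2
    simp only [Set.indicator_apply, Set.mem_ofPred_eq]
  have := campbell b h (F := fun q u => a (q 0) u * ∑' z : lattice b,
      {v | ‖v‖ ≤ ‖q 0‖}.indicator (fun v => a v ((z : E d) + u)) (q z))
    ((measurable_comp₂ ha ((measurable_pi_apply 0).comp measurable_fst) measurable_snd).mul
      (Measurable.tsum hm))
  rw [← this, ← lintegral_const_mul' _ _ (by simp)]
  refine lintegral_mono fun ω => ?_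
  set A : lattice b → ℝ≥0∞ := fun x => a (p x ω) ((x : E d) + U ω) with hA
  set I : lattice b → lattice b → ℝ≥0∞ := fun x y => if ‖p y ω‖ ≤ ‖p x ω‖ then 1 else 0 with hI
  have e1 : ∀ x : lattice b, ∑' z : lattice b, {v | ‖v‖ ≤ ‖p (0 + x) ω‖}.indicator
      (fun v => a v ((z : E d) + ((x : E d) + U ω))) (p (z + x) ω) = ∑' y, A y * I x y := by
    intro x
    rw [← (Equiv.addRight x).tsum_eq fun y => A y * I x y]
    refine tsum_congr fun z => ?_
    simp [Set.indicator_apply, hA, hI, add_assoc]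
  have e2 : ∀ x y, A x * A y ≤ A x * (A y * I x y) + A y * (A x * I y x) := by
    intro x y
    rcases le_total ‖p y ω‖ ‖p x ω‖ with hxy | hxy
    · simp [hI, hxy]
    · simp [hI, hxy, mul_comm]
  calc (∑' x, A x) ^ 2 = ∑' x, ∑' y, A x * A y := by
        rw [sq, ← ENNReal.tsum_mul_right]; simp_rw [ENNReal.tsum_mul_left]
    _ ≤ ∑' x, ∑' y, (A x * (A y * I x y) + A y * (A x * I y x)) :=
        ENNReal.tsum_le_tsum fun x => ENNReal.tsum_le_tsum fun y => e2 x y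
    _ = ∑' x, ∑' y, A x * (A y * I x y) + ∑' x, ∑' y, A y * (A x * I y x) := by
        simp_rw [ENNReal.tsum_add]
    _ = 2 * ∑' x, A x * ∑' y, A y * I x y := by
        rw [ENNReal.tsum_comm (f := fun x y => A y * (A x * I y x)), ← two_mul]
        simp_rw [ENNReal.tsum_mul_left]
    _ = _ := by
        congr 1
        refine tsum_congr fun x => ?_
        rw [e1 x]; simp [hA]

lemma count_ae_lt_top [IsProbabilityMeasure P] (h : IsPerturbation b P p U)
    {B : Set (E d)} (hB : MeasurableSet B) (hBt : volume B ≠ ∞) :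
    ∀ᵐ ω ∂P, perturbedLattice b p U ω B < ∞ := by
  refine ae_lt_top (measurable_count b h hB) ?_
  rw [mean_count b h hB]
  exact ENNReal.div_ne_top hBt (volume_fundamentalDomain_ne_zero b)

lemma integral_count [IsProbabilityMeasure P] (h : IsPerturbation b P p U)
    {B : Set (E d)} (hB : MeasurableSet B) (hBt : volume B ≠ ∞) :
    ∫ ω, (perturbedLattice b p U ω B).toReal ∂P =
      (volume B / volume (ZSpan.fundamentalDomain b)).toReal := by
  rw [integral_toReal (measurable_count b h hB).aemeasurable (count_ae_lt_top b h hB hBt),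
    mean_count b h hB]

/-- The number variance is finite exactly when the number of points is square integrable. -/
lemma numberVariance_lt_top_iff [IsProbabilityMeasure P] (h : IsPerturbation b P p U)
    {B : Set (E d)} (hB : MeasurableSet B) (hBt : volume B ≠ ∞) :
    numberVariance b P p U B < ∞ ↔ ∫⁻ ω, perturbedLattice b p U ω B ^ 2 ∂P < ∞ := by
  have hmeas := (measurable_count b h hB).ennreal_toReal.aestronglyMeasurable (μ := P)
  rw [numberVariance, evariance_lt_top_iff_memLp hmeas, MemLp,
    eLpNorm_lt_top_iff_lintegral_rpow_enorm_lt_top (by simp) (by simp)]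
  simp only [hmeas, true_and]
  have : ∫⁻ ω, ‖(perturbedLattice b p U ω B).toReal‖ₑ ^ (2 : ℝ≥0∞).toReal ∂P =
      ∫⁻ ω, perturbedLattice b p U ω B ^ 2 ∂P := by
    refine lintegral_congr_ae ?_
    filter_upwards [count_ae_lt_top b h hB hBt] with ω hω
    rw [Real.enorm_of_nonneg ENNReal.toReal_nonneg, ENNReal.ofReal_toReal hω.ne]
    simp
  rw [this]

end General

/-! ### Finite number variance under a moment of order `d` -/

section FiniteVariance

variable {d : ℕ} (b : Module.Basis (Fin d) ℝ (E d))
variable {Ω : Type u} [MeasurableSpace Ω] {P : Measure Ω}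
  {p : lattice b → Ω → E d} {U : Ω → E d}

lemma ennreal_add_pow_le (a s : ℝ≥0∞) (n : ℕ) : (a + s) ^ n ≤ 2 ^ n * (a ^ n + s ^ n) := by
  rcases le_total a s with h | h
  · calc (a + s) ^ n ≤ (2 * s) ^ n := by rw [two_mul]; gcongr
      _ = 2 ^ n * s ^ n := mul_pow _ _ _
      _ ≤ _ := by gcongr; exact le_add_self
  · calc (a + s) ^ n ≤ (2 * a) ^ n := by rw [two_mul]; gcongr
      _ = 2 ^ n * a ^ n := mul_pow _ _ _
      _ ≤ _ := by gcongr; exact le_self_add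

lemma volume_closedBall_eq (c : E d) {r : ℝ} (hr : 0 ≤ r) :
    volume (Metric.closedBall c r) =
      ENNReal.ofReal r ^ d * volume (Metric.closedBall (0 : E d) 1) := by
  have h1 := Measure.addHaar_closedBall' (volume : Measure (E d)) c hr
  rw [h1, finrank_euclideanSpace_fin, ENNReal.ofReal_pow hr]

/-- A finite moment of order `d` implies finite number variance: a point with perturbation `v` has
at most of order `1 + ‖v‖ ^ d` partners with smaller perturbations in a given ball. -/
theorem numberVariance_closedBall_lt_top [IsProbabilityMeasure P] (h : IsPerturbation b P p U)
    (hp : ∫⁻ ω, ‖p 0 ω‖ₑ ^ d ∂P < ∞) (c : E d) {r : ℝ} (hr : 0 < r) :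
    numberVariance b P p U (Metric.closedBall c r) < ∞ := by
  set B := Metric.closedBall c r with hBdef
  have hB : MeasurableSet B := measurableSet_closedBall
  have hBt : volume B ≠ ∞ := measure_closedBall_lt_top.ne
  set D := ZSpan.fundamentalDomain b
  have hD0 : volume D ≠ 0 := volume_fundamentalDomain_ne_zero b
  rw [numberVariance_lt_top_iff b h hB hBt]
  set ρ := cellRadius b
  have hρ : 0 ≤ ρ := cellRadius_nonneg b
  set v := volume (Metric.closedBall (0 : E d) 1)
  have hv : v ≠ ∞ := measure_closedBall_lt_top.ne
  set G : Ω → ℝ≥0∞ := fun ω =>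
    2 ^ d * (ENNReal.ofReal (r + ρ) ^ d + ‖p 0 ω‖ₑ ^ d) * v / volume D with hG
  have key := lintegral_sq_tsum_le b h (a := fun v u => B.indicator (1 : E d → ℝ≥0∞) (u + v))
    ((measurable_one.indicator hB).comp (measurable_snd.add measurable_fst))
  simp_rw [perturbedLattice_apply b hB]
  refine key.trans_lt ?_
  have hcount : ∀ ω u, ∑' z : lattice b, {v | ‖v‖ ≤ ‖p 0 ω‖}.indicator
      (fun v => B.indicator (1 : E d → ℝ≥0∞) ((z : E d) + u + v)) (p z ω) ≤ G ω := by
    intro ω u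
    have h1 := tsum_indicator_le b (Metric.closedBall c (r + ‖p 0 ω‖))
      (Metric.closedBall c (r + ρ + ‖p 0 ω‖)) measurableSet_closedBall u (by
        intro y hy t ht
        rw [Metric.mem_closedBall, dist_eq_norm] at hy ⊢
        calc ‖y + t - c‖ = ‖(y - c) + t‖ := by congr 1; abel
          _ ≤ ‖y - c‖ + ‖t‖ := norm_add_le _ _
          _ ≤ _ := by linarith)
    refine le_trans (ENNReal.tsum_le_tsum fun z => ?_) (h1.trans ?_)
    · by_cases h3 : ‖p z ω‖ ≤ ‖p 0 ω‖
      · by_cases h4 : (z : E d) + u + p z ω ∈ B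
        · have : u + (z : E d) ∈ Metric.closedBall c (r + ‖p 0 ω‖) := by
            rw [Metric.mem_closedBall, dist_eq_norm] at *
            calc ‖u + (z : E d) - c‖ = ‖((z : E d) + u + p z ω - c) - p z ω‖ := by
                  congr 1; abel
              _ ≤ ‖(z : E d) + u + p z ω - c‖ + ‖p z ω‖ := norm_sub_le _ _
              _ ≤ _ := by linarith
          simp [h3, h4, this]
        · simp [Set.indicator_apply, h4]
      · simp [h3]
    · rw [volume_closedBall_eq _ (by positivity),
        ENNReal.ofReal_add (by positivity) (by positivity), ofReal_norm]
      simp only [hG]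
      gcongr
      exact ennreal_add_pow_le _ _ _
  have hint : ∫⁻ ω, (∫⁻ u, B.indicator (1 : E d → ℝ≥0∞) (u + p 0 ω) * ∑' z : lattice b,
        {v | ‖v‖ ≤ ‖p 0 ω‖}.indicator
          (fun v => B.indicator (1 : E d → ℝ≥0∞) ((z : E d) + u + v)) (p z ω)) ∂P ≤
      ∫⁻ ω, volume B * G ω ∂P := by
    refine lintegral_mono fun ω => ?_
    have hm : Measurable fun u => B.indicator (1 : E d → ℝ≥0∞) (u + p 0 ω) :=
      (measurable_one.indicator hB).comp (measurable_add_const _)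
    calc _ ≤ ∫⁻ u, B.indicator (1 : E d → ℝ≥0∞) (u + p 0 ω) * G ω :=
          lintegral_mono fun u => by gcongr; exact hcount ω u
      _ = _ := by
        rw [lintegral_mul_const _ hm,
          lintegral_add_right_eq_self (B.indicator (1 : E d → ℝ≥0∞)), lintegral_indicator_one hB]
  refine ENNReal.mul_lt_top (by simp) (ENNReal.div_lt_top (ne_of_lt (hint.trans_lt ?_)) hD0)
  rw [lintegral_const_mul' _ _ hBt]
  refine ENNReal.mul_lt_top hBt.lt_top ?_
  have hm : Measurable fun ω => ‖p 0 ω‖ₑ ^ d := (h.measurable_pert 0).enorm.pow_const d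
  have : ∀ ω, G ω = (2 ^ d * v / volume D) * (ENNReal.ofReal (r + ρ) ^ d + ‖p 0 ω‖ₑ ^ d) := by
    intro ω
    simp only [hG, div_eq_mul_inv]; ring
  have hc : 2 ^ d * v / volume D ≠ ∞ := ENNReal.div_ne_top (ENNReal.mul_ne_top (by simp) hv) hD0
  simp_rw [this]
  rw [lintegral_const_mul' _ _ hc, lintegral_add_left measurable_const]
  refine ENNReal.mul_lt_top hc.lt_top (ENNReal.add_lt_top.2 ⟨?_, hp⟩)
  simp

end FiniteVariance

/-! ### Stationary perturbations driven by a random phase -/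

section Construction

/-- The `d`-dimensional torus, the space of random phases. -/
abbrev Torus (d : ℕ) : Type := Fin d → UnitAddCircle

/-- The representative in `[0, 1)` of a point of the circle. -/
noncomputable def circleRep (w : UnitAddCircle) : ℝ := AddCircle.measurableEquivIco 1 0 w

lemma measurable_circleRep : Measurable circleRep :=
  measurable_subtype_coe.comp (AddCircle.measurableEquivIco 1 0).measurable

lemma circleRep_mem (w : UnitAddCircle) : 0 ≤ circleRep w ∧ circleRep w < 1 := by
  have h := (AddCircle.measurableEquivIco (1 : ℝ) 0 w).2
  simp only [zero_add] at h
  exact h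

lemma circleRep_coe {t : ℝ} (h0 : 0 ≤ t) (h1 : t < 1) : circleRep (t : UnitAddCircle) = t :=
  AddCircle.equivIco_coe_of_mem (p := (1 : ℝ)) (a := 0) (y := t) ⟨h0, by simpa using h1⟩

lemma coe_circleRep (w : UnitAddCircle) : ((circleRep w : ℝ) : UnitAddCircle) = w :=
  AddCircle.coe_equivIco (p := (1 : ℝ)) (a := 0)

/-- The circle representative is additive as long as the sum does not leave `[0, 1)`. -/
lemma circleRep_add {w : UnitAddCircle} {t : ℝ} (h0 : 0 ≤ circleRep w + t)
    (h1 : circleRep w + t < 1) : circleRep (w + (t : UnitAddCircle)) = circleRep w + t := by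
  rw [← circleRep_coe h0 h1, AddCircle.coe_add, coe_circleRep]

instance : IsProbabilityMeasure (volume : Measure UnitAddCircle) := ⟨UnitAddCircle.measure_univ⟩

instance (d : ℕ) : IsProbabilityMeasure (volume : Measure (Torus d)) :=
  inferInstanceAs (IsProbabilityMeasure (Measure.pi fun _ : Fin d => volume))

variable {d : ℕ} (b : Module.Basis (Fin d) ℝ (E d))
variable {Θ : Type v} [MeasurableSpace Θ] (μ : Measure Θ) [IsProbabilityMeasure μ]

/-- The phase shift of the lattice point `x` at inverse scale `s`. -/
noncomputable def phase (s : ℝ) (x : E d) : Torus d := fun i => ((s * x i : ℝ) : UnitAddCircle)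

lemma phase_add (s : ℝ) (x y : E d) : phase s (x + y) = phase s x + phase s y := by
  ext i
  simp [phase, mul_add]

lemma phase_zero (s : ℝ) : phase s (0 : E d) = 0 := by
  ext i
  simp [phase]

lemma measurable_phase (x : E d) : Measurable fun s => phase s x :=
  measurable_pi_lambda _ fun _ => AddCircle.measurable_mk'.comp (measurable_id.mul_const _)

/-- The law of a random parameter, an independent uniform phase and an independent uniform
shift. -/
noncomputable def phaseMeasure : Measure ((Θ × Torus d) × E d) :=
  (μ.prod volume).prod (ProbabilityTheory.cond volume (ZSpan.fundamentalDomain b))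

lemma isProbabilityMeasure_cond :
    IsProbabilityMeasure
      (ProbabilityTheory.cond volume (ZSpan.fundamentalDomain b) : Measure (E d)) :=
  cond_isProbabilityMeasure_of_finite (volume_fundamentalDomain_ne_zero b)
    (volume_fundamentalDomain_ne_top b)

instance : IsProbabilityMeasure (phaseMeasure b μ) := by
  have := isProbabilityMeasure_cond b
  unfold phaseMeasure
  infer_instance

/-- The perturbation read off a profile `F` on the torus, at inverse scale `m`, from a random
phase. -/
noncomputable def phasePert (m : Θ → ℝ) (F : Θ → Torus d → E d) (x : lattice b)
    (ω : (Θ × Torus d) × E d) : E d :=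
  F ω.1.1 (ω.1.2 + phase (m ω.1.1) (x : E d))

/-- Translating the lattice only translates the phase, which does not change its uniform law,
so such perturbations are stationary. -/
lemma isPerturbation_phasePert {m : Θ → ℝ} (hm : Measurable m) {F : Θ → Torus d → E d}
    (hF : Measurable (Function.uncurry F)) :
    IsPerturbation b (phaseMeasure b μ) (phasePert b m F) Prod.snd := by
  have := isProbabilityMeasure_cond b
  have hph : ∀ x : E d, Measurable fun q : Θ × Torus d => q.2 + phase (m q.1) x := fun x =>
    measurable_snd.add ((measurable_phase x).comp (hm.comp measurable_fst))
  have hmeas : ∀ x : lattice b, Measurable (phasePert b m F x) := fun x =>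
    measurable_comp₂ hF (measurable_fst.comp measurable_fst) ((hph x).comp measurable_fst)
  refine ⟨hmeas, measurable_snd, fun a => ?_, ?_, ?_⟩
  · have hS : MeasurePreserving
        (fun q : Θ × Torus d => (id q.1, q.2 + phase (m q.1) (a : E d)))
        (μ.prod volume) (μ.prod volume) := by
      refine (MeasurePreserving.id μ).skew_product
        (g := fun θ w => w + phase (m θ) (a : E d)) (hph a) (Eventually.of_forall fun θ => ?_)
      exact (measurePreserving_add_right volume _).map_eq
    have hT := hS.prod (MeasurePreserving.id
      (ProbabilityTheory.cond volume (ZSpan.fundamentalDomain b)))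
    have hfield : Measurable fun ω (x : lattice b) => phasePert b m F x ω :=
      measurable_pi_lambda _ hmeas
    have heq : (fun ω (x : lattice b) => phasePert b m F (x + a) ω) =
        (fun ω (x : lattice b) => phasePert b m F x ω) ∘
          Prod.map (fun q : Θ × Torus d => (id q.1, q.2 + phase (m q.1) (a : E d))) id := by
      funext ω x
      simp only [phasePert, Function.comp_apply, Prod.map_fst, id]
      congr 1
      rw [Submodule.coe_add, phase_add, add_assoc, add_comm (phase _ (x : E d))]
    refine ⟨hfield.aemeasurable, (measurable_pi_lambda _ fun x => hmeas _).aemeasurable, ?_⟩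
    rw [heq, ← Measure.map_map hfield hT.measurable]
    congr 1
    exact hT.map_eq.symm
  · exact measurePreserving_snd.map_eq
  · have := indepFun_prod (μ := μ.prod (volume : Measure (Torus d)))
      (ν := ProbabilityTheory.cond volume (ZSpan.fundamentalDomain b))
      (X := fun (q : Θ × Torus d) (x : lattice b) => F q.1 (q.2 + phase (m q.1) (x : E d)))
      (Y := id)
      (measurable_pi_lambda _ fun x => measurable_comp₂ hF measurable_fst (hph x)) measurable_id
    exact this

end Construction

/-! ### The integer lattice -/

section StdLattice

variable {d : ℕ}

lemma stdBasis_repr (x : E d) (i : Fin d) : (stdBasis d).repr x i = x i := by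
  simp [stdBasis]

lemma mem_fundamentalDomain_std {x : E d} :
    x ∈ ZSpan.fundamentalDomain (stdBasis d) ↔ ∀ i, 0 ≤ x i ∧ x i < 1 := by
  simp [ZSpan.mem_fundamentalDomain]

lemma exists_int_coord (x : lattice (stdBasis d)) (i : Fin d) : ∃ k : ℤ, (x : E d) i = k := by
  obtain ⟨k, hk⟩ := ((stdBasis d).mem_span_iff_repr_mem ℤ (x : E d)).1 x.2 i
  exact ⟨k, by simpa [stdBasis_repr] using hk.symm⟩

/-- The point of the integer lattice with given coordinates. -/
noncomputable def intPoint (k : Fin d → ℤ) : lattice (stdBasis d) :=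
  ⟨WithLp.toLp 2 fun i => (k i : ℝ), ((stdBasis d).mem_span_iff_repr_mem ℤ _).2 fun i =>
    ⟨k i, by simp⟩⟩

lemma intPoint_apply (k : Fin d → ℤ) (i : Fin d) : (intPoint k : E d) i = k i := rfl

lemma intPoint_injective : Function.Injective (intPoint (d := d)) := fun k l h => by
  ext i
  have := congrArg (fun x : lattice (stdBasis d) => (x : E d) i) h
  simpa [intPoint_apply] using this

lemma volume_fundamentalDomain_std :
    volume (ZSpan.fundamentalDomain (stdBasis d)) = 1 := by
  rw [measure_congr (ZSpan.fundamentalDomain_ae_parallelepiped (stdBasis d) volume)]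
  simpa [stdBasis] using (EuclideanSpace.basisFun (Fin d) ℝ).volume_parallelepiped

end StdLattice

/-! ### Infinite number variance: sawtooth profiles -/

section InfiniteVariance

variable {d : ℕ}

/-- The sawtooth profile: at scale `M` it brings every point of a cube of side `M` to the lower
corner of the cube. -/
noncomputable def sawtooth (M : ℝ) (w : Torus d) : E d :=
  WithLp.toLp 2 fun i => -(M * circleRep (w i))

lemma measurable_sawtooth {Θ : Type v} [MeasurableSpace Θ] {M : Θ → ℝ} (hM : Measurable M) :
    Measurable (Function.uncurry fun θ (w : Torus d) => sawtooth (M θ) w) := by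
  refine (WithLp.measurable_toLp 2 _).comp (measurable_pi_lambda _ fun i => ?_)
  exact ((hM.comp measurable_fst).mul (measurable_circleRep.comp
    ((measurable_pi_apply i).comp measurable_snd))).neg

lemma norm_sawtooth_le {M : ℝ} (hM : 0 ≤ M) (w : Torus d) : ‖sawtooth M w‖ ≤ √d * M := by
  rw [EuclideanSpace.norm_eq, Real.sqrt_le_left (by positivity), mul_pow, Real.sq_sqrt (by simp)]
  calc ∑ i, ‖sawtooth M w i‖ ^ 2 ≤ ∑ _i : Fin d, M ^ 2 := by
        refine Finset.sum_le_sum fun i _ => ?_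
        have h := circleRep_mem (w i)
        simp only [sawtooth, Real.norm_eq_abs, sq_abs, neg_sq, mul_pow]
        have : circleRep (w i) ^ 2 ≤ 1 := pow_le_one₀ h.1 h.2.le
        nlinarith [sq_nonneg M]
    _ = _ := by simp

/-- At scale `M`, at least `(M - 1) ^ d` points are brought to the same place as the origin. -/
lemma le_tsum_sawtooth (M : ℝ) (w : Torus d) (B : Set (E d)) (u : E d)
    (hu : u + sawtooth M w ∈ B) :
    ENNReal.ofReal (M - 1) ^ d ≤ ∑' z : lattice (stdBasis d), B.indicator (1 : E d → ℝ≥0∞)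
      ((z : E d) + u + sawtooth M (w + phase M⁻¹ (z : E d))) := by
  rcases le_or_gt M 1 with hM | hM
  · rcases Nat.eq_zero_or_pos d with rfl | hd
    · rw [pow_zero]
      refine le_trans ?_ (ENNReal.le_tsum 0)
      have : ((0 : lattice (stdBasis 0)) : E 0) + u +
          sawtooth M (w + phase M⁻¹ ((0 : lattice (stdBasis 0)) : E 0)) ∈ B :=
        Set.mem_of_eq_of_mem (Subsingleton.elim _ _) hu
      rw [Set.indicator_of_mem this]
      simp
    · rw [ENNReal.ofReal_of_nonpos (by linarith), zero_pow hd.ne']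
      exact zero_le
  have hM0 : 0 < M := by linarith
  set τ : Fin d → ℝ := fun i => circleRep (w i) with hτ
  set I : Fin d → Finset ℤ := fun i => Finset.Ico ⌈-(M * τ i)⌉ ⌈M * (1 - τ i)⌉ with hI
  set S := Fintype.piFinset I with hS
  have hcard : ENNReal.ofReal (M - 1) ^ d ≤ (S.card : ℝ≥0∞) := by
    rw [Fintype.card_piFinset]
    push_cast
    calc ENNReal.ofReal (M - 1) ^ d = ∏ _i : Fin d, ENNReal.ofReal (M - 1) := by simp
      _ ≤ _ := by
        refine Finset.prod_le_prod' fun i _ => ?_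
        rw [← ENNReal.ofReal_natCast]
        refine ENNReal.ofReal_le_ofReal ?_
        have h1 := Int.ceil_lt_add_one (-(M * τ i))
        have h2 := Int.le_ceil (M * (1 - τ i))
        have h3 : ((⌈M * (1 - τ i)⌉ - ⌈-(M * τ i)⌉ : ℤ) : ℝ) ≤ ((I i).card : ℝ) := by
          rw [hI, Int.card_Ico]
          exact_mod_cast Int.self_le_toNat _
        push_cast at h3
        linarith
  have hmem : ∀ k ∈ S, (intPoint k : E d) + u +
      sawtooth M (w + phase M⁻¹ (intPoint k : E d)) ∈ B := by
    intro k hk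
    convert hu using 1
    ext i
    have hki := Fintype.mem_piFinset.1 hk i
    rw [hI, Finset.mem_Ico, Int.ceil_le, Int.lt_ceil] at hki
    have hrep : circleRep (w i + ((M⁻¹ * (k i : ℝ) : ℝ) : UnitAddCircle)) =
        τ i + M⁻¹ * k i := by
      have e : M⁻¹ * (k i : ℝ) = k i / M := by field_simp
      apply circleRep_add
      · change 0 ≤ τ i + _
        have : -τ i ≤ k i / M := by rw [le_div_iff₀ hM0]; linarith
        rw [e]; linarith
      · change τ i + _ < 1
        have : k i / M < 1 - τ i := by rw [div_lt_iff₀ hM0]; linarith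
        rw [e]; linarith
    simp only [sawtooth, PiLp.add_apply, phase, Pi.add_apply, intPoint_apply]
    rw [hrep]
    field_simp
    ring
  calc ENNReal.ofReal (M - 1) ^ d ≤ (S.card : ℝ≥0∞) := hcard
    _ = ∑ k ∈ S, (fun z : lattice (stdBasis d) => B.indicator (1 : E d → ℝ≥0∞)
        ((z : E d) + u + sawtooth M (w + phase M⁻¹ (z : E d)))) (intPoint k) := by
        rw [Finset.sum_congr rfl fun k hk => Set.indicator_of_mem (hmem k hk) _]
        simp
    _ = ∑ z ∈ S.map ⟨intPoint, intPoint_injective⟩, B.indicator (1 : E d → ℝ≥0∞)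
        ((z : E d) + u + sawtooth M (w + phase M⁻¹ (z : E d))) := by
        rw [Finset.sum_map]; rfl
    _ ≤ _ := ENNReal.sum_le_tsum _

/-- The points brought together by a sawtooth of random scale `M` make the second moment at least
the volume of the ball times the mean of `(M - 1) ^ d`. -/
lemma numberVariance_sawtooth {Θ : Type v} [MeasurableSpace Θ] (μ : Measure Θ)
    [IsProbabilityMeasure μ] {M : Θ → ℝ} (hM : Measurable M)
    (hint : ∫⁻ θ, ENNReal.ofReal (M θ - 1) ^ d ∂μ = ∞) (c : E d) {r : ℝ} (hr : 0 < r) :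
    numberVariance (stdBasis d) (phaseMeasure (stdBasis d) μ)
      (phasePert (stdBasis d) (fun θ => (M θ)⁻¹) fun θ w => sawtooth (M θ) w) Prod.snd
      (Metric.closedBall c r) = ∞ := by
  have h := isPerturbation_phasePert (stdBasis d) μ hM.inv (measurable_sawtooth (d := d) hM)
  set B := Metric.closedBall c r with hBdef
  have hB : MeasurableSet B := measurableSet_closedBall
  have hBt : volume B ≠ ∞ := measure_closedBall_lt_top.ne
  by_contra hne
  have h1 := (numberVariance_lt_top_iff (stdBasis d) h hB hBt).1 (lt_top_iff_ne_top.2 hne)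
  simp_rw [perturbedLattice_apply (stdBasis d) hB] at h1
  rw [lintegral_sq_tsum (stdBasis d) h
    (a := fun v u => B.indicator (1 : E d → ℝ≥0∞) (u + v))
    ((measurable_one.indicator hB).comp (measurable_snd.add measurable_fst)),
    volume_fundamentalDomain_std, div_one] at h1
  refine h1.ne (top_unique ?_)
  have hfst : MeasurePreserving (fun ω : (Θ × Torus d) × E d => ω.1.1)
      (phaseMeasure (stdBasis d) μ) μ := by
    have := isProbabilityMeasure_cond (stdBasis d)
    exact (measurePreserving_fst (μ := μ) (ν := (volume : Measure (Torus d)))).comp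
      measurePreserving_fst
  have hfm : Measurable fun θ => ENNReal.ofReal (M θ - 1) ^ d :=
    (hM.sub_const 1).ennreal_ofReal.pow_const d
  calc (∞ : ℝ≥0∞) = volume B * ∫⁻ θ, ENNReal.ofReal (M θ - 1) ^ d ∂μ := by
        rw [hint, ENNReal.mul_top (Metric.measure_closedBall_pos volume c hr).ne']
    _ = ∫⁻ ω, volume B * ENNReal.ofReal (M ω.1.1 - 1) ^ d ∂(phaseMeasure (stdBasis d) μ) := by
        rw [lintegral_const_mul' _ _ hBt]
        congr 1
        exact (hfst.lintegral_comp hfm).symm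
    _ ≤ _ := by
        refine lintegral_mono fun ω => ?_
        set q := phasePert (stdBasis d) (fun θ => (M θ)⁻¹) (fun θ w => sawtooth (M θ) w) 0 ω
          with hq
        have hq' : q = sawtooth (M ω.1.1) ω.1.2 := by simp [hq, phasePert, phase_zero]
        have hm : Measurable fun u => B.indicator (1 : E d → ℝ≥0∞) (u + q) :=
          (measurable_one.indicator hB).comp (measurable_add_const _)
        calc volume B * ENNReal.ofReal (M ω.1.1 - 1) ^ d
            = ∫⁻ u, B.indicator (1 : E d → ℝ≥0∞) (u + q) * ENNReal.ofReal (M ω.1.1 - 1) ^ d := by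
              rw [lintegral_mul_const _ hm,
                lintegral_add_right_eq_self (B.indicator (1 : E d → ℝ≥0∞)),
                lintegral_indicator_one hB]
          _ ≤ _ := by
              refine lintegral_mono fun u => ?_
              by_cases hu : u + q ∈ B
              · exact mul_le_mul' le_rfl (le_tsum_sawtooth _ _ B u (hq' ▸ hu))
              · simp [hu]

lemma lintegral_ofReal_div_sub_one {Ω₀ : Type v} [MeasurableSpace Ω₀] (P₀ : Measure Ω₀)
    [IsProbabilityMeasure P₀] {X : Ω₀ → ℝ} {s : ℝ} (hs : 0 < s)
    (hint : ∫⁻ ω, ENNReal.ofReal (X ω) ^ d ∂P₀ = ∞) :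
    ∫⁻ ω, ENNReal.ofReal (X ω / s - 1) ^ d ∂P₀ = ∞ := by
  by_contra hne
  have hle : ∀ ω, ENNReal.ofReal (X ω) ^ d ≤
      (ENNReal.ofReal s ^ d * 2 ^ d) * (ENNReal.ofReal (X ω / s - 1) ^ d + 1) := by
    intro ω
    have : ENNReal.ofReal (X ω) ≤ ENNReal.ofReal s * (ENNReal.ofReal (X ω / s - 1) + 1) := by
      rw [← ENNReal.ofReal_one]
      calc ENNReal.ofReal (X ω) = ENNReal.ofReal (s * ((X ω / s - 1) + 1)) := by
            congr 1; field_simp; ring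
        _ = ENNReal.ofReal s * ENNReal.ofReal ((X ω / s - 1) + 1) :=
            ENNReal.ofReal_mul hs.le
        _ ≤ _ := by gcongr; exact ENNReal.ofReal_add_le
    calc ENNReal.ofReal (X ω) ^ d
        ≤ (ENNReal.ofReal s * (ENNReal.ofReal (X ω / s - 1) + 1)) ^ d := by gcongr
      _ = ENNReal.ofReal s ^ d * (ENNReal.ofReal (X ω / s - 1) + 1) ^ d := mul_pow _ _ _
      _ ≤ ENNReal.ofReal s ^ d * (2 ^ d * (ENNReal.ofReal (X ω / s - 1) ^ d + 1 ^ d)) := by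
          gcongr; exact ennreal_add_pow_le _ _ _
      _ = _ := by rw [one_pow, mul_assoc]
  have h2 := lintegral_mono (μ := P₀) hle
  have hc : ENNReal.ofReal s ^ d * 2 ^ d ≠ ∞ := ENNReal.mul_ne_top (by simp) (by simp)
  rw [hint, lintegral_const_mul' _ _ hc, lintegral_add_right _ measurable_const] at h2
  refine (ENNReal.mul_lt_top hc.lt_top (ENNReal.add_lt_top.2 ⟨lt_top_iff_ne_top.2 hne, ?_⟩)).ne
    (top_unique h2)
  simp

/-- The sawtooth perturbation at scale `X / √d` is dominated by `X`. -/
theorem exists_dominated_infinite_variance (hd : 1 ≤ d) (Ω₀ : Type v) [MeasurableSpace Ω₀]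
    (P₀ : Measure Ω₀) [IsProbabilityMeasure P₀] (X : Ω₀ → ℝ) (hX : Measurable X)
    (hX0 : ∀ᵐ ω ∂P₀, 0 ≤ X ω) (hint : ∫⁻ ω, ENNReal.ofReal (X ω) ^ d ∂P₀ = ∞) :
    ∃ (Ω : Type v) (_ : MeasurableSpace Ω) (P : Measure Ω) (_ : IsProbabilityMeasure P)
      (π : Ω → Ω₀) (p : lattice (stdBasis d) → Ω → E d) (U : Ω → E d),
      MeasurePreserving π P P₀ ∧ IsPerturbation (stdBasis d) P p U ∧
      (∀ᵐ ω ∂P, ‖p 0 ω‖ ≤ X (π ω)) ∧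
      ∀ (c : E d) (r : ℝ), 0 < r →
        numberVariance (stdBasis d) P p U (Metric.closedBall c r) = ∞ := by
  have hd' : 0 < √(d : ℝ) := Real.sqrt_pos.2 (by exact_mod_cast hd)
  have hM : Measurable fun ω => X ω / √(d : ℝ) := hX.div_const _
  have hfst : MeasurePreserving (fun ω : (Ω₀ × Torus d) × E d => ω.1.1)
      (phaseMeasure (stdBasis d) P₀) P₀ := by
    have := isProbabilityMeasure_cond (stdBasis d)
    exact (measurePreserving_fst (μ := P₀) (ν := (volume : Measure (Torus d)))).comp
      measurePreserving_fst
  refine ⟨_, inferInstance, phaseMeasure (stdBasis d) P₀, inferInstance, fun ω => ω.1.1,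
    phasePert (stdBasis d) (fun ω => (X ω / √(d : ℝ))⁻¹) fun ω w => sawtooth (X ω / √(d : ℝ)) w,
    Prod.snd, hfst, isPerturbation_phasePert (stdBasis d) P₀ hM.inv (measurable_sawtooth hM),
    ?_, fun c r hr => numberVariance_sawtooth P₀ hM (lintegral_ofReal_div_sub_one P₀ hd' hint)
      c hr⟩
  filter_upwards [hfst.quasiMeasurePreserving.ae hX0] with ω hω
  refine (norm_sawtooth_le (div_nonneg hω hd'.le) _).trans_eq ?_
  field_simp

end InfiniteVariance

/-! ### Large number variance in dimension at least three: square waves -/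

section LargeVariance

variable {d : ℕ}

/-- Jensen's inequality for the square, for functions with values in `[0, ∞]`. -/
lemma sq_le_lintegral_sq {α : Type*} [MeasurableSpace α] (ν : Measure α) [IsProbabilityMeasure ν]
    {f : α → ℝ≥0∞} (hf : Measurable f) (κ : ℝ) (hκ : ENNReal.ofReal κ ≤ ∫⁻ x, f x ∂ν) :
    ENNReal.ofReal κ ^ 2 ≤ ∫⁻ x, f x ^ 2 ∂ν := by
  set k := ENNReal.ofReal κ
  have hk : k ^ 2 ≠ ∞ := by simp [k]
  have h1 : ∀ x, 2 * k * f x ≤ f x ^ 2 + k ^ 2 := fun x => by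
    rcases eq_or_ne (f x) ∞ with h | h
    · simp [h]
    · lift f x to NNReal using h with y
      rw [show k = ((κ.toNNReal : NNReal) : ℝ≥0∞) from rfl]
      norm_cast
      rw [mul_right_comm]
      rw [← NNReal.coe_le_coe]
      push_cast
      nlinarith [sq_nonneg ((y : ℝ) - (κ.toNNReal : ℝ))]
  have h2 := lintegral_mono (μ := ν) h1
  rw [lintegral_const_mul _ hf, lintegral_add_right _ measurable_const] at h2
  simp only [lintegral_const, measure_univ, mul_one] at h2
  have h3 : k ^ 2 + k ^ 2 ≤ (∫⁻ x, f x ^ 2 ∂ν) + k ^ 2 := by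
    refine le_trans ?_ h2
    calc k ^ 2 + k ^ 2 = 2 * k * k := by ring
      _ ≤ _ := by gcongr
  exact (ENNReal.add_le_add_iff_right hk).1 h3

/-- The square wave profile: it pushes points by `ε` along one axis, forwards in the first half
of the period and backwards in the second half, so that points accumulate in the middle. -/
noncomputable def squareWave (i₀ : Fin d) (ε : ℝ) (w : Torus d) : E d :=
  EuclideanSpace.single i₀ (if circleRep (w i₀) < 1 / 2 then ε else -ε)

lemma measurable_squareWave (i₀ : Fin d) (ε : ℝ) : Measurable (squareWave i₀ ε) := by
  have h : Measurable fun w : Torus d => if circleRep (w i₀) < 1 / 2 then ε else -ε :=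
    Measurable.ite (measurableSet_lt (measurable_circleRep.comp (measurable_pi_apply i₀))
      measurable_const) measurable_const measurable_const
  have h2 : Measurable fun t : ℝ => (EuclideanSpace.single i₀ t : E d) := by
    refine (WithLp.measurable_toLp 2 _).comp ?_
    exact measurable_pi_lambda _ fun i => by
      by_cases hi : i = i₀
      · subst hi; simpa using measurable_id'
      · simp [hi]
  exact h2.comp h

lemma norm_squareWave (i₀ : Fin d) {ε : ℝ} (hε : 0 < ε) (w : Torus d) :
    ‖squareWave i₀ ε w‖ = ε := by
  rw [squareWave, PiLp.norm_single]
  split_ifs <;> simp [abs_of_pos hε]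

lemma volume_coord_box (I : Fin d → Set ℝ) :
    volume {y : E d | ∀ i, y i ∈ I i} = ∏ i, volume (I i) := by
  rw [← volume_pi_pi]
  have h :=
    (EuclideanSpace.volume_preserving_symm_measurableEquiv_toLp (Fin d)).measure_preimage_equiv
      (Set.univ.pi I)
  rw [← h]
  congr 1
  ext y
  simp [Set.mem_pi]

/-- A slab of half-width `ε` at height at most `r / 2 + 1` cuts off a set of volume of order
`ε r ^ (d - 1)` from the ball of radius `r`. -/
lemma volume_slab_ge (i₀ : Fin d) {ε r n : ℝ} (hε : 0 < ε) (hε1 : ε ≤ 1) (hr : 8 ≤ r)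
    (hn : |n| ≤ r / 2 + 1) (hd : 3 ≤ d) :
    ENNReal.ofReal (2 * ε * (r / d) ^ (d - 1)) ≤
      volume (Metric.closedBall (0 : E d) r ∩ {y | n - ε ≤ y i₀ ∧ y i₀ < n + ε}) := by
  have hd0 : (0 : ℝ) < d := by positivity
  have hd3 : (3 : ℝ) ≤ d := by exact_mod_cast hd
  set I : Fin d → Set ℝ := fun i =>
    if i = i₀ then Set.Ico (n - ε) (n + ε) else Set.Icc (-(r / (2 * d))) (r / (2 * d)) with hI
  have hsub : {y : E d | ∀ i, y i ∈ I i} ⊆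
      Metric.closedBall (0 : E d) r ∩ {y | n - ε ≤ y i₀ ∧ y i₀ < n + ε} := by
    intro y hy
    have h0 : n - ε ≤ y i₀ ∧ y i₀ < n + ε := by simpa [hI] using hy i₀
    refine ⟨?_, h0⟩
    rw [mem_closedBall_zero_iff, EuclideanSpace.norm_eq, Real.sqrt_le_left (by linarith),
      ← Finset.add_sum_erase _ _ (Finset.mem_univ i₀)]
    have hn' := abs_le.1 hn
    have h1 : ‖y i₀‖ ^ 2 ≤ (3 / 4 * r) ^ 2 := by
      gcongr
      rw [Real.norm_eq_abs, abs_le]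
      constructor <;> linarith [h0.1, h0.2, hn'.1, hn'.2]
    have h2 : ∑ i ∈ Finset.univ.erase i₀, ‖y i‖ ^ 2 ≤
        ∑ _i ∈ Finset.univ.erase i₀, (r / (2 * d)) ^ 2 := by
      refine Finset.sum_le_sum fun i hi => ?_
      have hyi := hy i
      simp only [hI, Finset.ne_of_mem_erase hi, if_false] at hyi
      gcongr
      rw [Real.norm_eq_abs, abs_le]
      exact hyi
    have h3 : ∑ _i ∈ Finset.univ.erase i₀, (r / (2 * d)) ^ 2 ≤ r ^ 2 / 12 := by
      rw [Finset.sum_const, Finset.card_erase_of_mem (Finset.mem_univ _), Finset.card_univ,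
        Fintype.card_fin, nsmul_eq_mul]
      have : ((d - 1 : ℕ) : ℝ) ≤ d := by exact_mod_cast Nat.sub_le d 1
      calc ((d - 1 : ℕ) : ℝ) * (r / (2 * d)) ^ 2 ≤ d * (r / (2 * d)) ^ 2 := by gcongr
        _ = r ^ 2 / (4 * d) := by field_simp; ring
        _ ≤ r ^ 2 / 12 := by gcongr; linarith
    nlinarith [sq_nonneg r]
  refine le_trans (le_of_eq ?_) (measure_mono hsub)
  rw [volume_coord_box, ← Finset.mul_prod_erase _ _ (Finset.mem_univ i₀)]
  have h4 : ∀ i ∈ Finset.univ.erase i₀, volume (I i) = ENNReal.ofReal (r / d) := by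
    intro i hi
    simp only [hI, Finset.ne_of_mem_erase hi, if_false, Real.volume_Icc]
    congr 1
    field_simp
    ring
  rw [Finset.prod_congr rfl h4, Finset.prod_const, Finset.card_erase_of_mem (Finset.mem_univ _),
    Finset.card_univ, Fintype.card_fin, ENNReal.ofReal_mul (by positivity),
    ENNReal.ofReal_pow (by positivity)]
  congr 1
  simp only [hI, if_true, Real.volume_Ico]
  congr 1
  ring

/-- When the middle of the period lies at height less than `r / 2`, averaging over the uniform
shift shows an excess of points in the ball, namely the volume of a slab. -/
lemma mean_excess (i₀ : Fin d) {ε r s : ℝ} (hε : 0 < ε) (hε1 : ε ≤ 1) (hr : 8 ≤ r) (hd : 3 ≤ d)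
    (hs1 : 1 / (9 * r) ≤ s) (hs2 : s ≤ 1 / (4 * r)) (w : Torus d)
    (hw : |circleRep (w i₀) - 1 / 2| ≤ 1 / 18) :
    volume (Metric.closedBall (0 : E d) r) + ENNReal.ofReal (2 * ε * (r / d) ^ (d - 1)) ≤
      ∫⁻ t in ZSpan.fundamentalDomain (stdBasis d), ∑' x : lattice (stdBasis d),
        (Metric.closedBall (0 : E d) r).indicator (1 : E d → ℝ≥0∞)
          ((x : E d) + t + squareWave i₀ ε (w + phase s (x : E d))) := by
  set B := Metric.closedBall (0 : E d) r with hBdef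
  have hB : MeasurableSet B := measurableSet_closedBall
  have hr0 : 0 < r := by linarith
  have hs0 : 0 < s := lt_of_lt_of_le (by positivity) hs1
  set τ := circleRep (w i₀) with hτ
  set c := (1 / 2 - τ) / s with hc
  set n : ℝ := (⌈c⌉ : ℝ) with hn
  have hw' := abs_le.1 hw
  have hsr : 1 / 18 ≤ s * (r / 2) := by
    rw [div_le_iff₀ (by positivity)] at hs1
    linarith
  have hcabs : |c| ≤ r / 2 := by
    rw [abs_le, hc, le_div_iff₀ hs0, div_le_iff₀ hs0]
    constructor <;> nlinarith [hw'.1, hw'.2]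
  have hcabs' := abs_le.1 hcabs
  have hnabs : |n| ≤ r / 2 + 1 := by
    have h1 := Int.ceil_lt_add_one c
    have h2 := Int.le_ceil c
    rw [abs_le]
    constructor <;> linarith [hcabs'.1, hcabs'.2]
  set e : E d := EuclideanSpace.single i₀ ε with he
  have hei : e i₀ = ε := by simp [he]
  have hnorm_e : ‖e‖ = ε := by simp [he, abs_of_pos hε]
  set H1 : Set (E d) := {y | y i₀ < n + ε} with hH1
  set H2 : Set (E d) := {y | n - ε ≤ y i₀} with hH2
  have hco : Measurable fun y : E d => y i₀ :=
    (measurable_pi_apply i₀).comp (WithLp.measurable_ofLp 2 _)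
  have hH1m : MeasurableSet H1 := measurableSet_lt hco measurable_const
  have hH2m : MeasurableSet H2 := measurableSet_le measurable_const hco
  set g : E d → ℝ≥0∞ := fun y => (B ∩ H1).indicator (1 : E d → ℝ≥0∞) (y + e) +
    (B ∩ H2).indicator (1 : E d → ℝ≥0∞) (y - e) with hg
  have hpoint : ∀ x : lattice (stdBasis d), ∀ t ∈ ZSpan.fundamentalDomain (stdBasis d),
      g ((x : E d) + t) ≤ B.indicator (1 : E d → ℝ≥0∞)
        ((x : E d) + t + squareWave i₀ ε (w + phase s (x : E d))) := by
    intro x t ht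
    obtain ⟨k, hk⟩ := exists_int_coord x i₀
    have ht0 := mem_fundamentalDomain_std.1 ht i₀
    -- points moved into the ball have small height, hence a phase in the same period
    have hphase : |(k : ℝ)| ≤ r + 2 → circleRep ((w + phase s (x : E d)) i₀) = τ + s * k := by
      intro hkr
      have hk' := abs_le.1 hkr
      have hsr2 : s * (r + 2) ≤ 3 / 8 := by
        rw [le_div_iff₀ (by positivity)] at hs2
        have : s * 2 ≤ s * r / 4 := by nlinarith
        linarith
      rw [Pi.add_apply, phase, hk]
      apply circleRep_add
      · have : -(s * (r + 2)) ≤ s * k := by nlinarith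
        linarith [hw'.1]
      · have : s * k ≤ s * (r + 2) := by nlinarith
        linarith [hw'.2]
    have hiff : ((x : E d) + t) i₀ < n ↔ τ + s * k < 1 / 2 := by
      have h1 : ((x : E d) + t) i₀ < n ↔ k < ⌈c⌉ := by
        rw [PiLp.add_apply, hk, hn]
        constructor
        · intro h
          have : (k : ℝ) < ⌈c⌉ := by linarith [ht0.1]
          exact_mod_cast this
        · intro h
          have : (k : ℝ) + 1 ≤ ⌈c⌉ := by exact_mod_cast h
          linarith [ht0.2]
      rw [h1, Int.lt_ceil, hc, lt_div_iff₀ hs0]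
      constructor <;> intro h <;> linarith
    have hkbound : ∀ σ : E d, ‖σ‖ = ε → (x : E d) + t + σ ∈ B → |(k : ℝ)| ≤ r + 2 := by
      intro σ hσ h
      rw [hBdef, mem_closedBall_zero_iff] at h
      have h1 : ‖((x : E d) + t) i₀‖ ≤ r + 1 := by
        refine (PiLp.norm_apply_le _ _).trans ?_
        calc ‖(x : E d) + t‖ = ‖((x : E d) + t + σ) - σ‖ := by congr 1; abel
          _ ≤ ‖(x : E d) + t + σ‖ + ‖σ‖ := norm_sub_le _ _
          _ ≤ r + 1 := by linarith
      rw [PiLp.add_apply, hk, Real.norm_eq_abs, abs_le] at h1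
      rw [abs_le]
      constructor <;> linarith [h1.1, h1.2, ht0.1, ht0.2]
    by_cases hlt : ((x : E d) + t) i₀ < n
    · have h2 : (x : E d) + t - e ∉ B ∩ H2 := by
        rintro ⟨-, h⟩
        have : n - ε ≤ ((x : E d) + t) i₀ - ε := by simpa [hH2, he] using h
        linarith
      simp only [hg, Set.indicator_of_notMem h2, add_zero]
      by_cases h1 : (x : E d) + t + e ∈ B ∩ H1
      · have hsq : squareWave i₀ ε (w + phase s (x : E d)) = e := by
          rw [squareWave, hphase (hkbound e hnorm_e h1.1), if_pos (hiff.1 hlt)]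
        rw [hsq, Set.indicator_of_mem h1, Set.indicator_of_mem h1.1]
      · rw [Set.indicator_of_notMem h1]; exact zero_le
    · have h2 : (x : E d) + t + e ∉ B ∩ H1 := by
        rintro ⟨-, h⟩
        have : ((x : E d) + t) i₀ + ε < n + ε := by simpa [hH1, he] using h
        exact hlt (by linarith)
      simp only [hg, Set.indicator_of_notMem h2, zero_add]
      by_cases h1 : (x : E d) + t - e ∈ B ∩ H2
      · have hsq : squareWave i₀ ε (w + phase s (x : E d)) = -e := by
          rw [squareWave, hphase (hkbound (-e) (by rw [norm_neg, hnorm_e])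
            (by rw [← sub_eq_add_neg]; exact h1.1)), if_neg (fun h => hlt (hiff.2 h)), he]
          ext i
          by_cases hi : i = i₀ <;> simp [hi]
        rw [hsq, ← sub_eq_add_neg, Set.indicator_of_mem h1, Set.indicator_of_mem h1.1]
      · rw [Set.indicator_of_notMem h1]; exact zero_le
  have hgint : ∫⁻ y, g y = volume (B ∩ H1) + volume (B ∩ H2) := by
    simp only [hg]
    have hm : Measurable fun y => (B ∩ H1).indicator (1 : E d → ℝ≥0∞) (y + e) :=
      (measurable_one.indicator (hB.inter hH1m)).comp (measurable_add_const _)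
    rw [lintegral_add_left hm,
      lintegral_add_right_eq_self ((B ∩ H1).indicator (1 : E d → ℝ≥0∞)),
      lintegral_sub_right_eq_self ((B ∩ H2).indicator (1 : E d → ℝ≥0∞)),
      lintegral_indicator_one (hB.inter hH1m), lintegral_indicator_one (hB.inter hH2m)]
  have hunion : (B ∩ H1) ∪ (B ∩ H2) = B := by
    rw [← Set.inter_union_distrib_left]
    refine Set.inter_eq_left.2 fun y _ => ?_
    rcases lt_or_ge (y i₀) (n + ε) with h | h
    · exact Or.inl h
    · exact Or.inr (show n - ε ≤ y i₀ by linarith)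
  have hinter : (B ∩ H1) ∩ (B ∩ H2) = B ∩ {y | n - ε ≤ y i₀ ∧ y i₀ < n + ε} := by
    ext y
    simp only [hH1, hH2, Set.mem_inter_iff]
    exact ⟨fun h => ⟨h.1.1, h.2.2, h.1.2⟩, fun h => ⟨⟨h.1, h.2.2⟩, h.1, h.2.1⟩⟩
  calc volume B + ENNReal.ofReal (2 * ε * (r / d) ^ (d - 1))
      ≤ volume B + volume (B ∩ {y | n - ε ≤ y i₀ ∧ y i₀ < n + ε}) := by
        gcongr
        exact volume_slab_ge i₀ hε hε1 hr hnabs hd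
    _ = ∫⁻ y, g y := by
        rw [hgint, ← measure_union_add_inter _ (hB.inter hH2m), hunion, hinter]
    _ = ∑' x : lattice (stdBasis d), ∫⁻ t in ZSpan.fundamentalDomain (stdBasis d),
          g ((x : E d) + t) := lintegral_eq_tsum_lattice _ g
    _ ≤ ∑' x : lattice (stdBasis d), ∫⁻ t in ZSpan.fundamentalDomain (stdBasis d),
          B.indicator (1 : E d → ℝ≥0∞)
            ((x : E d) + t + squareWave i₀ ε (w + phase s (x : E d))) :=
        ENNReal.tsum_le_tsum fun x => setLIntegral_mono_ae'
          (ZSpan.fundamentalDomain_measurableSet _) (Eventually.of_forall fun t ht => hpoint x t ht)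
    _ = _ := by
        rw [lintegral_tsum]
        intro x
        exact ((measurable_one.indicator hB).comp
          ((measurable_const_add _).add_const _)).aemeasurable

lemma volume_circleRep_near : ENNReal.ofReal (1 / 9) ≤
    volume {w : UnitAddCircle | |circleRep w - 1 / 2| ≤ 1 / 18} := by
  have hm : MeasurableSet {w : UnitAddCircle | |circleRep w - 1 / 2| ≤ 1 / 18} :=
    measurableSet_le ((measurable_circleRep.sub_const _).norm) measurable_const
  rw [← (UnitAddCircle.measurePreserving_mk 0).measure_preimage hm.nullMeasurableSet]
  have h : Set.Icc (4 / 9 : ℝ) (5 / 9) ⊆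
      ((↑) : ℝ → UnitAddCircle) ⁻¹' {w : UnitAddCircle | |circleRep w - 1 / 2| ≤ 1 / 18} := by
    intro t ht
    change |circleRep (t : UnitAddCircle) - 1 / 2| ≤ 1 / 18
    rw [circleRep_coe (by linarith [ht.1]) (by linarith [ht.2]), abs_le]
    constructor <;> linarith [ht.1, ht.2]
  refine le_trans ?_ (measure_mono h)
  rw [Measure.restrict_apply measurableSet_Icc, Set.inter_eq_left.2, Real.volume_Icc]
  · norm_num
  · intro t ht
    exact ⟨by linarith [ht.1], by linarith [ht.2]⟩

/-- The random inverse scale is `θ ^ 2` with `θ` uniform in `[0, 1]`. -/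
noncomputable abbrev scaleMeasure : Measure ℝ := volume.restrict (Set.Icc 0 1)

instance : IsProbabilityMeasure scaleMeasure :=
  ⟨by rw [Measure.restrict_apply_univ, Real.volume_Icc]; norm_num⟩

/-- With probability at least `1 / (54 * √r)` the scale of the wave fits the radius and the middle
of a period passes near the centre; the conditional mean of the number of points, given the phase,
then exceeds the volume of the ball by that of a slab. -/
lemma le_numberVariance_squareWave (i₀ : Fin d) {ε r : ℝ} (hε : 0 < ε) (hε1 : ε ≤ 1)
    (hr : 8 ≤ r) (hd : 3 ≤ d) :
    ENNReal.ofReal (1 / (54 * √r) * (2 * ε * (r / d) ^ (d - 1)) ^ 2) ≤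
      numberVariance (stdBasis d) (phaseMeasure (stdBasis d) scaleMeasure)
        (phasePert (stdBasis d) (fun θ => θ ^ 2) fun _ w => squareWave i₀ ε w) Prod.snd
        (Metric.closedBall 0 r) := by
  have := isProbabilityMeasure_cond (stdBasis d)
  have h := isPerturbation_phasePert (stdBasis d) scaleMeasure (m := fun θ => θ ^ 2)
    (measurable_id.pow_const 2) (F := fun _ w => squareWave i₀ ε w)
    ((measurable_squareWave i₀ ε).comp measurable_snd)
  set p := phasePert (stdBasis d) (fun θ : ℝ => θ ^ 2) (fun _ w => squareWave i₀ ε w) with hp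
  set B := Metric.closedBall (0 : E d) r with hBdef
  have hB : MeasurableSet B := measurableSet_closedBall
  have hBt : volume B ≠ ∞ := measure_closedBall_lt_top.ne
  set κ : ℝ := 2 * ε * (r / d) ^ (d - 1) with hκ
  set N : (ℝ × Torus d) × E d → ℝ≥0∞ := fun ω =>
    perturbedLattice (stdBasis d) p Prod.snd ω B with hN
  have hNm : Measurable N := measurable_count (stdBasis d) h hB
  have hr0 : 0 < r := by linarith
  have hsq : 0 < √r := Real.sqrt_pos.2 hr0
  set A : Set (ℝ × Torus d) := (Set.Icc (1 / (3 * √r)) (1 / (2 * √r))) ×ˢ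
    ((fun w : Torus d => w i₀) ⁻¹' {w : UnitAddCircle | |circleRep w - 1 / 2| ≤ 1 / 18}) with hA
  have hSm : MeasurableSet {w : UnitAddCircle | |circleRep w - 1 / 2| ≤ 1 / 18} :=
    measurableSet_le ((measurable_circleRep.sub_const _).norm) measurable_const
  have hAm : MeasurableSet A := measurableSet_Icc.prod ((measurable_pi_apply i₀) hSm)
  have hAvol : ENNReal.ofReal (1 / (54 * √r)) ≤ (scaleMeasure.prod volume) A := by
    rw [hA, Measure.prod_prod]
    have h1 : scaleMeasure (Set.Icc (1 / (3 * √r)) (1 / (2 * √r))) =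
        ENNReal.ofReal (1 / (6 * √r)) := by
      rw [Measure.restrict_apply measurableSet_Icc, Set.inter_eq_left.2, Real.volume_Icc]
      · congr 1; field_simp; norm_num
      · have h1r : 1 ≤ √r := Real.one_le_sqrt.2 (by linarith)
        refine Set.Icc_subset_Icc (by positivity) ?_
        rw [div_le_one (by positivity)]; linarith
    have h2 := (measurePreserving_eval (fun _ : Fin d => (volume : Measure UnitAddCircle))
      i₀).measure_preimage hSm.nullMeasurableSet
    rw [h1]
    calc ENNReal.ofReal (1 / (54 * √r))
        = ENNReal.ofReal (1 / (6 * √r)) * ENNReal.ofReal (1 / 9) := by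
          rw [← ENNReal.ofReal_mul (by positivity)]
          congr 1; field_simp; norm_num
      _ ≤ _ := by
          gcongr
          exact volume_circleRep_near.trans_eq h2.symm
  have hmean : ∫ ω, (N ω).toReal ∂(phaseMeasure (stdBasis d) scaleMeasure) = (volume B).toReal := by
    rw [hN, integral_count (stdBasis d) h hB hBt, volume_fundamentalDomain_std, div_one]
  have hfin : ∀ᵐ ω ∂(phaseMeasure (stdBasis d) scaleMeasure), N ω < ∞ :=
    count_ae_lt_top (stdBasis d) h hB hBt
  have hbelow : ∀ᵐ ω ∂(phaseMeasure (stdBasis d) scaleMeasure), (N ω - volume B) ^ 2 ≤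
      ‖(N ω).toReal - (volume B).toReal‖ₑ ^ 2 := by
    filter_upwards [hfin] with ω hω
    gcongr
    rw [← ENNReal.ofReal_toReal hω.ne, ← ENNReal.ofReal_toReal hBt,
      ← ENNReal.ofReal_sub _ ENNReal.toReal_nonneg, Real.enorm_eq_ofReal_abs,
      ENNReal.toReal_ofReal ENNReal.toReal_nonneg, ENNReal.toReal_ofReal ENNReal.toReal_nonneg]
    exact ENNReal.ofReal_le_ofReal (le_abs_self _)
  have hcond : ∀ q ∈ A, ENNReal.ofReal κ ≤ ∫⁻ u, (N (q, u) - volume B)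
      ∂(ProbabilityTheory.cond volume (ZSpan.fundamentalDomain (stdBasis d))) := by
    rintro ⟨θ, w⟩ ⟨hθ, hw⟩
    have hθ0 : 0 < θ := lt_of_lt_of_le (by positivity) hθ.1
    have hex := mean_excess i₀ (s := θ ^ 2) hε hε1 hr hd
      (by
        have := pow_le_pow_left₀ (by positivity) hθ.1 2
        calc 1 / (9 * r) = (1 / (3 * √r)) ^ 2 := by
              rw [div_pow, mul_pow, Real.sq_sqrt hr0.le]; norm_num
          _ ≤ _ := this)
      (by
        have := pow_le_pow_left₀ hθ0.le hθ.2 2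
        calc θ ^ 2 ≤ (1 / (2 * √r)) ^ 2 := this
          _ = 1 / (4 * r) := by rw [div_pow, mul_pow, Real.sq_sqrt hr0.le]; norm_num) w hw
    have hcm : (ProbabilityTheory.cond volume (ZSpan.fundamentalDomain (stdBasis d)) :
        Measure (E d)) = volume.restrict (ZSpan.fundamentalDomain (stdBasis d)) := by
      rw [ProbabilityTheory.cond, volume_fundamentalDomain_std]; simp
    have hsub : ∫⁻ u, N ((θ, w), u)
        ∂(ProbabilityTheory.cond volume (ZSpan.fundamentalDomain (stdBasis d))) ≤
        volume B + ∫⁻ u, (N ((θ, w), u) - volume B)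
          ∂(ProbabilityTheory.cond volume (ZSpan.fundamentalDomain (stdBasis d))) := by
      calc _ ≤ ∫⁻ u, (volume B + (N ((θ, w), u) - volume B))
            ∂(ProbabilityTheory.cond volume (ZSpan.fundamentalDomain (stdBasis d))) :=
            lintegral_mono fun u => le_add_tsub
        _ = _ := by
            rw [lintegral_add_left measurable_const]; simp
    refine (ENNReal.add_le_add_iff_left hBt).1 (le_trans ?_ hsub)
    rw [hcm]
    refine hex.trans_eq (lintegral_congr fun u => ?_)
    simp only [hN]
    rw [perturbedLattice_apply (stdBasis d) hB]
    simp only [hp, phasePert, hBdef]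
  rw [numberVariance, evariance, hmean]
  calc ENNReal.ofReal (1 / (54 * √r) * κ ^ 2)
      = ENNReal.ofReal (1 / (54 * √r)) * ENNReal.ofReal κ ^ 2 := by
        rw [ENNReal.ofReal_mul (by positivity), ENNReal.ofReal_pow (by positivity)]
    _ ≤ (scaleMeasure.prod volume) A * ENNReal.ofReal κ ^ 2 := by gcongr
    _ = ∫⁻ _q in A, ENNReal.ofReal κ ^ 2 ∂(scaleMeasure.prod volume) := by
        rw [setLIntegral_const, mul_comm]
    _ ≤ ∫⁻ q in A, (∫⁻ u, (N (q, u) - volume B) ^ 2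
          ∂(ProbabilityTheory.cond volume (ZSpan.fundamentalDomain (stdBasis d))))
            ∂(scaleMeasure.prod volume) := by
        refine setLIntegral_mono_ae' hAm (Eventually.of_forall fun q hq => ?_)
        exact sq_le_lintegral_sq _ ((hNm.comp measurable_prodMk_left).sub_const _) κ (hcond q hq)
    _ ≤ ∫⁻ q, (∫⁻ u, (N (q, u) - volume B) ^ 2
          ∂(ProbabilityTheory.cond volume (ZSpan.fundamentalDomain (stdBasis d))))
            ∂(scaleMeasure.prod volume) := setLIntegral_le_lintegral _ _
    _ = ∫⁻ ω, (N ω - volume B) ^ 2 ∂(phaseMeasure (stdBasis d) scaleMeasure) :=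
        (lintegral_prod _ ((hNm.sub_const _).pow_const 2).aemeasurable).symm
    _ ≤ _ := lintegral_mono_ae hbelow

/-- For `d ≥ 3` the lower bound of order `r ^ (2 * d - 5 / 2)` on the number variance of square
waves exceeds the volume `r ^ d`. -/
theorem exists_small_large_variance (hd : 3 ≤ d) {ε : ℝ} (hε : 0 < ε) :
    ∃ (Ω : Type) (_ : MeasurableSpace Ω) (P : Measure Ω) (_ : IsProbabilityMeasure P)
      (p : lattice (stdBasis d) → Ω → E d) (U : Ω → E d),
      IsPerturbation (stdBasis d) P p U ∧ (∀ᵐ ω ∂P, ‖p 0 ω‖ ≤ ε) ∧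
      Tendsto (rescaledVariance (stdBasis d) P p U) atTop (𝓝 ∞) := by
  set η : ℝ := min ε 1 with hη
  have hη0 : 0 < η := lt_min hε one_pos
  have hη1 : η ≤ 1 := min_le_right _ _
  set i₀ : Fin d := ⟨0, by omega⟩
  refine ⟨(ℝ × Torus d) × E d, inferInstance, phaseMeasure (stdBasis d) scaleMeasure,
    inferInstance, phasePert (stdBasis d) (fun θ => θ ^ 2) fun _ w => squareWave i₀ η w, Prod.snd,
    isPerturbation_phasePert (stdBasis d) scaleMeasure (measurable_id.pow_const 2)
      ((measurable_squareWave i₀ η).comp measurable_snd),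
    Eventually.of_forall fun ω => (norm_squareWave i₀ hη0 _).trans_le (min_le_left _ _), ?_⟩
  set v := volume (Metric.closedBall (0 : E d) 1) with hv
  have hvt : v ≠ ∞ := measure_closedBall_lt_top.ne
  have hv0 : v ≠ 0 := (Metric.measure_closedBall_pos volume _ one_pos).ne'
  have hvpos : 0 < v.toReal := ENNReal.toReal_pos hv0 hvt
  have hd0 : (0 : ℝ) < d := by positivity
  set C : ℝ := (2 * η / (d : ℝ) ^ (d - 1)) ^ 2 / 54 / v.toReal with hC
  have hC0 : 0 < C := by positivity
  have hlow : Tendsto (fun r : ℝ => ENNReal.ofReal (C * √r)) atTop (𝓝 ∞) :=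
    ENNReal.tendsto_ofReal_nhds_top.2
      (Real.tendsto_sqrt_atTop.const_mul_atTop hC0)
  refine tendsto_nhds_top_mono hlow ?_
  filter_upwards [eventually_ge_atTop (8 : ℝ)] with r hr
  have hr0 : 0 < r := by linarith
  have hsq : 0 < √r := Real.sqrt_pos.2 hr0
  have hvar := le_numberVariance_squareWave i₀ hη0 hη1 hr hd
  rw [rescaledVariance]
  refine le_trans ?_ (ENNReal.div_le_div_right hvar _)
  have hvol : volume (Metric.closedBall (0 : E d) r) = ENNReal.ofReal (r ^ d * v.toReal) := by
    rw [volume_closedBall_eq _ hr0.le, ENNReal.ofReal_mul (by positivity),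
      ENNReal.ofReal_toReal hvt, ENNReal.ofReal_pow hr0.le]
  rw [hvol, ← ENNReal.ofReal_div_of_pos (by positivity)]
  refine ENNReal.ofReal_le_ofReal ?_
  rw [le_div_iff₀ (by positivity), hC]
  obtain ⟨k, rfl⟩ : ∃ k, d = k + 3 := ⟨d - 3, by omega⟩
  have hr1 : (1 : ℝ) ≤ r ^ k := one_le_pow₀ (by linarith)
  simp only [show k + 3 - 1 = k + 2 from rfl]
  have hkey : √r * √r = r := Real.mul_self_sqrt hr0.le
  have e1 : 1 / (54 * √r) * (2 * η * (r / ((k + 3 : ℕ) : ℝ)) ^ (k + 2)) ^ 2 =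
      (2 * η / ((k + 3 : ℕ) : ℝ) ^ (k + 2)) ^ 2 / 54 * (r ^ (k + 2)) ^ 2 / √r := by
    rw [div_pow]; field_simp
  rw [e1, le_div_iff₀ hsq]
  have e2 : (2 * η / ((k + 3 : ℕ) : ℝ) ^ (k + 2)) ^ 2 / 54 / v.toReal * √r *
      (r ^ (k + 3) * v.toReal) * √r =
      (2 * η / ((k + 3 : ℕ) : ℝ) ^ (k + 2)) ^ 2 / 54 * (r ^ (k + 3) * (√r * √r)) := by
    field_simp
  rw [e2, hkey]
  gcongr ?_ * ?_
  calc r ^ (k + 3) * r = r ^ (k + 4) * 1 := by ring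
    _ ≤ r ^ (k + 4) * r ^ k := by gcongr
    _ = (r ^ (k + 2)) ^ 2 := by ring

end LargeVariance

/-! ### Truncation of the perturbations in dimensions one and two -/

section Truncation

variable {d : ℕ} (b : Module.Basis (Fin d) ℝ (E d))
variable {Ω : Type u} [MeasurableSpace Ω] {P : Measure Ω}
  {p : lattice b → Ω → E d} {U : Ω → E d}

lemma IsPerturbation.comp (h : IsPerturbation b P p U) {f : E d → E d}
    (hf : Measurable f) : IsPerturbation b P (fun x ω => f (p x ω)) U := by
  have hmap : Measurable fun (q : lattice b → E d) (x : lattice b) => f (q x) :=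
    measurable_pi_lambda _ fun x => hf.comp (measurable_pi_apply x)
  exact ⟨fun x => hf.comp (h.measurable_pert x), h.measurable_shift,
    fun a => (h.invariant a).comp hmap, h.uniform, h.indep.comp hmap measurable_id⟩

/-- Truncation of a vector at norm `K`. -/
noncomputable def truncate (K : ℝ) (v : E d) : E d := if ‖v‖ ≤ K then v else 0

lemma measurable_truncate (K : ℝ) : Measurable (truncate (d := d) K) :=
  Measurable.ite (measurableSet_le measurable_norm measurable_const) measurable_id
    measurable_const

lemma norm_truncate_le {K : ℝ} (hK : 0 ≤ K) (v : E d) : ‖truncate K v‖ ≤ K := by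
  unfold truncate
  split_ifs with h
  · exact h
  · simpa using hK

/-- The spherical shell of half-width `t` around the sphere of radius `r`. -/
def shell (d : ℕ) (r t : ℝ) : Set (E d) := {y | |‖y‖ - r| ≤ t}

lemma measurableSet_shell (r t : ℝ) : MeasurableSet (shell d r t) :=
  measurableSet_le ((measurable_norm.sub_const r).norm) measurable_const

lemma volume_shell_le (hd : d = 1 ∨ d = 2) {r t : ℝ} (hr : 0 ≤ r) (ht : 0 ≤ t) :
    volume (shell d r t) ≤ ENNReal.ofReal (4 * t * (r + t) ^ (d - 1)) *
      volume (Metric.closedBall (0 : E d) 1) := by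
  set v := volume (Metric.closedBall (0 : E d) 1) with hv
  have hdpos : 0 < d := by rcases hd with rfl | rfl <;> norm_num
  have hsub : shell d r t ⊆ Metric.closedBall 0 (r + t) \ Metric.ball 0 (max (r - t) 0) := by
    intro y hy
    have hy' := abs_le.1 (show |‖y‖ - r| ≤ t from hy)
    refine ⟨?_, ?_⟩
    · rw [mem_closedBall_zero_iff]; linarith
    · rw [mem_ball_zero_iff, not_lt]
      exact max_le (by linarith) (norm_nonneg _)
  refine (measure_mono hsub).trans ?_
  have hvt : v ≠ ∞ := measure_closedBall_lt_top.ne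
  have : Nonempty (Fin d) := ⟨⟨0, hdpos⟩⟩
  have hmax : max (r - t) 0 ≤ r + t := max_le (by linarith) (by linarith)
  rw [measure_sdiff (Metric.ball_subset_closedBall.trans
      (Metric.closedBall_subset_closedBall hmax))
      measurableSet_ball.nullMeasurableSet measure_ball_lt_top.ne,
    ← Measure.addHaar_closedBall_eq_addHaar_ball,
    volume_closedBall_eq _ (by positivity), volume_closedBall_eq _ (le_max_right _ _),
    ← ENNReal.sub_mul fun _ _ => hvt, ← ENNReal.ofReal_pow (by positivity),
    ← ENNReal.ofReal_pow (by positivity), ← ENNReal.ofReal_sub _ (by positivity)]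
  gcongr
  rcases hd with rfl | rfl
  · rcases le_total t r with h | h
    · rw [max_eq_left (by linarith)]; norm_num; linarith
    · rw [max_eq_right (by linarith)]; norm_num; linarith
  · rcases le_total t r with h | h
    · rw [max_eq_left (by linarith)]; norm_num; nlinarith
    · rw [max_eq_right (by linarith)]; norm_num; nlinarith

/-- The indicator that truncating its perturbation `v` at `K` changes whether a point at `u` ends
up in `B`. It is written as a sum of two truncated differences, of which at most one is nonzero. -/
noncomputable def changed (B : Set (E d)) (K : ℝ) (v u : E d) : ℝ≥0∞ :=
  (B.indicator (1 : E d → ℝ≥0∞) (u + v) - B.indicator (1 : E d → ℝ≥0∞) (u + truncate K v)) +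
  (B.indicator (1 : E d → ℝ≥0∞) (u + truncate K v) - B.indicator (1 : E d → ℝ≥0∞) (u + v))

lemma measurable_changed {B : Set (E d)} (hB : MeasurableSet B) (K : ℝ) :
    Measurable (Function.uncurry (changed B K)) := by
  have h1 : Measurable fun q : E d × E d => B.indicator (1 : E d → ℝ≥0∞) (q.2 + q.1) :=
    (measurable_one.indicator hB).comp (measurable_snd.add measurable_fst)
  have h2 : Measurable fun q : E d × E d => B.indicator (1 : E d → ℝ≥0∞) (q.2 + truncate K q.1) :=
    (measurable_one.indicator hB).comp
      (measurable_snd.add ((measurable_truncate K).comp measurable_fst))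
  exact (h1.sub h2).add (h2.sub h1)

/-- Truncation at `K` matters only for perturbations larger than `K`, and only for points that
are closer to the boundary of the ball than the size of their perturbation. -/
lemma changed_le (r K : ℝ) (v u : E d) :
    changed (Metric.closedBall 0 r) K v u ≤
      if K < ‖v‖ then (shell d r ‖v‖).indicator (1 : E d → ℝ≥0∞) u else 0 := by
  unfold changed truncate
  by_cases hK : ‖v‖ ≤ K
  · simp [hK, not_lt.2 hK]
  · rw [if_neg hK, if_pos (not_le.1 hK), add_zero]
    have hs : ∀ y : E d, y ∈ Metric.closedBall (0 : E d) r ↔ ‖y‖ ≤ r := fun y => by simp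
    have h1 : ‖u + v‖ ≤ ‖u‖ + ‖v‖ := norm_add_le _ _
    have h2 : ‖u‖ ≤ ‖u + v‖ + ‖v‖ := by
      calc ‖u‖ = ‖(u + v) - v‖ := by congr 1; abel
        _ ≤ _ := norm_sub_le _ _
    by_cases ha : ‖u + v‖ ≤ r <;> by_cases hb : ‖u‖ ≤ r
    · simp [ha, hb]
    · have hb' := not_le.1 hb
      have habs : |‖u‖ - r| ≤ ‖v‖ := abs_le.2 ⟨by linarith [norm_nonneg v], by linarith⟩
      have hmem : u ∈ shell d r ‖v‖ := habs
      simp [ha, hb, hmem]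
    · have ha' := not_le.1 ha
      have habs : |‖u‖ - r| ≤ ‖v‖ := abs_le.2 ⟨by linarith, by linarith [norm_nonneg v]⟩
      have hmem : u ∈ shell d r ‖v‖ := habs
      simp [ha, hb, hmem]
    · simp [ha, hb]

/-- Truncation changes membership on a set of positions of at most twice the volume of `B`. -/
lemma lintegral_changed_le {B : Set (E d)} (hB : MeasurableSet B) (K : ℝ) (v : E d) :
    ∫⁻ u, changed B K v u ≤ 2 * volume B := by
  have hm : ∀ w : E d, Measurable fun u => B.indicator (1 : E d → ℝ≥0∞) (u + w) := fun w =>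
    (measurable_one.indicator hB).comp (measurable_add_const _)
  calc ∫⁻ u, changed B K v u
      ≤ ∫⁻ u, (B.indicator (1 : E d → ℝ≥0∞) (u + v) +
          B.indicator (1 : E d → ℝ≥0∞) (u + truncate K v)) :=
        lintegral_mono fun u => add_le_add tsub_le_self tsub_le_self
    _ = 2 * volume B := by
        rw [lintegral_add_left (hm v), lintegral_add_right_eq_self (B.indicator (1 : E d → ℝ≥0∞)),
          lintegral_add_right_eq_self (B.indicator (1 : E d → ℝ≥0∞)), lintegral_indicator_one hB,
          two_mul]

/-- For one point, the volume of the positions at which truncation matters, multiplied by the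
number of lattice points in the shell where less perturbed points could matter as well. For
`d ≤ 2` this is of order `r ^ d * ‖v‖ ^ d`. -/
lemma lintegral_changed_mul_le (hd : d = 1 ∨ d = 2) {r K : ℝ} (hr : 0 < r) (hK : 0 < K)
    (hKρ : cellRadius b ≤ K) (v : E d) :
    (∫⁻ u, changed (Metric.closedBall 0 r) K v u) *
      (volume (shell d r (‖v‖ + cellRadius b)) / volume (ZSpan.fundamentalDomain b)) ≤
    (192 * volume (Metric.closedBall (0 : E d) 1) ^ 2 / volume (ZSpan.fundamentalDomain b)) *
      ENNReal.ofReal r ^ d * (if K < ‖v‖ then ‖v‖ₑ ^ d else 0) := by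
  set w := volume (Metric.closedBall (0 : E d) 1) with hw
  set B := Metric.closedBall (0 : E d) r with hBdef
  have hB : MeasurableSet B := measurableSet_closedBall
  by_cases hKv : K < ‖v‖
  swap
  · have : ∫⁻ u, changed B K v u = 0 := by
      rw [← nonpos_iff_eq_zero]
      calc ∫⁻ u, changed B K v u ≤ ∫⁻ _u : E d, 0 :=
            lintegral_mono fun u => (changed_le r K v u).trans (by simp [hKv])
        _ = 0 := by simp
    simp [this]
  rw [if_pos hKv]
  set s := ‖v‖ with hs
  have hs0 : 0 < s := hK.trans hKv
  have hρ := cellRadius_nonneg b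
  have hA1 : ∫⁻ u, changed B K v u ≤ ENNReal.ofReal (4 * s * (r + s) ^ (d - 1)) * w := by
    calc ∫⁻ u, changed B K v u ≤ ∫⁻ u, (shell d r s).indicator (1 : E d → ℝ≥0∞) u :=
          lintegral_mono fun u => (changed_le r K v u).trans (by rw [if_pos hKv])
      _ = volume (shell d r s) := lintegral_indicator_one (measurableSet_shell r s)
      _ ≤ _ := volume_shell_le hd hr.le hs0.le
  have hA2 : ∫⁻ u, changed B K v u ≤ ENNReal.ofReal (2 * r ^ d) * w := by
    refine (lintegral_changed_le hB K v).trans_eq ?_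
    rw [hBdef, volume_closedBall_eq _ hr.le, ENNReal.ofReal_mul (by norm_num),
      ENNReal.ofReal_pow hr.le, ← mul_assoc]
    simp [hw]
  have hA3 : volume (shell d r (s + cellRadius b)) ≤
      ENNReal.ofReal (8 * s * (r + 2 * s) ^ (d - 1)) * w := by
    refine (volume_shell_le hd hr.le (by positivity)).trans ?_
    refine mul_le_mul' (ENNReal.ofReal_le_ofReal ?_) le_rfl
    exact mul_le_mul (by linarith) (pow_le_pow_left₀ (by positivity) (by linarith) _)
      (by positivity) (by positivity)
  have hfin : (192 * w ^ 2 / volume (ZSpan.fundamentalDomain b)) * ENNReal.ofReal r ^ d * ‖v‖ₑ ^ d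
      = ENNReal.ofReal (192 * r ^ d * s ^ d) * w * w / volume (ZSpan.fundamentalDomain b) := by
    rw [ENNReal.ofReal_mul (by positivity), ENNReal.ofReal_mul (by positivity),
      ENNReal.ofReal_pow hr.le, ENNReal.ofReal_pow hs0.le, hs, ofReal_norm]
    simp only [div_eq_mul_inv, ENNReal.ofReal_ofNat]
    ring
  rw [hfin, ← mul_div_assoc]
  refine ENNReal.div_le_div_right ?_ _
  rcases le_total s r with hsr | hsr
  · refine (mul_le_mul' hA1 hA3).trans ?_
    rw [mul_mul_mul_comm, ← ENNReal.ofReal_mul (by positivity), mul_assoc _ w w]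
    refine mul_le_mul' (ENNReal.ofReal_le_ofReal ?_) le_rfl
    rcases hd with rfl | rfl
    · norm_num; nlinarith
    · norm_num
      have h1 : r + s ≤ 2 * r := by linarith
      have h2 : r + 2 * s ≤ 3 * r := by linarith
      calc 4 * s * (r + s) * (8 * s * (r + 2 * s)) ≤ 4 * s * (2 * r) * (8 * s * (3 * r)) := by
            gcongr
        _ = 192 * r ^ 2 * s ^ 2 := by ring
  · refine (mul_le_mul' hA2 hA3).trans ?_
    rw [mul_mul_mul_comm, ← ENNReal.ofReal_mul (by positivity), mul_assoc _ w w]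
    refine mul_le_mul' (ENNReal.ofReal_le_ofReal ?_) le_rfl
    rcases hd with rfl | rfl
    · norm_num; nlinarith
    · norm_num
      have h2 : r + 2 * s ≤ 3 * s := by linarith
      calc 2 * r ^ 2 * (8 * s * (r + 2 * s)) ≤ 2 * r ^ 2 * (8 * s * (3 * s)) := by gcongr
        _ ≤ 192 * r ^ 2 * s ^ 2 := by nlinarith [sq_nonneg (r * s)]

/-- The mean square of the number of points changed by truncation at `K` is controlled by the
tail of the `d`-th moment. -/
lemma lintegral_sq_changed_le [IsProbabilityMeasure P] (h : IsPerturbation b P p U)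
    (hd : d = 1 ∨ d = 2) {r K : ℝ} (hr : 0 < r) (hK : 0 < K) (hKρ : cellRadius b ≤ K) :
    ∫⁻ ω, (∑' x : lattice b, changed (Metric.closedBall 0 r) K (p x ω) ((x : E d) + U ω)) ^ 2 ∂P ≤
      2 * ((192 * volume (Metric.closedBall (0 : E d) 1) ^ 2 /
        volume (ZSpan.fundamentalDomain b)) / volume (ZSpan.fundamentalDomain b)) *
      ENNReal.ofReal r ^ d * ∫⁻ ω, (if K < ‖p 0 ω‖ then ‖p 0 ω‖ₑ ^ d else 0) ∂P := by
  set B := Metric.closedBall (0 : E d) r with hBdef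
  have hB : MeasurableSet B := measurableSet_closedBall
  set D := volume (ZSpan.fundamentalDomain b)
  set w := volume (Metric.closedBall (0 : E d) 1) with hw
  have hwt : w ≠ ∞ := measure_closedBall_lt_top.ne
  have hD0 : D ≠ 0 := volume_fundamentalDomain_ne_zero b
  have key := lintegral_sq_tsum_le b h (measurable_changed hB K)
  have hcount : ∀ ω u, ∑' z : lattice b, {v | ‖v‖ ≤ ‖p 0 ω‖}.indicator
      (fun v => changed B K v ((z : E d) + u)) (p z ω) ≤
      volume (shell d r (‖p 0 ω‖ + cellRadius b)) / D := by
    intro ω u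
    refine le_trans (ENNReal.tsum_le_tsum fun z => ?_) (tsum_indicator_le b (shell d r ‖p 0 ω‖)
      (shell d r (‖p 0 ω‖ + cellRadius b)) (measurableSet_shell _ _) u ?_)
    · by_cases h3 : ‖p z ω‖ ≤ ‖p 0 ω‖
      · rw [Set.indicator_of_mem (show p z ω ∈ {v | ‖v‖ ≤ ‖p 0 ω‖} from h3)]
        refine (changed_le r K _ _).trans ?_
        split_ifs
        · rw [add_comm]
          refine Set.indicator_le_indicator_of_subset (fun y hy => ?_) (fun _ => zero_le) _
          exact (show |‖y‖ - r| ≤ ‖p z ω‖ from hy).trans h3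
        · exact zero_le
      · rw [Set.indicator_of_notMem (show p z ω ∉ {v | ‖v‖ ≤ ‖p 0 ω‖} from h3)]
        exact zero_le
    · intro y hy t ht
      have hy' : |‖y‖ - r| ≤ ‖p 0 ω‖ := hy
      have h1 : |‖y + t‖ - ‖y‖| ≤ ‖t‖ := by
        simpa using abs_norm_sub_norm_le (y + t) y
      have h2 := abs_add_le (‖y + t‖ - ‖y‖) (‖y‖ - r)
      have e : ‖y + t‖ - r = (‖y + t‖ - ‖y‖) + (‖y‖ - r) := by ring
      change |‖y + t‖ - r| ≤ _
      rw [e]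
      linarith
  have hm : ∀ v : E d, Measurable fun u => changed B K v u := fun v =>
    measurable_comp₂ (measurable_changed hB K) measurable_const measurable_id
  have hbound : ∀ ω, ∫⁻ u, changed B K (p 0 ω) u * ∑' z : lattice b,
      {v | ‖v‖ ≤ ‖p 0 ω‖}.indicator (fun v => changed B K v ((z : E d) + u)) (p z ω) ≤
      (192 * w ^ 2 / D) * ENNReal.ofReal r ^ d * (if K < ‖p 0 ω‖ then ‖p 0 ω‖ₑ ^ d else 0) := by
    intro ω
    calc _ ≤ ∫⁻ u, changed B K (p 0 ω) u *
          (volume (shell d r (‖p 0 ω‖ + cellRadius b)) / D) :=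
          lintegral_mono fun u => mul_le_mul' le_rfl (hcount ω u)
      _ = (∫⁻ u, changed B K (p 0 ω) u) *
          (volume (shell d r (‖p 0 ω‖ + cellRadius b)) / D) := lintegral_mul_const _ (hm _)
      _ ≤ _ := lintegral_changed_mul_le b hd hr hK hKρ (p 0 ω)
  refine key.trans ?_
  have hc : (192 * w ^ 2 / D) * ENNReal.ofReal r ^ d ≠ ∞ :=
    ENNReal.mul_ne_top (ENNReal.div_ne_top (ENNReal.mul_ne_top (by simp) (by simp [hwt])) hD0)
      (by simp)
  have h4 := lintegral_mono (μ := P) hbound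
  rw [lintegral_const_mul' _ _ hc] at h4
  calc _ ≤ 2 * (((192 * w ^ 2 / D) * ENNReal.ofReal r ^ d *
        ∫⁻ ω, (if K < ‖p 0 ω‖ then ‖p 0 ω‖ₑ ^ d else 0) ∂P) / D) :=
        mul_le_mul' le_rfl (ENNReal.div_le_div_right h4 _)
    _ = _ := by simp only [div_eq_mul_inv]; ring

lemma numberVariance_le_truncate [IsProbabilityMeasure P] (h : IsPerturbation b P p U)
    {B : Set (E d)} (hB : MeasurableSet B) (hBt : volume B ≠ ∞) (K : ℝ) :
    numberVariance b P p U B ≤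
      2 * ∫⁻ ω, (∑' x : lattice b, changed B K (p x ω) ((x : E d) + U ω)) ^ 2 ∂P +
      2 * numberVariance b P (fun x ω => truncate K (p x ω)) U B := by
  have h' : IsPerturbation b P (fun x ω => truncate K (p x ω)) U := h.comp b (measurable_truncate K)
  have hm' := measurable_count b h' hB
  rw [numberVariance, numberVariance, evariance, evariance, integral_count b h hB hBt,
    integral_count b h' hB hBt]
  set m := (volume B / volume (ZSpan.fundamentalDomain b)).toReal
  have hmeas : Measurable fun ω => ∑' x : lattice b, changed B K (p x ω) ((x : E d) + U ω) :=
    Measurable.tsum fun x => measurable_comp₂ (measurable_changed hB K) (h.measurable_pert x)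
      (h.measurable_shift.const_add _)
  rw [← lintegral_const_mul' _ _ (by simp), ← lintegral_const_mul' _ _ (by simp),
    ← lintegral_add_left ((hmeas.pow_const 2).const_mul 2)]
  refine lintegral_mono_ae ?_
  filter_upwards [count_ae_lt_top b h hB hBt, count_ae_lt_top b h' hB hBt] with ω h1 h2
  set N := perturbedLattice b p U ω B with hN
  set N' := perturbedLattice b (fun x ω => truncate K (p x ω)) U ω B with hN'
  set A := ∑' x : lattice b, changed B K (p x ω) ((x : E d) + U ω) with hA
  have e1 : N ≤ N' + A := by
    rw [hN, hN', hA, perturbedLattice_apply b hB, perturbedLattice_apply b hB, ← ENNReal.tsum_add]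
    refine ENNReal.tsum_le_tsum fun x => ?_
    unfold changed
    rw [← add_assoc]
    exact le_add_tsub.trans le_self_add
  have e2 : N' ≤ N + A := by
    rw [hN, hN', hA, perturbedLattice_apply b hB, perturbedLattice_apply b hB, ← ENNReal.tsum_add]
    refine ENNReal.tsum_le_tsum fun x => ?_
    unfold changed
    rw [add_comm (_ - _), ← add_assoc]
    exact le_add_tsub.trans le_self_add
  have e3 : ‖N.toReal - N'.toReal‖ₑ ≤ A := by
    rcases eq_or_ne A ∞ with hAt | hAt
    · simp [hAt]
    · rw [Real.enorm_eq_ofReal_abs]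
      refine ENNReal.ofReal_le_of_le_toReal ?_
      have f1 := ENNReal.toReal_mono (ENNReal.add_ne_top.2 ⟨h2.ne, hAt⟩) e1
      have f2 := ENNReal.toReal_mono (ENNReal.add_ne_top.2 ⟨h1.ne, hAt⟩) e2
      rw [ENNReal.toReal_add h2.ne hAt] at f1
      rw [ENNReal.toReal_add h1.ne hAt] at f2
      rw [abs_le]
      constructor <;> linarith
  calc ‖N.toReal - m‖ₑ ^ 2 = ‖(N.toReal - N'.toReal) + (N'.toReal - m)‖ₑ ^ 2 := by
        congr 2; ring
    _ ≤ (A + ‖N'.toReal - m‖ₑ) ^ 2 := by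
        gcongr
        exact (enorm_add_le _ _).trans (by gcongr)
    _ ≤ 2 * A ^ 2 + 2 * ‖N'.toReal - m‖ₑ ^ 2 := by
        generalize ‖N'.toReal - m‖ₑ = y
        rcases eq_or_ne A ∞ with hAt | hAt
        · simp [hAt]
        rcases eq_or_ne y ∞ with hyt | hyt
        · simp [hyt]
        lift A to NNReal using hAt with a
        lift y to NNReal using hyt with y
        norm_cast
        rw [← NNReal.coe_le_coe]
        push_cast
        nlinarith [sq_nonneg ((a : ℝ) - y)]

lemma tendsto_tail [IsProbabilityMeasure P] {f : Ω → E d} (hf : Measurable f)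
    (hint : ∫⁻ ω, ‖f ω‖ₑ ^ d ∂P < ∞) :
    Tendsto (fun n : ℕ => ∫⁻ ω, (if (n : ℝ) < ‖f ω‖ then ‖f ω‖ₑ ^ d else 0) ∂P) atTop (𝓝 0) := by
  have := tendsto_lintegral_of_dominated_convergence (μ := P)
    (F := fun (n : ℕ) ω => if (n : ℝ) < ‖f ω‖ then ‖f ω‖ₑ ^ d else 0) (f := fun _ => 0)
    (fun ω => ‖f ω‖ₑ ^ d)
    (fun n => Measurable.ite (measurableSet_lt measurable_const hf.norm)
      (hf.enorm.pow_const d) measurable_const)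
    (fun n => Eventually.of_forall fun ω => by dsimp only; split_ifs <;> simp)
    hint.ne
    (Eventually.of_forall fun ω => by
      refine tendsto_const_nhds.congr' ?_
      filter_upwards [eventually_ge_atTop ⌈‖f ω‖⌉₊] with n hn
      rw [if_neg (not_lt.2 (Nat.ceil_le.1 hn))])
  simpa using this

/-- In dimensions one and two it suffices to treat bounded perturbations. -/
lemma hyperuniform_of_truncate [IsProbabilityMeasure P] (h : IsPerturbation b P p U)
    (hd : d = 1 ∨ d = 2) (hint : ∫⁻ ω, ‖p 0 ω‖ₑ ^ d ∂P < ∞)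
    (htr : ∀ K : ℝ, 0 < K → Hyperuniform b P (fun x ω => truncate K (p x ω)) U) :
    Hyperuniform b P p U := by
  set D := volume (ZSpan.fundamentalDomain b)
  set w := volume (Metric.closedBall (0 : E d) 1) with hw
  have hwt : w ≠ ∞ := measure_closedBall_lt_top.ne
  have hw0 : w ≠ 0 := (Metric.measure_closedBall_pos volume _ one_pos).ne'
  have hD0 : D ≠ 0 := volume_fundamentalDomain_ne_zero b
  set C := 2 * (2 * (192 * w ^ 2 / D / D)) / w with hC
  have hCt : C ≠ ∞ := ENNReal.div_ne_top (ENNReal.mul_ne_top (by simp) (ENNReal.mul_ne_top (by simp)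
    (ENNReal.div_ne_top (ENNReal.div_ne_top (ENNReal.mul_ne_top (by simp) (by simp [hwt])) hD0)
      hD0))) hw0
  have hkey : ∀ K r : ℝ, 0 < K → cellRadius b ≤ K → 0 < r → rescaledVariance b P p U r ≤
      C * (∫⁻ ω, (if K < ‖p 0 ω‖ then ‖p 0 ω‖ₑ ^ d else 0) ∂P) +
      2 * rescaledVariance b P (fun x ω => truncate K (p x ω)) U r := by
    intro K r hK hKρ hr
    have h1 := numberVariance_le_truncate b h (B := Metric.closedBall 0 r)
      measurableSet_closedBall measure_closedBall_lt_top.ne K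
    have h2 := lintegral_sq_changed_le b h hd hr hK hKρ
    have hr0 : ENNReal.ofReal r ^ d ≠ 0 := by simp [hr]
    have hrt : ENNReal.ofReal r ^ d ≠ ∞ := by simp
    rw [rescaledVariance, rescaledVariance]
    refine (ENNReal.div_le_div_right (h1.trans (add_le_add (mul_le_mul' le_rfl h2) le_rfl))
      _).trans_eq ?_
    rw [ENNReal.add_div, mul_div_assoc 2 (numberVariance _ _ _ _ _)]
    congr 1
    rw [volume_closedBall_eq _ hr.le, hC]
    simp only [div_eq_mul_inv]
    rw [ENNReal.mul_inv (Or.inl hr0) (Or.inl hrt)]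
    calc _ = 2 * (2 * (192 * w ^ 2 * D⁻¹ * D⁻¹)) * w⁻¹ *
          (∫⁻ ω, (if K < ‖p 0 ω‖ then ‖p 0 ω‖ₑ ^ d else 0) ∂P) *
          (ENNReal.ofReal r ^ d * (ENNReal.ofReal r ^ d)⁻¹) := by ring
      _ = _ := by rw [ENNReal.mul_inv_cancel hr0 hrt, mul_one]
  rw [Hyperuniform, ENNReal.tendsto_nhds_zero]
  intro ε hε
  have htail : Tendsto (fun n : ℕ => C * ∫⁻ ω, (if (n : ℝ) < ‖p 0 ω‖ then ‖p 0 ω‖ₑ ^ d else 0) ∂P)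
      atTop (𝓝 0) := by
    simpa using ENNReal.Tendsto.const_mul (tendsto_tail (h.measurable_pert 0) hint)
      (Or.inr hCt)
  have hε2 : 0 < ε / 2 := ENNReal.half_pos hε.ne'
  obtain ⟨n, hn1, hn2, hn3⟩ := ((ENNReal.tendsto_nhds_zero.1 htail (ε / 2) hε2).and
    ((eventually_ge_atTop ⌈cellRadius b⌉₊).and (eventually_ge_atTop 1))).exists
  have hK : (0 : ℝ) < n := by exact_mod_cast hn3
  have h3 : Tendsto (fun r => 2 * rescaledVariance b P (fun x ω => truncate n (p x ω)) U r)
      atTop (𝓝 0) := by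
    simpa using ENNReal.Tendsto.const_mul (htr n hK) (Or.inr (by simp))
  filter_upwards [ENNReal.tendsto_nhds_zero.1 h3 (ε / 2) hε2, eventually_gt_atTop 0] with r hr hr0
  calc _ ≤ _ := hkey n r hK (Nat.ceil_le.1 hn2) hr0
    _ ≤ ε / 2 + ε / 2 := add_le_add hn1 hr
    _ = ε := ENNReal.add_halves ε

end Truncation

/-! ### Bounded perturbations in dimension one -/

section DimensionOne

variable {d : ℕ} (b : Module.Basis (Fin d) ℝ (E d))

/-- The number of lattice points in a translate of `A` is at least the volume of any set whose
neighbourhood lies in `A`, divided by the volume of the fundamental domain. -/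
lemma le_tsum_indicator (A A' : Set (E d)) (hA' : MeasurableSet A') (c : E d)
    (h : ∀ y, ∀ t : E d, ‖t‖ ≤ cellRadius b → y + t ∈ A' → y ∈ A) :
    volume A' / volume (ZSpan.fundamentalDomain b) ≤
      ∑' z : lattice b, A.indicator (1 : E d → ℝ≥0∞) (c + (z : E d)) := by
  set D := ZSpan.fundamentalDomain b
  have hDm : MeasurableSet D := ZSpan.fundamentalDomain_measurableSet b
  refine ENNReal.div_le_of_le_mul ?_
  rw [← ENNReal.tsum_mul_right]
  calc volume A' = ∫⁻ x, A'.indicator (1 : E d → ℝ≥0∞) x := (lintegral_indicator_one hA').symm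
    _ = ∫⁻ x, A'.indicator (1 : E d → ℝ≥0∞) (c + x) :=
        (lintegral_add_left_eq_self (A'.indicator (1 : E d → ℝ≥0∞)) c).symm
    _ = ∑' z : lattice b, ∫⁻ x in D, A'.indicator (1 : E d → ℝ≥0∞) (c + ((z : E d) + x)) :=
        lintegral_eq_tsum_lattice b fun x => A'.indicator (1 : E d → ℝ≥0∞) (c + x)
    _ ≤ _ := by
      refine ENNReal.tsum_le_tsum fun z => ?_
      rw [← setLIntegral_const]
      refine setLIntegral_mono_ae' hDm (Eventually.of_forall fun x hx => ?_)
      rw [← add_assoc]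
      by_cases hmem : c + (z : E d) + x ∈ A'
      · rw [Set.indicator_of_mem hmem,
          Set.indicator_of_mem (h _ x (norm_le_cellRadius b hx) hmem)]
        simp
      · rw [Set.indicator_of_notMem hmem]; exact zero_le

/-- In dimension one the boundary of a ball is bounded, so that a bounded perturbation moves a
bounded number of points through it. -/
lemma hyperuniform_one (b : Module.Basis (Fin 1) ℝ (E 1)) {Ω : Type u} [MeasurableSpace Ω]
    {P : Measure Ω} [IsProbabilityMeasure P] {p : lattice b → Ω → E 1} {U : Ω → E 1}
    (h : IsPerturbation b P p U) {K : ℝ} (hK : 0 < K) (hp : ∀ x ω, ‖p x ω‖ ≤ K) :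
    Hyperuniform b P p U := by
  set D := volume (ZSpan.fundamentalDomain b) with hD
  set w := volume (Metric.closedBall (0 : E 1) 1) with hw
  have hwt : w ≠ ∞ := measure_closedBall_lt_top.ne
  have hw0 : w ≠ 0 := (Metric.measure_closedBall_pos volume _ one_pos).ne'
  have hD0 : D ≠ 0 := volume_fundamentalDomain_ne_zero b
  have hDt : D ≠ ∞ := volume_fundamentalDomain_ne_top b
  set ρ := cellRadius b
  have hρ : 0 ≤ ρ := cellRadius_nonneg b
  set C := ENNReal.ofReal (K + ρ) * w / D with hC
  have hCt : C ≠ ∞ := ENNReal.div_ne_top (ENNReal.mul_ne_top (by simp) hwt) hD0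
  have hvol : ∀ r : ℝ, 0 ≤ r → volume (Metric.closedBall (0 : E 1) r) = ENNReal.ofReal r * w :=
    fun r hr => by rw [volume_closedBall_eq _ hr, pow_one]
  have hvar : ∀ r, K + ρ < r → numberVariance b P p U (Metric.closedBall 0 r) ≤ C ^ 2 := by
    intro r hr
    have hr0 : 0 < r := by linarith
    set B := Metric.closedBall (0 : E 1) r with hBdef
    have hB : MeasurableSet B := measurableSet_closedBall
    have hBt : volume B ≠ ∞ := measure_closedBall_lt_top.ne
    rw [numberVariance, evariance, integral_count b h hB hBt]
    have hmt : volume B / volume (ZSpan.fundamentalDomain b) ≠ ∞ := ENNReal.div_ne_top hBt hD0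
    set m := volume B / volume (ZSpan.fundamentalDomain b) with hm
    have hpt : ∀ᵐ ω ∂P, ‖(perturbedLattice b p U ω B).toReal - m.toReal‖ₑ ^ 2 ≤ C ^ 2 := by
      filter_upwards [count_ae_lt_top b h hB hBt] with ω hω
      gcongr
      set N := perturbedLattice b p U ω B with hN
      have e1 : N ≤ m + C := by
        have h1 := tsum_indicator_le b (Metric.closedBall 0 (r + K))
          (Metric.closedBall 0 (r + K + ρ)) measurableSet_closedBall (U ω) (by
            intro y hy t ht
            rw [mem_closedBall_zero_iff] at *
            exact (norm_add_le _ _).trans (by linarith))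
        rw [hvol _ (by linarith), show r + K + ρ = r + (K + ρ) by ring,
          ENNReal.ofReal_add hr0.le (by positivity), add_mul, ENNReal.add_div,
          ← hvol r hr0.le] at h1
        refine le_trans ?_ h1
        rw [hN, perturbedLattice_apply b hB]
        refine ENNReal.tsum_le_tsum fun x => ?_
        by_cases hx : (x : E 1) + U ω + p x ω ∈ B
        · have : U ω + (x : E 1) ∈ Metric.closedBall (0 : E 1) (r + K) := by
            rw [hBdef, mem_closedBall_zero_iff] at hx
            rw [mem_closedBall_zero_iff]
            calc ‖U ω + (x : E 1)‖ = ‖((x : E 1) + U ω + p x ω) - p x ω‖ := by congr 1; abel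
              _ ≤ _ := norm_sub_le _ _
              _ ≤ r + K := add_le_add hx (hp x ω)
          rw [Set.indicator_of_mem this]
          exact Set.indicator_le_self _ _ _
        · rw [Set.indicator_of_notMem hx]; exact zero_le
      have e2 : m ≤ N + C := by
        have h1 := le_tsum_indicator b (Metric.closedBall 0 (r - K))
          (Metric.closedBall 0 (r - (K + ρ))) measurableSet_closedBall (U ω) (by
            intro y t ht hy
            rw [mem_closedBall_zero_iff] at *
            calc ‖y‖ = ‖(y + t) - t‖ := by congr 1; abel
              _ ≤ _ := norm_sub_le _ _
              _ ≤ _ := by linarith)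
        have h2 : m = ENNReal.ofReal (r - (K + ρ)) * w / D + C := by
          rw [hm, hvol r hr0.le, hC, ← ENNReal.add_div, ← add_mul,
            ← ENNReal.ofReal_add (by linarith) (by positivity)]
          congr 3
          ring
        rw [h2]
        gcongr
        rw [← hvol _ (by linarith)]
        refine h1.trans ?_
        rw [hN, perturbedLattice_apply b hB]
        refine ENNReal.tsum_le_tsum fun x => ?_
        by_cases hx : U ω + (x : E 1) ∈ Metric.closedBall (0 : E 1) (r - K)
        · have : (x : E 1) + U ω + p x ω ∈ B := by
            rw [mem_closedBall_zero_iff] at hx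
            rw [hBdef, mem_closedBall_zero_iff]
            calc ‖(x : E 1) + U ω + p x ω‖ = ‖(U ω + (x : E 1)) + p x ω‖ := by congr 1; abel
              _ ≤ _ := norm_add_le _ _
              _ ≤ r := by linarith [hp x ω]
          rw [Set.indicator_of_mem this]
          exact Set.indicator_le_self _ _ _
        · rw [Set.indicator_of_notMem hx]; exact zero_le
      rw [Real.enorm_eq_ofReal_abs]
      refine ENNReal.ofReal_le_of_le_toReal ?_
      have f1 := ENNReal.toReal_mono (ENNReal.add_ne_top.2 ⟨hmt, hCt⟩) e1
      have f2 := ENNReal.toReal_mono (ENNReal.add_ne_top.2 ⟨hω.ne, hCt⟩) e2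
      rw [ENNReal.toReal_add hmt hCt] at f1
      rw [ENNReal.toReal_add hω.ne hCt] at f2
      rw [abs_le]
      constructor <;> linarith
    calc _ ≤ ∫⁻ _ω, C ^ 2 ∂P := lintegral_mono_ae hpt
      _ = C ^ 2 := by simp
  have hlim : Tendsto (fun r : ℝ => C ^ 2 / w / ENNReal.ofReal r) atTop (𝓝 0) :=
    ENNReal.Tendsto.const_div (ENNReal.tendsto_ofReal_nhds_top.2 tendsto_id)
      (Or.inr (ENNReal.div_ne_top (by simp [hCt]) hw0))
      |>.trans (by simp)
  refine tendsto_of_tendsto_of_tendsto_of_le_of_le' tendsto_const_nhds hlim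
    (Eventually.of_forall fun _ => zero_le) ?_
  filter_upwards [eventually_gt_atTop (K + ρ)] with r hr
  rw [rescaledVariance, hvol r (by linarith)]
  refine (ENNReal.div_le_div_right (hvar r hr) _).trans_eq ?_
  simp only [div_eq_mul_inv]
  rw [ENNReal.mul_inv (Or.inr hwt) (Or.inr hw0), mul_assoc, mul_comm w⁻¹]

end DimensionOne

/-! ### Averages over the rescaled lattice -/

section LatticeSums

variable {d : ℕ} (b : Module.Basis (Fin d) ℝ (E d))

lemma finite_lattice_ball (R : ℝ) : {z : lattice b | ‖(z : E d)‖ ≤ R}.Finite := by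
  have h := ZSpan.setFinite_inter b (Metric.isBounded_closedBall (x := (0 : E d)) (r := R))
  have h2 := h.preimage (f := ((↑) : lattice b → E d)) Subtype.val_injective.injOn
  refine h2.subset fun z hz => ?_
  exact ⟨mem_closedBall_zero_iff.2 hz, z.2⟩

/-- The lattice points of norm at most `R`. -/
noncomputable def latticeBall (R : ℝ) : Finset (lattice b) := (finite_lattice_ball b R).toFinset

lemma mem_latticeBall {R : ℝ} {z : lattice b} : z ∈ latticeBall b R ↔ ‖(z : E d)‖ ≤ R := by
  simp [latticeBall]

/-- A volume bound for the number of lattice points in `A`, where `A'` contains a neighbourhood of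
`A`. -/
lemma card_le_of_subset (F : Finset (lattice b)) (A A' : Set (E d)) (hA' : MeasurableSet A')
    (h : ∀ y ∈ A, ∀ t : E d, ‖t‖ ≤ cellRadius b → y + t ∈ A') (hF : ∀ z ∈ F, (z : E d) ∈ A) :
    (F.card : ℝ≥0∞) ≤ volume A' / volume (ZSpan.fundamentalDomain b) := by
  refine le_trans ?_ (tsum_indicator_le b A A' hA' 0 h)
  refine le_trans (le_of_eq ?_) (ENNReal.sum_le_tsum F)
  rw [Finset.sum_congr rfl fun z hz => by
    rw [zero_add, Set.indicator_of_mem (hF z hz)]]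
  simp

lemma exists_card_latticeBall_le :
    ∃ C : ℝ, 0 < C ∧ ∀ R : ℝ, 1 ≤ R → ((latticeBall b R).card : ℝ) ≤ C * R ^ d := by
  set D := volume (ZSpan.fundamentalDomain b)
  set w := volume (Metric.closedBall (0 : E d) 1) with hw
  have hwt : w ≠ ∞ := measure_closedBall_lt_top.ne
  have hw0 : w ≠ 0 := (Metric.measure_closedBall_pos volume _ one_pos).ne'
  have hD0 : D ≠ 0 := volume_fundamentalDomain_ne_zero b
  have hDt : D ≠ ∞ := volume_fundamentalDomain_ne_top b
  have hρ := cellRadius_nonneg b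
  have hwp : 0 < (w / D).toReal := ENNReal.toReal_pos (ENNReal.div_ne_zero.2 ⟨hw0, hDt⟩)
    (ENNReal.div_ne_top hwt hD0)
  refine ⟨(1 + cellRadius b) ^ d * (w / D).toReal, by positivity, fun R hR => ?_⟩
  have h1 := card_le_of_subset b (latticeBall b R) (Metric.closedBall 0 R)
    (Metric.closedBall 0 (R + cellRadius b)) measurableSet_closedBall
    (fun y hy t ht => by
      rw [mem_closedBall_zero_iff] at *
      exact (norm_add_le _ _).trans (add_le_add hy ht))
    (fun z hz => mem_closedBall_zero_iff.2 ((mem_latticeBall b).1 hz))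
  rw [volume_closedBall_eq _ (by linarith), mul_div_assoc] at h1
  have h2 := ENNReal.toReal_mono (ENNReal.mul_ne_top (by simp) (ENNReal.div_ne_top hwt hD0)) h1
  rw [ENNReal.toReal_mul, ENNReal.toReal_pow, ENNReal.toReal_ofReal (by linarith),
    ENNReal.toReal_natCast] at h2
  refine h2.trans ?_
  rw [mul_right_comm, ← mul_pow]
  gcongr
  nlinarith

/-- Lattice sums of the values at scale `r` of a compactly supported function, weighted by `c`
and normalised by the volume scale. -/
noncomputable def latticeAvg (φ : E d → ℝ) (r : ℝ) (c : lattice b → ℝ) : ℝ :=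
  (r ^ d)⁻¹ * ∑' z : lattice b, φ (r⁻¹ • (z : E d)) * c z

variable {φ : E d → ℝ}

lemma exists_radius (hφ : HasCompactSupport φ) : ∃ R : ℝ, 1 ≤ R ∧ ∀ x, R < ‖x‖ → φ x = 0 := by
  obtain ⟨R, hR⟩ := hφ.isCompact.isBounded.subset_closedBall 0
  refine ⟨max R 1, le_max_right _ _, fun x hx => ?_⟩
  by_contra h
  have := mem_closedBall_zero_iff.1 (hR (subset_tsupport φ h))
  exact absurd (this.trans (le_max_left _ _)) (not_le.2 hx)

lemma tsum_eq_sum_latticeBall {u : lattice b → ℝ} {R : ℝ}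
    (hu : ∀ z : lattice b, R < ‖(z : E d)‖ → u z = 0) :
    ∑' z, u z = ∑ z ∈ latticeBall b R, u z :=
  tsum_eq_sum fun z hz => hu z (not_le.1 fun h => hz ((mem_latticeBall b).2 h))

lemma summable_of_radius {u : lattice b → ℝ} {R : ℝ}
    (hu : ∀ z : lattice b, R < ‖(z : E d)‖ → u z = 0) :
    Summable u :=
  summable_of_ne_finset_zero (s := latticeBall b R) fun z hz =>
    hu z (not_le.1 fun h => hz ((mem_latticeBall b).2 h))

lemma eq_zero_of_radius {R : ℝ} (hR : ∀ x, R < ‖x‖ → φ x = 0) {r : ℝ} (hr : 0 < r) (x : E d)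
    (hx : R * r < ‖x‖) : φ (r⁻¹ • x) = 0 := by
  refine hR _ ?_
  rw [norm_smul, norm_inv, Real.norm_of_nonneg hr.le, ← div_eq_inv_mul, lt_div_iff₀ hr]
  exact hx

lemma summable_latticeAvg (hφ : HasCompactSupport φ) {r : ℝ} (hr : 0 < r) (c : lattice b → ℝ) :
    Summable fun z : lattice b => φ (r⁻¹ • (z : E d)) * c z := by
  obtain ⟨R, -, hR⟩ := exists_radius hφ
  exact summable_of_radius b (R := R * r) fun z hz => by
    rw [eq_zero_of_radius hR hr _ hz, zero_mul]

lemma latticeAvg_sub (hφ : HasCompactSupport φ) {r : ℝ} (hr : 0 < r) (c c' : lattice b → ℝ) :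
    latticeAvg b φ r (fun z => c z - c' z) = latticeAvg b φ r c - latticeAvg b φ r c' := by
  unfold latticeAvg
  rw [← mul_sub, ← (summable_latticeAvg b hφ hr c).tsum_sub (summable_latticeAvg b hφ hr c')]
  simp [mul_sub]

lemma latticeAvg_sum {ι : Type*} (hφ : HasCompactSupport φ) {r : ℝ} (hr : 0 < r) (t : Finset ι)
    (w : ι → ℝ) (c : ι → lattice b → ℝ) :
    latticeAvg b φ r (fun z => ∑ i ∈ t, w i * c i z) = ∑ i ∈ t, w i * latticeAvg b φ r (c i) := by
  unfold latticeAvg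
  have h : ∀ i ∈ t, Summable fun z : lattice b => φ (r⁻¹ • (z : E d)) * (w i * c i z) :=
    fun i _ => summable_latticeAvg b hφ hr _
  simp_rw [Finset.mul_sum]
  rw [Summable.tsum_finsetSum h, Finset.mul_sum]
  refine Finset.sum_congr rfl fun i _ => ?_
  simp_rw [mul_left_comm _ (w i)]
  rw [tsum_mul_left, mul_left_comm]

/-- A family vanishing outside a ball of radius `R` and bounded by `ε` has a sum of order
`R ^ d * ε`. -/
lemma exists_abs_tsum_le : ∃ C : ℝ, 0 < C ∧ ∀ (R ε : ℝ) (u : lattice b → ℝ), 1 ≤ R → 0 ≤ ε →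
    (∀ z : lattice b, R < ‖(z : E d)‖ → u z = 0) → (∀ z, |u z| ≤ ε) →
    |∑' z, u z| ≤ C * R ^ d * ε := by
  obtain ⟨C, hC0, hC⟩ := exists_card_latticeBall_le b
  refine ⟨C, hC0, fun R ε u hR hε h0 hu => ?_⟩
  rw [tsum_eq_sum_latticeBall b h0]
  calc |∑ z ∈ latticeBall b R, u z| ≤ ∑ z ∈ latticeBall b R, |u z| := Finset.abs_sum_le_sum_abs _ _
    _ ≤ ∑ _z ∈ latticeBall b R, ε := Finset.sum_le_sum fun z _ => hu z
    _ = (latticeBall b R).card * ε := by rw [Finset.sum_const, nsmul_eq_mul]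
    _ ≤ _ := by gcongr; exact hC R hR

lemma exists_abs_latticeAvg_le (hφ : HasCompactSupport φ) (hc : Continuous φ) :
    ∃ C : ℝ, 0 < C ∧ ∀ (r M : ℝ) (c : lattice b → ℝ), 1 ≤ r → 0 ≤ M → (∀ z, |c z| ≤ M) →
      |latticeAvg b φ r c| ≤ C * M := by
  obtain ⟨C, hC0, hC⟩ := exists_abs_tsum_le b
  obtain ⟨R, hR1, hR⟩ := exists_radius hφ
  obtain ⟨B, hB⟩ := hc.bounded_above_of_compact_support hφ
  have hB0 : 0 ≤ B := (norm_nonneg _).trans (hB 0)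
  refine ⟨C * R ^ d * B + 1, by positivity, fun r M c hr hM hcM => ?_⟩
  have hr0 : 0 < r := by linarith
  have h1 := hC (R * r) (B * M) (fun z => φ (r⁻¹ • (z : E d)) * c z) (by nlinarith)
    (by positivity) (fun z hz => by rw [eq_zero_of_radius hR hr0 _ hz, zero_mul])
    (fun z => by rw [abs_mul]; exact mul_le_mul (hB _) (hcM z) (abs_nonneg _) hB0)
  rw [latticeAvg, abs_mul, abs_of_pos (by positivity : (0 : ℝ) < (r ^ d)⁻¹)]
  calc (r ^ d)⁻¹ * |∑' z : lattice b, φ (r⁻¹ • (z : E d)) * c z|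
      ≤ (r ^ d)⁻¹ * (C * (R * r) ^ d * (B * M)) := by gcongr
    _ = C * R ^ d * B * M := by rw [mul_pow]; field_simp
    _ ≤ _ := by nlinarith

/-- If every weight is compared with the values of `φ` at points moved by a bounded amount, the
normalised sum does not change asymptotically. -/
lemma tendsto_sum_of_close (hφ : HasCompactSupport φ) (hc : Continuous φ) (A M : ℝ)
    (u : ℝ → lattice b → ℝ)
    (hu : ∀ (r : ℝ) (z : lattice b), 0 < r → ∀ η, (∀ y : E d, ‖y‖ ≤ A → |φ (r⁻¹ • ((z : E d) + y)) -
      φ (r⁻¹ • (z : E d))| ≤ η) → |u r z| ≤ M * η) :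
    Tendsto (fun r => (r ^ d)⁻¹ * ∑' z, u r z) atTop (𝓝 0) := by
  obtain ⟨C, hC0, hC⟩ := exists_abs_tsum_le b
  obtain ⟨R, hR1, hR⟩ := exists_radius hφ
  have hA : 0 ≤ |A| := abs_nonneg A
  have hM : 0 ≤ |M| := abs_nonneg M
  rw [Metric.tendsto_atTop]
  intro ε hε
  set η := ε / (2 * (C * (R + 1) ^ d * (|M| + 1))) with hη
  have hη0 : 0 < η := by positivity
  obtain ⟨δ, hδ0, hδ⟩ := Metric.uniformContinuous_iff.1 (hφ.uniformContinuous_of_continuous hc)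
    η hη0
  refine ⟨max 1 (max (|A| + 1) ((|A| + 1) / δ)), fun r hr => ?_⟩
  have hr1 : 1 ≤ r := (le_max_left _ _).trans hr
  have hr2 : |A| + 1 ≤ r := ((le_max_left _ _).trans (le_max_right _ _)).trans hr
  have hr3 : (|A| + 1) / δ ≤ r := ((le_max_right _ _).trans (le_max_right _ _)).trans hr
  have hr0 : 0 < r := by linarith
  have hclose : ∀ (z : lattice b) (y : E d), ‖y‖ ≤ A →
      |φ (r⁻¹ • ((z : E d) + y)) - φ (r⁻¹ • (z : E d))| ≤ η := by
    intro z y hy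
    have := hδ (a := r⁻¹ • ((z : E d) + y)) (b := r⁻¹ • (z : E d)) (by
      rw [dist_eq_norm, ← smul_sub, add_sub_cancel_left, norm_smul, norm_inv,
        Real.norm_of_nonneg hr0.le, ← div_eq_inv_mul, div_lt_iff₀ hr0]
      rw [div_le_iff₀ hδ0] at hr3
      have := le_abs_self A
      linarith)
    rw [Real.dist_eq] at this
    exact this.le
  have h0 : ∀ z : lattice b, (R + 1) * r < ‖(z : E d)‖ → u r z = 0 := by
    intro z hz
    have := hu r z hr0 0 fun y hy => by
      rw [eq_zero_of_radius hR hr0 _ (show R * r < ‖(z : E d)‖ by nlinarith),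
        eq_zero_of_radius hR hr0 _ ?_]
      · simp
      · have h1 : ‖(z : E d)‖ ≤ ‖(z : E d) + y‖ + ‖y‖ := by
          calc ‖(z : E d)‖ = ‖((z : E d) + y) - y‖ := by congr 1; abel
            _ ≤ _ := norm_sub_le _ _
        have := le_abs_self A
        nlinarith
    rw [mul_zero] at this
    exact abs_nonpos_iff.1 this
  have h1 := hC ((R + 1) * r) (|M| * η) (u r) (by nlinarith) (by positivity) h0 (fun z =>
    (hu r z hr0 η (hclose z)).trans (by gcongr; exact le_abs_self M))
  rw [Real.dist_eq, sub_zero, abs_mul, abs_of_pos (by positivity : (0 : ℝ) < (r ^ d)⁻¹)]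
  calc (r ^ d)⁻¹ * |∑' z, u r z| ≤ (r ^ d)⁻¹ * (C * ((R + 1) * r) ^ d * (|M| * η)) := by gcongr
    _ = C * (R + 1) ^ d * |M| * η := by rw [mul_pow]; field_simp
    _ ≤ C * (R + 1) ^ d * (|M| + 1) * η := by gcongr; linarith
    _ = ε / 2 := by rw [hη]; field_simp
    _ < ε := by linarith

/-- Shifting the weights does not change the averages asymptotically. -/
lemma tendsto_latticeAvg_shift (hφ : HasCompactSupport φ) (hc : Continuous φ)
    {c : lattice b → ℝ} {M : ℝ} (hM : ∀ z, |c z| ≤ M) (a : lattice b) :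
    Tendsto (fun r => latticeAvg b φ r (fun z => c (a + z)) - latticeAvg b φ r c)
      atTop (𝓝 0) := by
  have h := tendsto_sum_of_close b hφ hc ‖(a : E d)‖ M
    (fun r z => (φ (r⁻¹ • ((z : E d) - (a : E d))) - φ (r⁻¹ • (z : E d))) * c z) (by
      intro r z hr η hη
      rw [abs_mul, mul_comm]
      have := hη (-(a : E d)) (by rw [norm_neg])
      rw [← sub_eq_add_neg] at this
      exact mul_le_mul (hM z) this (abs_nonneg _) ((abs_nonneg _).trans (hM z)))
  refine h.congr' ?_
  filter_upwards [eventually_gt_atTop 0] with r hr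
  have e1 : ∑' z : lattice b, φ (r⁻¹ • ((z : E d) - (a : E d))) * c z =
      ∑' z : lattice b, φ (r⁻¹ • (z : E d)) * c (a + z) := by
    rw [← (Equiv.addLeft a).tsum_eq]
    refine tsum_congr fun z => ?_
    simp
  have hs : Summable fun z : lattice b => φ (r⁻¹ • ((z : E d) - (a : E d))) * c z := by
    have := (Equiv.addLeft (-a)).summable_iff.2
      (summable_latticeAvg b hφ hr fun z => c (a + z))
    refine this.congr fun z => ?_
    simp [sub_eq_neg_add]
  unfold latticeAvg
  rw [← mul_sub, ← e1, ← hs.tsum_sub (summable_latticeAvg b hφ hr c)]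
  simp_rw [sub_mul]

/-- Riemann sums over the scaled lattice. -/
lemma tendsto_latticeAvg_one (hφ : HasCompactSupport φ) (hc : Continuous φ) :
    Tendsto (fun r => latticeAvg b φ r fun _ => 1) atTop
      (𝓝 ((∫ x, φ x) / (volume (ZSpan.fundamentalDomain b)).toReal)) := by
  set D := ZSpan.fundamentalDomain b
  have hDm : MeasurableSet D := ZSpan.fundamentalDomain_measurableSet b
  have hD0 : volume D ≠ 0 := volume_fundamentalDomain_ne_zero b
  have hDt : volume D ≠ ∞ := volume_fundamentalDomain_ne_top b
  have hDpos : 0 < (volume D).toReal := ENNReal.toReal_pos hD0 hDt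
  have hint : Integrable φ := hc.integrable_of_hasCompactSupport hφ
  have hintr : ∀ r : ℝ, 0 < r → Integrable fun x => φ (r⁻¹ • x) := fun r hr =>
    hint.comp_smul (inv_ne_zero hr.ne')
  have h := tendsto_sum_of_close b hφ hc (cellRadius b) (volume D).toReal
    (fun r z => ∫ t in D, (φ (r⁻¹ • ((z : E d) + t)) - φ (r⁻¹ • (z : E d)))) (by
      intro r z hr η hη
      rw [← Real.norm_eq_abs, mul_comm]
      refine norm_setIntegral_le_of_norm_le_const hDt.lt_top fun t ht => ?_
      exact hη t (norm_le_cellRadius b ht))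
  have hmain : ∀ r : ℝ, 0 < r → (r ^ d)⁻¹ * ∑' z : lattice b,
      ∫ t in D, (φ (r⁻¹ • ((z : E d) + t)) - φ (r⁻¹ • (z : E d))) =
      (∫ x, φ x) - (volume D).toReal * latticeAvg b φ r fun _ => 1 := by
    intro r hr
    have : Countable (lattice b).toAddSubgroup := inferInstanceAs (Countable (lattice b))
    have e1 : ∫ x, φ (r⁻¹ • x) = ∑' z : lattice b, ∫ t in D, φ (r⁻¹ • ((z : E d) + t)) :=
      (ZSpan.isAddFundamentalDomain' b (volume : Measure (E d))).integral_eq_tsum'' _ (hintr r hr)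
    have e2 : ∫ x, φ (r⁻¹ • x) = r ^ d * ∫ x, φ x := by
      rw [Measure.integral_comp_inv_smul_of_nonneg volume φ hr.le, finrank_euclideanSpace_fin,
        smul_eq_mul]
    have e3 : ∀ z : lattice b, ∫ t in D, (φ (r⁻¹ • ((z : E d) + t)) - φ (r⁻¹ • (z : E d))) =
        (∫ t in D, φ (r⁻¹ • ((z : E d) + t))) -
          (volume D).toReal * (φ (r⁻¹ • (z : E d)) * 1) := by
      intro z
      rw [integral_sub, setIntegral_const, smul_eq_mul, mul_one]
      · rfl
      · exact ((hintr r hr).comp_add_left (z : E d)).integrableOn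
      · exact integrableOn_const hDt
    have hs1 : Summable fun z : lattice b => ∫ t in D, φ (r⁻¹ • ((z : E d) + t)) := by
      obtain ⟨R, -, hR⟩ := exists_radius hφ
      refine summable_of_radius b (R := R * r + cellRadius b) fun z hz => ?_
      refine setIntegral_eq_zero_of_forall_eq_zero fun t ht => ?_
      refine eq_zero_of_radius hR hr _ ?_
      have h1 : ‖(z : E d)‖ ≤ ‖(z : E d) + t‖ + ‖t‖ := by
        calc ‖(z : E d)‖ = ‖((z : E d) + t) - t‖ := by congr 1; abel
          _ ≤ _ := norm_sub_le _ _
      have := norm_le_cellRadius b ht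
      linarith
    have hs2 := (summable_latticeAvg b hφ hr fun _ => 1).mul_left (volume D).toReal
    simp_rw [e3]
    rw [hs1.tsum_sub hs2, ← e1, e2, tsum_mul_left, latticeAvg]
    field_simp
  have h2 : Tendsto (fun r => (∫ x, φ x) - (volume D).toReal * latticeAvg b φ r fun _ => 1)
      atTop (𝓝 0) := by
    refine h.congr' ?_
    filter_upwards [eventually_gt_atTop 0] with r hr using hmain r hr
  have h3 := (h2.const_sub (∫ x, φ x)).div_const (volume D).toReal
  simp only [sub_zero, sub_sub_cancel] at h3
  refine h3.congr fun r => ?_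
  field_simp

end LatticeSums

/-! ### A mean ergodic theorem -/

section Ergodic

variable {V : Type*} [NormedAddCommGroup V] [InnerProductSpace ℝ V]
variable {d : ℕ} (b : Module.Basis (Fin d) ℝ (E d))

/-- A stationary family in a Hilbert space has convex combinations that are almost invariant
under translations: any combination whose norm is nearly minimal in the convex hull. -/
lemma exists_almost_invariant {G : Type*} [AddCommGroup G] (ξ : G → V)
    (hξ : ∀ a z w, inner ℝ (ξ (z + a)) (ξ (w + a)) = inner ℝ (ξ z) (ξ w)) {ε : ℝ} (hε : 0 < ε) :
    ∃ (ι : Type) (t : Finset ι) (w : ι → ℝ) (a : ι → G), ∑ i ∈ t, w i = 1 ∧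
      ∀ x : G, ‖∑ i ∈ t, w i • ξ (a i + x) - ∑ i ∈ t, w i • ξ (a i)‖ ≤ ε := by
  set S := convexHull ℝ (Set.range ξ) with hS
  have hne : S.Nonempty := ⟨ξ 0, subset_convexHull ℝ _ ⟨0, rfl⟩⟩
  set m := Metric.infDist 0 S with hm
  have hm0 : 0 ≤ m := Metric.infDist_nonneg
  have hlow : ∀ s ∈ S, m ≤ ‖s‖ := fun s hs => by
    simpa using Metric.infDist_le_dist_of_mem (x := (0 : V)) hs
  set δ := min 1 (ε ^ 2 / (8 * (m + 1))) with hδ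
  have hδ0 : 0 < δ := lt_min one_pos (by positivity)
  have hδ1 : δ ≤ 1 := min_le_left _ _
  have hδ2 : 8 * (m + 1) * δ ≤ ε ^ 2 := by
    have := min_le_right 1 (ε ^ 2 / (8 * (m + 1)))
    rw [← hδ, le_div_iff₀ (by positivity)] at this
    linarith
  obtain ⟨c, hcS, hc⟩ := (Metric.infDist_lt_iff (x := (0 : V)) (r := m + δ) hne).1 (by linarith)
  rw [dist_zero_left] at hc
  have hcS' := hcS
  rw [hS, convexHull_eq] at hcS'
  obtain ⟨ι, t, w, y, hw0, hw1, hy, hcy⟩ := hcS'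
  rw [Finset.centerMass_eq_of_sum_1 _ _ hw1] at hcy
  have hex : ∀ i, ∃ a, i ∈ t → ξ a = y i := fun i => by
    by_cases hi : i ∈ t
    · obtain ⟨a, ha⟩ := hy i hi
      exact ⟨a, fun _ => ha⟩
    · exact ⟨0, fun h => absurd h hi⟩
  choose a ha using hex
  have hc0 : ∑ i ∈ t, w i • ξ (a i) = c := by
    rw [← hcy]
    exact Finset.sum_congr rfl fun i hi => by rw [ha i hi]
  refine ⟨ι, t, w, a, hw1, fun x => ?_⟩
  rw [hc0]
  set cx := ∑ i ∈ t, w i • ξ (a i + x) with hcx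
  have hcxS : cx ∈ S := (convex_convexHull ℝ _).sum_mem hw0 hw1 fun i _ =>
    subset_convexHull ℝ _ ⟨_, rfl⟩
  have hnorm : ‖cx‖ ^ 2 = ‖c‖ ^ 2 := by
    rw [← real_inner_self_eq_norm_sq, ← real_inner_self_eq_norm_sq, ← hc0, hcx]
    simp only [sum_inner, inner_sum, real_inner_smul_left, real_inner_smul_right, hξ]
  have hmid : m ≤ ‖(1 / 2 : ℝ) • cx + (1 / 2 : ℝ) • c‖ :=
    hlow _ ((convex_convexHull ℝ _) hcxS hcS (by norm_num) (by norm_num) (by norm_num))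
  rw [← smul_add, norm_smul] at hmid
  norm_num at hmid
  have hpar := parallelogram_law_with_norm ℝ cx c
  have hsum : (2 * m) ^ 2 ≤ ‖cx + c‖ ^ 2 := by gcongr; linarith
  have hcsq : ‖c‖ ^ 2 ≤ (m + δ) ^ 2 := by gcongr
  refine abs_le_of_sq_le_sq' ?_ hε.le |>.2
  nlinarith

/-- A mean ergodic theorem for smooth averages: the averages of a stationary family against a
compactly supported function of zero integral tend weakly to zero. -/
lemma tendsto_latticeAvg_inner {φ : E d → ℝ} (hφ : HasCompactSupport φ) (hc : Continuous φ)
    (h0 : ∫ x, φ x = 0) (ξ : lattice b → V)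
    (hξ : ∀ a z w, inner ℝ (ξ (z + a)) (ξ (w + a)) = inner ℝ (ξ z) (ξ w)) (y : V) :
    Tendsto (fun r => latticeAvg b φ r fun z => inner ℝ (ξ z) y) atTop (𝓝 0) := by
  obtain ⟨C, hC0, hC⟩ := exists_abs_latticeAvg_le b hφ hc
  have hbound : ∀ z, |inner ℝ (ξ z) y| ≤ ‖ξ 0‖ * ‖y‖ := by
    intro z
    have h1 : ‖ξ z‖ = ‖ξ 0‖ := by
      have h2 := hξ z 0 0
      rw [zero_add, real_inner_self_eq_norm_sq, real_inner_self_eq_norm_sq] at h2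
      exact (pow_left_inj₀ (norm_nonneg _) (norm_nonneg _) two_ne_zero).1 h2
    rw [← h1]
    exact abs_real_inner_le_norm _ _
  rw [Metric.tendsto_atTop']
  intro ε hε
  obtain ⟨ι, t, w, a, hw, hinv⟩ := exists_almost_invariant ξ hξ
    (ε := ε / (2 * C * (‖y‖ + 1))) (by positivity)
  set c : V := ∑ i ∈ t, w i • ξ (a i) with hcdef
  -- replacing the family by its convex combinations does not change the averages
  have h1 : Tendsto (fun r => ∑ i ∈ t, w i * (latticeAvg b φ r (fun z => inner ℝ (ξ (a i + z)) y) -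
      latticeAvg b φ r fun z => inner ℝ (ξ z) y)) atTop (𝓝 0) := by
    have := tendsto_finsetSum t fun i _ =>
      (tendsto_latticeAvg_shift b hφ hc hbound (a i)).const_mul (w i)
    simpa using this
  have h2 : Tendsto (fun r => inner ℝ c y * latticeAvg b φ r fun _ => 1) atTop (𝓝 0) := by
    have := (tendsto_latticeAvg_one b hφ hc).const_mul (inner ℝ c y)
    simpa [h0] using this
  have h3 := h2.sub h1
  rw [sub_zero] at h3
  obtain ⟨N, hN⟩ := (Metric.tendsto_atTop').1 h3 (ε / 2) (by positivity)
  refine ⟨max N 1, fun r hr => ?_⟩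
  have hr1 : 1 < r := (le_max_right _ _).trans_lt hr
  have hr0 : 0 < r := by linarith
  have h4 := hN r ((le_max_left _ _).trans_lt hr)
  have h5 := hC r (ε / (2 * C * (‖y‖ + 1)) * ‖y‖)
    (fun z => ∑ i ∈ t, w i * inner ℝ (ξ (a i + z)) y - inner ℝ c y) hr1.le (by positivity) (by
      intro z
      have : ∑ i ∈ t, w i * inner ℝ (ξ (a i + z)) y - inner ℝ c y =
          inner ℝ (∑ i ∈ t, w i • ξ (a i + z) - c) y := by
        simp only [inner_sub_left, sum_inner, real_inner_smul_left]
      rw [this]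
      exact (abs_real_inner_le_norm _ _).trans (by gcongr; exact hinv z))
  have e1 : latticeAvg b φ r (fun z => ∑ i ∈ t, w i * inner ℝ (ξ (a i + z)) y - inner ℝ c y) =
      ∑ i ∈ t, w i * latticeAvg b φ r (fun z => inner ℝ (ξ (a i + z)) y) -
        inner ℝ c y * latticeAvg b φ r fun _ => 1 := by
    rw [latticeAvg_sub b hφ hr0, latticeAvg_sum b hφ hr0]
    congr 1
    unfold latticeAvg
    simp_rw [mul_one]
    rw [tsum_mul_right]
    ring
  rw [e1] at h5
  simp_rw [mul_sub] at h4
  rw [Finset.sum_sub_distrib, ← Finset.sum_mul, hw, one_mul] at h4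
  rw [Real.dist_eq, sub_zero] at h4 ⊢
  have h6 : C * (ε / (2 * C * (‖y‖ + 1)) * ‖y‖) ≤ ε / 2 := by
    have : C * (ε / (2 * C * (‖y‖ + 1)) * ‖y‖) = ε / 2 * (‖y‖ / (‖y‖ + 1)) := by field_simp
    rw [this]
    have : ‖y‖ / (‖y‖ + 1) ≤ 1 := by rw [div_le_one (by positivity)]; linarith
    nlinarith
  have h5' := abs_le.1 (h5.trans h6)
  have h4' := abs_lt.1 h4
  rw [abs_lt]
  constructor <;> linarith [h5'.1, h5'.2, h4'.1, h4'.2]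

end Ergodic

/-! ### Sums over planar shells -/

section Shells

variable (b : Module.Basis (Fin 2) ℝ (E 2))

/-- In the plane, sums over lattice points of a function of the integer part of the norm are
controlled by counting at most `C * (n + 1)` points at distance between `n` and `n + 1`. -/
lemma exists_shell_sum_le : ∃ C : ℝ, 0 < C ∧ ∀ (N : ℕ) (F : Finset (lattice b)) (G : ℕ → ℝ),
    (∀ z ∈ F, ‖(z : E 2)‖ < N) → (∀ n, 0 ≤ G n) →
    ∑ z ∈ F, G ⌊‖(z : E 2)‖⌋₊ ≤ ∑ n ∈ Finset.range N, C * (n + 1) * G n := by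
  set D := volume (ZSpan.fundamentalDomain b)
  set w := volume (Metric.closedBall (0 : E 2) 1) with hw
  have hwt : w ≠ ∞ := measure_closedBall_lt_top.ne
  have hw0 : w ≠ 0 := (Metric.measure_closedBall_pos volume _ one_pos).ne'
  have hD0 : D ≠ 0 := volume_fundamentalDomain_ne_zero b
  have hDt : D ≠ ∞ := volume_fundamentalDomain_ne_top b
  have hρ := cellRadius_nonneg b
  set ρ := cellRadius b
  have hwp : 0 < (w / D).toReal := ENNReal.toReal_pos (ENNReal.div_ne_zero.2 ⟨hw0, hDt⟩)
    (ENNReal.div_ne_top hwt hD0)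
  set C := 4 * (1 / 2 + ρ) * (1 + ρ) * (w / D).toReal with hC
  have hC0 : 0 < C := by positivity
  refine ⟨C, hC0, fun N F G hF hG => ?_⟩
  have hmaps : ∀ z ∈ F, ⌊‖(z : E 2)‖⌋₊ ∈ Finset.range N := fun z hz =>
    Finset.mem_range.2 ((Nat.floor_lt (norm_nonneg _)).2 (hF z hz))
  rw [← Finset.sum_fiberwise_of_maps_to hmaps]
  refine Finset.sum_le_sum fun n _ => ?_
  rw [Finset.sum_congr rfl fun z hz => by rw [(Finset.mem_filter.1 hz).2], Finset.sum_const,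
    nsmul_eq_mul]
  refine mul_le_mul_of_nonneg_right ?_ (hG n)
  have h1 := card_le_of_subset b (F.filter fun z => ⌊‖(z : E 2)‖⌋₊ = n)
    (shell 2 (n + 1 / 2) (1 / 2)) (shell 2 (n + 1 / 2) (1 / 2 + ρ)) (measurableSet_shell _ _)
    (fun y hy t ht => by
      have hy' : |‖y‖ - (n + 1 / 2)| ≤ 1 / 2 := hy
      have h1 : |‖y + t‖ - ‖y‖| ≤ ‖t‖ := by
        simpa using abs_norm_sub_norm_le (y + t) y
      have h2 := abs_add_le (‖y + t‖ - ‖y‖) (‖y‖ - (n + 1 / 2))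
      have e : ‖y + t‖ - (n + 1 / 2 : ℝ) = (‖y + t‖ - ‖y‖) + (‖y‖ - (n + 1 / 2)) := by ring
      change |‖y + t‖ - (n + 1 / 2)| ≤ _
      rw [e]
      linarith)
    (fun z hz => by
      have h3 := (Nat.floor_eq_iff (norm_nonneg _)).1 (Finset.mem_filter.1 hz).2
      have h4 : |‖(z : E 2)‖ - (n + 1 / 2)| ≤ 1 / 2 :=
        abs_le.2 ⟨by linarith [h3.1], by linarith [h3.2]⟩
      exact h4)
  have h2 := h1.trans (ENNReal.div_le_div_right (volume_shell_le (d := 2) (Or.inr rfl)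
    (by positivity) (by positivity)) _)
  rw [mul_div_assoc] at h2
  have h3 := ENNReal.toReal_mono (ENNReal.mul_ne_top (by simp) (ENNReal.div_ne_top hwt hD0)) h2
  rw [ENNReal.toReal_mul, ENNReal.toReal_ofReal (by positivity), ENNReal.toReal_natCast] at h3
  refine h3.trans ?_
  have hn : (0 : ℝ) ≤ n := Nat.cast_nonneg n
  have : (n : ℝ) + 1 / 2 + (1 / 2 + ρ) ≤ (1 + ρ) * (n + 1) := by nlinarith
  calc 4 * (1 / 2 + ρ) * ((n : ℝ) + 1 / 2 + (1 / 2 + ρ)) ^ (2 - 1) * (w / D).toReal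
      ≤ 4 * (1 / 2 + ρ) * ((1 + ρ) * (n + 1)) * (w / D).toReal := by
        rw [show 2 - 1 = 1 from rfl, pow_one]; gcongr
    _ = C * (n + 1) := by rw [hC]; ring

lemma sum_sub_shift_le {g : ℕ → ℝ} {β : ℝ} (h0 : ∀ n, 0 ≤ g n) (h1 : ∀ n, g n ≤ β) (N L : ℕ) :
    ∑ n ∈ Finset.range N, (g n - g (n + L)) ≤ L * β := by
  induction L with
  | zero => simp
  | succ L ih =>
    have h2 : ∑ n ∈ Finset.range N, (g n - g (n + (L + 1))) =
        ∑ n ∈ Finset.range N, (g n - g (n + L)) +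
        ∑ n ∈ Finset.range N, (g (n + L) - g (n + 1 + L)) := by
      rw [← Finset.sum_add_distrib]
      refine Finset.sum_congr rfl fun n _ => ?_
      rw [show n + 1 + L = n + (L + 1) by ring]
      ring
    rw [h2, Finset.sum_range_sub' (fun n => g (n + L))]
    push_cast
    linarith [h1 (0 + L), h0 (N + L)]

/-- The oscillations of a bounded monotone function of the norm at scale `K` telescope over the
shells, so that their sum is of the order of the number of points of the largest shell. The sum of
the inverse norms is of the same order. -/
lemma exists_sum_osc_le : ∃ C : ℝ, 0 < C ∧
    (∀ (N K : ℕ) (F : Finset (lattice b)) (f : ℝ → ℝ) (β : ℝ), (∀ z ∈ F, ‖(z : E 2)‖ < N) →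
      Antitone f → (∀ t, 0 ≤ f t) → (∀ t, f t ≤ β) →
      ∑ z ∈ F, (f (‖(z : E 2)‖ - K) - f (‖(z : E 2)‖ + K)) ≤ C * N * ((2 * K + 1) * β)) ∧
    (∀ (N : ℕ) (F : Finset (lattice b)), (∀ z ∈ F, ‖(z : E 2)‖ < N) →
      ∑ z ∈ F, (max ‖(z : E 2)‖ 1)⁻¹ ≤ 2 * C * N) := by
  obtain ⟨C, hC0, hC⟩ := exists_shell_sum_le b
  refine ⟨C, hC0, fun N K F f β hF hf h0 hβ => ?_, fun N F hF => ?_⟩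
  · have h1 := hC N F (fun n => f (n - K) - f (n + 1 + K)) hF (fun n => by
      have : (n : ℝ) - K ≤ n + 1 + K := by
        have : (0 : ℝ) ≤ K := Nat.cast_nonneg K
        linarith
      linarith [hf this])
    calc ∑ z ∈ F, (f (‖(z : E 2)‖ - K) - f (‖(z : E 2)‖ + K))
        ≤ ∑ z ∈ F, (f ((⌊‖(z : E 2)‖⌋₊ : ℝ) - K) - f (⌊‖(z : E 2)‖⌋₊ + 1 + K)) := by
          refine Finset.sum_le_sum fun z _ => ?_
          have h2 := Nat.floor_le (norm_nonneg (z : E 2))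
          have h3 := Nat.lt_floor_add_one ‖(z : E 2)‖
          exact sub_le_sub (hf (by linarith)) (hf (by linarith))
      _ ≤ _ := h1
      _ ≤ ∑ n ∈ Finset.range N, C * N * (f ((n : ℝ) - K) - f (n + 1 + K)) := by
          refine Finset.sum_le_sum fun n hn => ?_
          have hn' : (n : ℝ) + 1 ≤ N := by exact_mod_cast Finset.mem_range.1 hn
          have : (n : ℝ) - K ≤ n + 1 + K := by
            have : (0 : ℝ) ≤ K := Nat.cast_nonneg K
            linarith
          have h4 := sub_nonneg.2 (hf this)
          gcongr
      _ = C * N * ∑ n ∈ Finset.range N,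
          (f ((n : ℝ) - K) - f (((n + (2 * K + 1) : ℕ) : ℝ) - K)) := by
          rw [Finset.mul_sum]
          refine Finset.sum_congr rfl fun n _ => ?_
          congr 3
          push_cast
          ring
      _ ≤ _ := by
          gcongr
          have := sum_sub_shift_le (g := fun n : ℕ => f ((n : ℝ) - K)) (fun n => h0 _)
            (fun n => hβ _) N (2 * K + 1)
          push_cast at this ⊢
          exact this
  · have h1 := hC N F (fun n => 2 / ((n : ℝ) + 1)) hF (fun n => by positivity)
    calc ∑ z ∈ F, (max ‖(z : E 2)‖ 1)⁻¹ ≤ ∑ z ∈ F, 2 / ((⌊‖(z : E 2)‖⌋₊ : ℝ) + 1) := by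
          refine Finset.sum_le_sum fun z _ => ?_
          have h2 := Nat.floor_le (norm_nonneg (z : E 2))
          have h3 : 0 < max ‖(z : E 2)‖ 1 := lt_max_of_lt_right one_pos
          rw [inv_le_comm₀ h3 (by positivity), inv_div]
          rw [div_le_iff₀ two_pos]
          linarith [le_max_left ‖(z : E 2)‖ 1, le_max_right ‖(z : E 2)‖ 1]
      _ ≤ _ := h1
      _ = 2 * C * N := by
          have h2 : ∀ n ∈ Finset.range N, C * ((n : ℝ) + 1) * (2 / ((n : ℝ) + 1)) = 2 * C :=
            fun n _ => by field_simp
          rw [Finset.sum_congr rfl h2, Finset.sum_const, Finset.card_range, nsmul_eq_mul]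
          ring

end Shells

/-! ### First order expansion of radial functions -/

section Radial

variable {V : Type*} [NormedAddCommGroup V] [InnerProductSpace ℝ V]

lemma abs_norm_add_sub_le (x y : V) :
    |‖x + y‖ - ‖x‖ - inner ℝ x y / ‖x‖| ≤ 2 * ‖y‖ := by
  have h1 : |‖x + y‖ - ‖x‖| ≤ ‖y‖ := by simpa using abs_norm_sub_norm_le (x + y) x
  have h2 : |inner ℝ x y / ‖x‖| ≤ ‖y‖ := by
    rw [abs_div, abs_norm]
    refine div_le_of_le_mul₀ (norm_nonneg _) (norm_nonneg _) ?_
    rw [mul_comm]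
    exact abs_real_inner_le_norm x y
  exact (abs_sub _ _).trans (by linarith)

lemma abs_norm_add_sub_le_sq {x : V} (hx : x ≠ 0) (y : V) :
    |‖x + y‖ - ‖x‖ - inner ℝ x y / ‖x‖| ≤ ‖y‖ ^ 2 / (2 * ‖x‖) := by
  have hx0 : 0 < ‖x‖ := norm_pos_iff.2 hx
  have h1 := norm_add_sq_real x y
  have h2 : |‖x + y‖ - ‖x‖| ≤ ‖y‖ := by simpa using abs_norm_sub_norm_le (x + y) x
  have h3 : (‖x + y‖ - ‖x‖) ^ 2 ≤ ‖y‖ ^ 2 :=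
    sq_le_sq' (by linarith [(abs_le.1 h2).1]) (abs_le.1 h2).2
  have e : ‖x + y‖ - ‖x‖ - inner ℝ x y / ‖x‖ =
      (‖y‖ ^ 2 - (‖x + y‖ - ‖x‖) ^ 2) / (2 * ‖x‖) := by
    field_simp
    linarith
  rw [e, abs_div, abs_of_pos (by positivity : 0 < 2 * ‖x‖)]
  gcongr
  rw [abs_le]
  constructor <;> nlinarith [sq_nonneg (‖x + y‖ - ‖x‖), sq_nonneg ‖y‖]

/-- First order expansion of a radial function with profile derivative `-κ`: the error splits
into the oscillation of `κ` and the curvature of the spheres. -/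
lemma abs_radial_remainder_le {Φ κ : ℝ → ℝ} (hΦ : ∀ s, HasDerivAt Φ (-κ s) s) {x y : V} {δ M : ℝ}
    (hy : ‖y‖ ≤ δ) (hM : ∀ t, 0 ≤ t → |t - ‖x‖| ≤ δ → |κ t - κ ‖x‖| ≤ M) :
    |Φ ‖x + y‖ - Φ ‖x‖ + κ ‖x‖ * (inner ℝ x y / ‖x‖)| ≤
      M * δ + |κ ‖x‖| * |‖x + y‖ - ‖x‖ - inner ℝ x y / ‖x‖| := by
  set s := ‖x‖ with hs
  have hdist : |‖x + y‖ - s| ≤ ‖y‖ := by simpa using abs_norm_sub_norm_le (x + y) x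
  have hM0 : 0 ≤ M := (abs_nonneg _).trans (hM s (norm_nonneg _) (by
    simpa using (norm_nonneg y).trans hy))
  have hmv := (convex_uIcc s ‖x + y‖).norm_image_sub_le_of_norm_hasDerivWithin_le
    (f := fun t => Φ t + κ s * t) (f' := fun t => -κ t + κ s) (C := M)
    (fun t _ => by
      have := (hΦ t).add ((hasDerivAt_id t).const_mul (κ s))
      simp only [mul_one] at this
      exact this.hasDerivWithinAt)
    (fun t ht => by
      have h1 : |t - s| ≤ |‖x + y‖ - s| := by
        have := Set.abs_sub_left_of_mem_uIcc ht
        exact this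
      have h0 : 0 ≤ t := by
        rcases Set.mem_uIcc.1 ht with h | h
        · exact (norm_nonneg _).trans h.1
        · exact (norm_nonneg _).trans h.1
      rw [Real.norm_eq_abs, neg_add_eq_sub, abs_sub_comm]
      exact hM t h0 (h1.trans (hdist.trans hy)))
    Set.left_mem_uIcc Set.right_mem_uIcc
  rw [Real.norm_eq_abs, Real.norm_eq_abs] at hmv
  have e : Φ ‖x + y‖ - Φ s + κ s * (inner ℝ x y / s) =
      (Φ ‖x + y‖ + κ s * ‖x + y‖ - (Φ s + κ s * s)) - κ s * (‖x + y‖ - s - inner ℝ x y / s) := by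
    ring
  rw [e]
  refine (abs_sub _ _).trans ?_
  rw [abs_mul]
  gcongr
  exact hmv.trans (by gcongr; exact hdist.trans hy)

end Radial

/-! ### Second order expansion of smooth radial functions -/

section Smooth

/-- Second order Taylor expansion with a uniform remainder. -/
lemma exists_taylor_two {F f f' : ℝ → ℝ} (hF : ∀ t, HasDerivAt F (f t) t)
    (hf : ∀ t, HasDerivAt f (f' t) t) (hu : UniformContinuous f') {ε : ℝ} (hε : 0 < ε) :
    ∃ δ > 0, ∀ t τ : ℝ, |τ| ≤ δ →
      |F (t + τ) - F t - f t * τ - 1 / 2 * f' t * τ ^ 2| ≤ ε * τ ^ 2 := by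
  obtain ⟨δ, hδ0, hδ⟩ := Metric.uniformContinuous_iff.1 hu ε hε
  refine ⟨δ / 2, by positivity, fun t τ hτ => ?_⟩
  have hseg : ∀ s ∈ Set.uIcc (0 : ℝ) τ, |s| ≤ |τ| := fun s hs => by
    simpa using Set.abs_sub_left_of_mem_uIcc hs
  have h1 : ∀ s ∈ Set.uIcc (0 : ℝ) τ, |f (t + s) - f t - f' t * s| ≤ ε * |τ| := by
    intro s hs
    have hmv := (convex_uIcc (0 : ℝ) s).norm_image_sub_le_of_norm_hasDerivWithin_le
      (f := fun s => f (t + s) - f' t * s) (f' := fun s => f' (t + s) - f' t) (C := ε)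
      (fun s _ => by
        have h := ((hf (t + s)).comp_const_add t s).sub ((hasDerivAt_id s).const_mul (f' t))
        simp only [mul_one] at h
        exact h.hasDerivWithinAt)
      (fun s' hs' => by
        have h2 : |s'| ≤ |s| := by simpa using Set.abs_sub_left_of_mem_uIcc hs'
        have := hδ (a := t + s') (b := t) (by
          rw [Real.dist_eq, add_sub_cancel_left]
          linarith [hseg s hs])
        rw [Real.dist_eq] at this
        exact this.le)
      Set.left_mem_uIcc Set.right_mem_uIcc
    simp only [Real.norm_eq_abs, add_zero, mul_zero, sub_zero] at hmv
    rw [show f (t + s) - f t - f' t * s = f (t + s) - f' t * s - f t by ring]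
    exact hmv.trans (mul_le_mul_of_nonneg_left (hseg s hs) hε.le)
  have hmv := (convex_uIcc (0 : ℝ) τ).norm_image_sub_le_of_norm_hasDerivWithin_le
    (f := fun s => F (t + s) - f t * s - 1 / 2 * f' t * s ^ 2)
    (f' := fun s => f (t + s) - f t - f' t * s) (C := ε * |τ|)
    (fun s _ => by
      have h := (((hF (t + s)).comp_const_add t s).sub ((hasDerivAt_id s).const_mul (f t))).sub
        ((hasDerivAt_pow 2 s).const_mul (1 / 2 * f' t))
      refine (h.congr_deriv ?_).hasDerivWithinAt
      norm_num
      ring)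
    (fun s hs => h1 s hs) Set.left_mem_uIcc Set.right_mem_uIcc
  simp only [Real.norm_eq_abs, add_zero, mul_zero, sub_zero, ne_eq, OfNat.ofNat_ne_zero,
    not_false_eq_true, zero_pow] at hmv
  rw [show F (t + τ) - F t - f t * τ - 1 / 2 * f' t * τ ^ 2 =
    F (t + τ) - f t * τ - 1 / 2 * f' t * τ ^ 2 - F t by ring]
  refine hmv.trans_eq ?_
  rw [mul_assoc, ← sq, sq_abs]

/-- Second order expansion of a function of the squared norm. -/
lemma exists_taylor_normSq {V : Type*} [NormedAddCommGroup V] [InnerProductSpace ℝ V]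
    {F f f' : ℝ → ℝ} (hF : ∀ t, HasDerivAt F (f t) t)
    (hf : ∀ t, HasDerivAt f (f' t) t) (hu : UniformContinuous f') {B : ℝ} (hB : ∀ t, |f' t| ≤ B)
    {ε : ℝ} (hε : 0 < ε) :
    ∃ δ > 0, ∀ x y : V, ‖x‖ ≤ 3 → ‖y‖ ≤ δ →
      |F (‖x + y‖ ^ 2) - F (‖x‖ ^ 2) - 2 * f (‖x‖ ^ 2) * inner ℝ x y -
        (f (‖x‖ ^ 2) * ‖y‖ ^ 2 + 2 * f' (‖x‖ ^ 2) * inner ℝ x y ^ 2)| ≤ ε * ‖y‖ ^ 2 := by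
  have hB0 : 0 ≤ B := (abs_nonneg _).trans (hB 0)
  obtain ⟨δ, hδ0, hδ⟩ := exists_taylor_two hF hf hu (ε := ε / 98) (by positivity)
  refine ⟨min 1 (min (δ / 7) (ε / (14 * (B + 1)))), by positivity, fun x y hx hy => ?_⟩
  have hy1 : ‖y‖ ≤ 1 := hy.trans (min_le_left _ _)
  have hy2 : ‖y‖ ≤ δ / 7 := hy.trans ((min_le_right _ _).trans (min_le_left _ _))
  have hy3 : ‖y‖ ≤ ε / (14 * (B + 1)) := hy.trans ((min_le_right _ _).trans (min_le_right _ _))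
  have hy0 := norm_nonneg y
  set t := ‖x‖ ^ 2 with ht
  set i : ℝ := inner ℝ x y with hi
  have hin : |i| ≤ 3 * ‖y‖ := (abs_real_inner_le_norm x y).trans (by gcongr)
  set τ := 2 * i + ‖y‖ ^ 2 with hτ
  have hadd : ‖x + y‖ ^ 2 = t + τ := by rw [norm_add_sq_real]; ring
  have hτle : |τ| ≤ 7 * ‖y‖ := by
    have h1 := abs_add_le (2 * i) (‖y‖ ^ 2)
    rw [abs_mul, abs_two, abs_of_nonneg (sq_nonneg ‖y‖)] at h1
    nlinarith
  have h1 := hδ t τ (hτle.trans (by linarith))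
  have h2 : τ ^ 2 ≤ 49 * ‖y‖ ^ 2 := by
    have := pow_le_pow_left₀ (abs_nonneg τ) hτle 2
    rw [sq_abs] at this
    linarith
  have h3 : |f' t * (2 * i * ‖y‖ ^ 2 + 1 / 2 * ‖y‖ ^ 4)| ≤ ε / 2 * ‖y‖ ^ 2 := by
    rw [abs_mul]
    have h4 : |2 * i * ‖y‖ ^ 2 + 1 / 2 * ‖y‖ ^ 4| ≤ 7 * ‖y‖ * ‖y‖ ^ 2 := by
      have h5 := abs_add_le (2 * i * ‖y‖ ^ 2) (1 / 2 * ‖y‖ ^ 4)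
      rw [abs_mul, abs_mul, abs_two, abs_of_nonneg (sq_nonneg ‖y‖),
        abs_of_nonneg (by positivity : 0 ≤ 1 / 2 * ‖y‖ ^ 4)] at h5
      have h6 : ‖y‖ ^ 4 ≤ ‖y‖ * ‖y‖ ^ 2 := by
        calc ‖y‖ ^ 4 = ‖y‖ * ‖y‖ * ‖y‖ ^ 2 := by ring
          _ ≤ ‖y‖ * 1 * ‖y‖ ^ 2 := by gcongr
          _ = _ := by ring
      have h7 : |i| * ‖y‖ ^ 2 ≤ 3 * ‖y‖ * ‖y‖ ^ 2 := by gcongr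
      have h8 : 0 ≤ ‖y‖ * ‖y‖ ^ 2 := by positivity
      linarith
    rw [le_div_iff₀ (by positivity)] at hy3
    calc |f' t| * |2 * i * ‖y‖ ^ 2 + 1 / 2 * ‖y‖ ^ 4| ≤ B * (7 * ‖y‖ * ‖y‖ ^ 2) := by
          gcongr; exact hB t
      _ = (‖y‖ * (14 * B)) / 2 * ‖y‖ ^ 2 := by ring
      _ ≤ ε / 2 * ‖y‖ ^ 2 := by gcongr; nlinarith
  have e : F (‖x + y‖ ^ 2) - F t - 2 * f t * i - (f t * ‖y‖ ^ 2 + 2 * f' t * i ^ 2) =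
      (F (t + τ) - F t - f t * τ - 1 / 2 * f' t * τ ^ 2) +
        f' t * (2 * i * ‖y‖ ^ 2 + 1 / 2 * ‖y‖ ^ 4) := by
    rw [hadd, hτ]; ring
  rw [e]
  refine (abs_add_le _ _).trans ?_
  nlinarith

variable {d : ℕ}

/-- The second derivatives of a radial function with profile `F (‖x‖ ^ 2)`, up to a factor two,
where `f` is the derivative of `F`. -/
noncomputable def radialHessian (f f' : ℝ → ℝ) (i j : Fin d) (x : E d) : ℝ :=
  (if i = j then f (‖x‖ ^ 2) else 0) + 2 * f' (‖x‖ ^ 2) * (x i * x j)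

lemma continuous_radialHessian {f f' : ℝ → ℝ} (hf : Continuous f) (hf' : Continuous f')
    (i j : Fin d) : Continuous (radialHessian f f' i j) := by
  unfold radialHessian
  split_ifs <;> fun_prop

lemma hasCompactSupport_radialHessian {f f' : ℝ → ℝ} (h : ∀ t, 4 < t → f t = 0)
    (h' : ∀ t, 4 < t → f' t = 0) (i j : Fin d) : HasCompactSupport (radialHessian f f' i j) := by
  refine HasCompactSupport.of_support_subset_isCompact (isCompact_closedBall (0 : E d) 2)
    fun x hx => ?_
  by_contra hn
  rw [mem_closedBall_zero_iff, not_le] at hn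
  have : 4 < ‖x‖ ^ 2 := by nlinarith
  refine hx ?_
  simp [radialHessian, h _ this, h' _ this]

/-- Second derivatives of a compactly supported function have zero integral. -/
lemma integral_radialHessian {f f' : ℝ → ℝ} (hf : ∀ t, HasDerivAt f (f' t) t)
    (hf' : Continuous f') (h : ∀ t, 4 < t → f t = 0)
    (h' : ∀ t, 4 < t → f' t = 0) (i j : Fin d) : ∫ x, radialHessian f f' i j x = 0 := by
  have hcf : Continuous f := continuous_iff_continuousAt.2 fun t => (hf t).continuousAt
  set ψ : E d → ℝ := fun x => f (‖x‖ ^ 2) * x i with hψ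
  have hder : ∀ x : E d, HasFDerivAt ψ (f (‖x‖ ^ 2) • (EuclideanSpace.proj i : E d →L[ℝ] ℝ) +
      x i • (f' (‖x‖ ^ 2) • (2 • (innerSL ℝ x)))) x := by
    intro x
    have h1 : HasFDerivAt (fun x : E d => ‖x‖ ^ 2) (2 • (innerSL ℝ x)) x :=
      (hasStrictFDerivAt_norm_sq x).hasFDerivAt
    have h2 := (hf (‖x‖ ^ 2)).comp_hasFDerivAt x h1
    exact h2.mul (EuclideanSpace.proj i : E d →L[ℝ] ℝ).hasFDerivAt
  have hval : ∀ x : E d, fderiv ℝ ψ x (EuclideanSpace.single j 1) = radialHessian f f' i j x := by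
    intro x
    rw [(hder x).fderiv, radialHessian]
    simp only [_root_.add_apply, _root_.smul_apply, smul_eq_mul,
      innerSL_apply_apply, EuclideanSpace.inner_single_right, PiLp.proj_apply,
      nsmul_eq_mul]
    by_cases hij : i = j
    · subst hij; simp; ring
    · simp [hij]; ring
  have hψc : Continuous ψ := by
    simp only [hψ]; fun_prop
  have hψs : HasCompactSupport ψ := by
    refine HasCompactSupport.of_support_subset_isCompact (isCompact_closedBall (0 : E d) 2)
      fun x hx => ?_
    by_contra hn
    rw [mem_closedBall_zero_iff, not_le] at hn
    have : 4 < ‖x‖ ^ 2 := by nlinarith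
    exact hx (by simp [hψ, h _ this])
  have hint := (continuous_radialHessian hcf hf' i j).integrable_of_hasCompactSupport (μ := volume)
    (hasCompactSupport_radialHessian h h' i j)
  have hparts := integral_mul_fderiv_eq_neg_fderiv_mul_of_integrable (μ := (volume : Measure (E d)))
    (𝕜 := ℝ) (f := fun _ : E d => (1 : ℝ)) (g := ψ) (v := EuclideanSpace.single j 1)
    (by simp) (by simpa [hval] using hint)
    (by simpa using hψc.integrable_of_hasCompactSupport hψs)
    (fun x _ => differentiableAt_const _) (fun x _ => (hder x).differentiableAt)
  simpa [hval] using hparts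

end Smooth

/-! ### The area of a lens and its smooth approximations -/

/-- The profile of the normalised area of the intersection of two discs: for `s ≥ 0`, two unit
discs whose centres are at distance `s` have an intersection of area `lensProfile s`. -/
noncomputable def lensProfile (s : ℝ) : ℝ := ∫ t in s..2, √(4 - t ^ 2)

lemma sqrt_eq_zero_of_two_le {s : ℝ} (hs : 2 ≤ s) : √(4 - s ^ 2) = 0 :=
  Real.sqrt_eq_zero_of_nonpos (by nlinarith)

lemma hasDerivAt_lensProfile (s : ℝ) : HasDerivAt lensProfile (-√(4 - s ^ 2)) s := by
  have hc : Continuous fun t : ℝ => √(4 - t ^ 2) := by fun_prop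
  have h := (hc.integral_hasStrictDerivAt 2 s).hasDerivAt.neg
  refine h.congr_of_eventuallyEq (Eventually.of_forall fun u => ?_)
  exact intervalIntegral.integral_symm _ _

lemma continuous_lensProfile : Continuous lensProfile :=
  continuous_iff_continuousAt.2 fun s => (hasDerivAt_lensProfile s).continuousAt

lemma lensProfile_of_two_le {s : ℝ} (hs : 2 ≤ s) : lensProfile s = 0 := by
  rw [lensProfile, intervalIntegral.integral_congr (g := fun _ => 0),
    intervalIntegral.integral_zero]
  intro t ht
  rw [Set.uIcc_of_ge hs] at ht
  exact sqrt_eq_zero_of_two_le ht.1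

/-- A twice differentiable approximation `F (s ^ 2)` of `lensProfile s`, such that the derivative
of the difference is, up to sign, a combination of bounded antitone functions which are either at
most `σ` or supported on `s < σ`. -/
structure SmoothApprox (σ : ℝ) where
  /-- The approximation, as a function of the squared distance. -/
  F : ℝ → ℝ
  /-- The derivative of `F`. -/
  f : ℝ → ℝ
  /-- The second derivative of `F`. -/
  f' : ℝ → ℝ
  /-- The part of the derivative of the difference near the origin. -/
  g₁ : ℝ → ℝ
  /-- The positive part of the derivative of the difference near `s = 2`. -/
  g₂ : ℝ → ℝ
  /-- The negative part of the derivative of the difference near `s = 2`. -/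
  g₃ : ℝ → ℝ
  hasDerivAt_F : ∀ t, HasDerivAt F (f t) t
  hasDerivAt_f : ∀ t, HasDerivAt f (f' t) t
  F_eq_zero : ∀ t, 4 ≤ t → F t = 0
  f_eq_zero : ∀ t, 4 < t → f t = 0
  f'_eq_zero : ∀ t, 4 < t → f' t = 0
  continuous_f' : Continuous f'
  uniformContinuous_f' : UniformContinuous f'
  bounded_f' : ∃ B, ∀ t, |f' t| ≤ B
  antitone₁ : Antitone g₁
  antitone₂ : Antitone g₂
  antitone₃ : Antitone g₃
  nonneg₁ : ∀ s, 0 ≤ g₁ s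
  nonneg₂ : ∀ s, 0 ≤ g₂ s
  nonneg₃ : ∀ s, 0 ≤ g₃ s
  le₁ : ∀ s, g₁ s ≤ 2
  le₂ : ∀ s, g₂ s ≤ σ
  le₃ : ∀ s, g₃ s ≤ σ
  eq_zero₁ : ∀ s, σ ≤ s → g₁ s = 0
  eq_sub : ∀ s, 0 ≤ s → √(4 - s ^ 2) + 2 * s * f (s ^ 2) = g₁ s + g₂ s - g₃ s

/-- A cut-off removing the two singularities of the derivative of `lensProfile (√t)`, at `t = 0`
and `t = 4`, provides smooth approximations. -/
lemma nonempty_smoothApprox {σ : ℝ} (hσ0 : 0 < σ) (hσ1 : σ ≤ 1) : Nonempty (SmoothApprox σ) := by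
  have hσ2 : 0 < σ ^ 2 := by positivity
  have hσ3 : σ ^ 2 ≤ 1 := by nlinarith
  set α : ℝ → ℝ := fun t => 1 - Real.smoothTransition (2 * t / σ ^ 2 - 1) with hα
  have hα0 : ∀ t, 0 ≤ α t := fun t => sub_nonneg.2 (Real.smoothTransition.le_one _)
  have hα1 : ∀ t, α t ≤ 1 := fun t => sub_le_self _ (Real.smoothTransition.nonneg _)
  have hαone : ∀ t, t ≤ σ ^ 2 / 2 → α t = 1 := fun t ht => by
    simp only [hα]
    rw [Real.smoothTransition.zero_of_nonpos, sub_zero]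
    rw [sub_nonpos, div_le_one hσ2]
    linarith
  have hαzero : ∀ t, σ ^ 2 ≤ t → α t = 0 := fun t ht => by
    simp only [hα]
    rw [Real.smoothTransition.one_of_one_le, sub_self]
    have : 2 ≤ 2 * t / σ ^ 2 := by rw [le_div_iff₀ hσ2]; linarith
    linarith
  have hαanti : Antitone α := fun s t hst => by
    simp only [hα]
    refine sub_le_sub_left (Real.smoothTransition.monotone ?_) _
    gcongr
  have hαs : ContDiff ℝ 1 α := by
    have h1 : ContDiff ℝ 1 Real.smoothTransition := Real.smoothTransition.contDiff (n := 1)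
    have h2 : ContDiff ℝ 1 fun t : ℝ => 2 * t / σ ^ 2 - 1 := by fun_prop
    exact contDiff_const.sub (h1.comp h2)
  set f : ℝ → ℝ := fun t => -(1 / 2) * (√(4 - t) / √t) * (1 - α t - α (4 - t)) with hf
  have hflow : ∀ t, t ≤ σ ^ 2 / 2 → f t = 0 := fun t ht => by
    simp only [hf]
    rw [hαone t ht, hαzero (4 - t) (by linarith)]
    ring
  have hfhigh : ∀ t, 4 - σ ^ 2 / 2 ≤ t → f t = 0 := fun t ht => by
    simp only [hf]
    rw [hαzero t (by linarith), hαone (4 - t) (by linarith)]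
    ring
  have hfc : ContDiff ℝ 1 f := by
    rw [contDiff_iff_contDiffAt]
    intro t
    by_cases h1 : t < σ ^ 2 / 2
    · refine (contDiffAt_const (c := (0 : ℝ))).congr_of_eventuallyEq ?_
      filter_upwards [Iio_mem_nhds h1] with s hs using hflow s (le_of_lt hs)
    by_cases h2 : 4 - σ ^ 2 / 2 < t
    · refine (contDiffAt_const (c := (0 : ℝ))).congr_of_eventuallyEq ?_
      filter_upwards [Ioi_mem_nhds h2] with s hs using hfhigh s (le_of_lt hs)
    rw [not_lt] at h1 h2
    have ht0 : 0 < t := by linarith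
    have ht4 : 0 < 4 - t := by linarith
    have h3 : ContDiffAt ℝ 1 (fun s : ℝ => √(4 - s)) t :=
      ContDiffAt.sqrt (by fun_prop) ht4.ne'
    have h4 : ContDiffAt ℝ 1 (fun s : ℝ => √s) t := Real.contDiffAt_sqrt ht0.ne'
    have h5 : ContDiff ℝ 1 fun s : ℝ => α (4 - s) :=
      hαs.comp (by fun_prop : ContDiff ℝ 1 fun s : ℝ => 4 - s)
    exact (contDiffAt_const.mul (h3.div h4 (Real.sqrt_pos.2 ht0).ne')).mul
      ((contDiffAt_const.sub hαs.contDiffAt).sub h5.contDiffAt)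
  obtain ⟨hfd, hfd'⟩ := contDiff_one_iff_deriv.1 hfc
  have hder0 : ∀ t, t < 0 ∨ 4 < t → deriv f t = 0 := by
    intro t ht
    have : f =ᶠ[𝓝 t] fun _ => (0 : ℝ) := by
      rcases ht with ht | ht
      · filter_upwards [Iio_mem_nhds ht] with s hs
        have hs' : s < 0 := hs
        exact hflow s (by linarith)
      · filter_upwards [Ioi_mem_nhds ht] with s hs
        have hs' : 4 < s := hs
        exact hfhigh s (by linarith)
    rw [this.deriv_eq]
    simp
  have hsupp : HasCompactSupport (deriv f) := by
    refine HasCompactSupport.of_support_subset_isCompact (isCompact_Icc (a := (0 : ℝ)) (b := 4))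
      fun t ht => ?_
    by_contra hn
    rw [Set.mem_Icc, not_and_or, not_le, not_le] at hn
    exact ht (hder0 t hn)
  obtain ⟨B, hB⟩ := hfd'.bounded_above_of_compact_support hsupp
  have hkanti : ∀ s t : ℝ, 0 ≤ s → s ≤ t → √(4 - t ^ 2) ≤ √(4 - s ^ 2) := fun s t hs hst =>
    Real.sqrt_le_sqrt (by gcongr)
  set c := √(4 - σ ^ 2) with hc
  have hc0 : 0 ≤ c := Real.sqrt_nonneg _
  have hcsq : c ^ 2 = 4 - σ ^ 2 := Real.sq_sqrt (by linarith)
  have hkc : √(4 - c ^ 2) = σ := by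
    rw [hcsq, sub_sub_cancel, Real.sqrt_sq hσ0.le]
  have hk2 : ∀ s : ℝ, √(4 - s ^ 2) ≤ 2 := fun s => by
    rw [Real.sqrt_le_left (by norm_num)]
    nlinarith [sq_nonneg s]
  set g₂ : ℝ → ℝ := fun s => √(4 - (max s c) ^ 2) with hg₂
  have hg₂a : Antitone g₂ := fun s t hst =>
    hkanti _ _ (hc0.trans (le_max_right _ _)) (max_le_max_right _ hst)
  have hg₂σ : ∀ s, g₂ s ≤ σ := fun s => by
    rw [← hkc]
    exact hkanti _ _ hc0 (le_max_right _ _)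
  have hpos : ∀ s t : ℝ, s ≤ t → (max s 0) ^ 2 ≤ (max t 0) ^ 2 := fun s t hst =>
    pow_le_pow_left₀ (le_max_right _ _) (max_le_max_right _ hst) 2
  have hF4 : ∀ t, 4 ≤ t → ∫ u in (4 : ℝ)..t, f u = 0 := fun t ht => by
    rw [intervalIntegral.integral_congr (g := fun _ => 0), intervalIntegral.integral_zero]
    intro u hu
    rw [Set.uIcc_of_le ht] at hu
    exact hfhigh u (by linarith [hu.1])
  exact ⟨{
    F := fun t => ∫ u in (4 : ℝ)..t, f u
    f := f
    f' := deriv f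
    g₁ := fun s => √(4 - (max s 0) ^ 2) * α ((max s 0) ^ 2)
    g₂ := g₂
    g₃ := fun s => g₂ s * (1 - α (4 - (max s 0) ^ 2))
    hasDerivAt_F := fun t => (hfd.continuous.integral_hasStrictDerivAt 4 t).hasDerivAt
    hasDerivAt_f := fun t => (hfd t).hasDerivAt
    F_eq_zero := hF4
    f_eq_zero := fun t ht => hfhigh t (by linarith)
    f'_eq_zero := fun t ht => hder0 t (Or.inr ht)
    continuous_f' := hfd'
    uniformContinuous_f' := hsupp.uniformContinuous_of_continuous hfd'
    bounded_f' := ⟨B, hB⟩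
    antitone₁ := fun s t hst => mul_le_mul (hkanti _ _ (le_max_right _ _) (max_le_max_right _ hst))
      (hαanti (hpos s t hst)) (hα0 _) (Real.sqrt_nonneg _)
    antitone₂ := hg₂a
    antitone₃ := fun s t hst => mul_le_mul (hg₂a hst)
      (sub_le_sub_left (hαanti (sub_le_sub_left (hpos s t hst) _)) _)
      (sub_nonneg.2 (hα1 _)) (Real.sqrt_nonneg _)
    nonneg₁ := fun s => mul_nonneg (Real.sqrt_nonneg _) (hα0 _)
    nonneg₂ := fun s => Real.sqrt_nonneg _
    nonneg₃ := fun s => mul_nonneg (Real.sqrt_nonneg _) (sub_nonneg.2 (hα1 _))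
    le₁ := fun s => (mul_le_of_le_one_right (Real.sqrt_nonneg _) (hα1 _)).trans (hk2 _)
    le₂ := hg₂σ
    le₃ := fun s => (mul_le_of_le_one_right (Real.sqrt_nonneg _)
      (sub_le_self _ (hα0 _))).trans (hg₂σ s)
    eq_zero₁ := fun s hs => by
      rw [hαzero, mul_zero]
      rw [max_eq_left (hσ0.le.trans hs)]
      gcongr
    eq_sub := fun s hs => by
      rw [max_eq_left hs]
      have h1 : 2 * s * f (s ^ 2) = -(√(4 - s ^ 2) * (1 - α (s ^ 2) - α (4 - s ^ 2))) := by
        simp only [hf]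
        rw [Real.sqrt_sq hs]
        rcases hs.eq_or_lt with h0 | h0
        · rw [← h0, hαone _ (by simpa using by positivity), hαzero _ (by linarith)]
          simp
        · field_simp
      have h2 : √(4 - s ^ 2) * α (4 - s ^ 2) = g₂ s * α (4 - s ^ 2) := by
        rcases le_total c s with h | h
        · rw [hg₂]
          simp only [max_eq_left h]
        · have : σ ^ 2 ≤ 4 - s ^ 2 := by
            have := pow_le_pow_left₀ hs h 2
            linarith
          rw [hαzero _ this, mul_zero, mul_zero]
      rw [h1]
      linear_combination h2 }⟩

/-! ### Centred perturbations of lattice sums: the smooth part -/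

section Cancellation

variable (b : Module.Basis (Fin 2) ℝ (E 2)) {Ω : Type u} [MeasurableSpace Ω] {P : Measure Ω}
  [IsProbabilityMeasure P]

lemma integrable_comp_of_norm_le {g : E 2 → ℝ} (hg : Continuous g) {q : Ω → E 2}
    (hq : Measurable q) {K : ℝ} (hK : ∀ ω, ‖q ω‖ ≤ K) : Integrable (fun ω => g (q ω)) P := by
  obtain ⟨B, hB⟩ := (isCompact_closedBall (0 : E 2) K).exists_bound_of_continuousOn hg.continuousOn
  exact Integrable.of_bound (hg.measurable.comp hq).aestronglyMeasurable B
    (Eventually.of_forall fun ω => hB _ (mem_closedBall_zero_iff.2 (hK ω)))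

lemma integral_inner_eq_zero {q : Ω → E 2} (hq : Measurable q) {K : ℝ} (hK : ∀ ω, ‖q ω‖ ≤ K)
    (h0 : ∀ i, ∫ ω, q ω i ∂P = 0) (x : E 2) : ∫ ω, inner ℝ x (q ω) ∂P = 0 := by
  have hi : ∀ i, Integrable (fun ω => q ω i) P := fun i =>
    integrable_comp_of_norm_le (g := fun x : E 2 => x i) (by fun_prop) hq hK
  simp only [PiLp.inner_apply, RCLike.inner_apply, conj_trivial]
  rw [integral_finsetSum _ fun i _ => (hi i).mul_const _]
  simp [integral_mul_const, h0]

/-- The quadratic form of the second derivatives of a radial function. -/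
lemma radialHessian_quadratic (f f' : ℝ → ℝ) (x y : E 2) :
    ∑ ij : Fin 2 × Fin 2, radialHessian f f' ij.1 ij.2 x * (y ij.1 * y ij.2) =
      f (‖x‖ ^ 2) * ‖y‖ ^ 2 + 2 * f' (‖x‖ ^ 2) * inner ℝ x y ^ 2 := by
  rw [Fintype.sum_prod_type, EuclideanSpace.norm_sq_eq y]
  simp only [PiLp.inner_apply, RCLike.inner_apply, conj_trivial, Fin.sum_univ_two, radialHessian,
    Real.norm_eq_abs, sq_abs, Fin.isValue, zero_ne_one, one_ne_zero, if_true, if_false]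
  ring

/-- The expectation of a second order expansion with centred increments. -/
lemma abs_integral_sub_quadratic_le {F : ℝ → ℝ} (hF : Continuous F) {y : Ω → E 2}
    (hy : Measurable y) {κ : ℝ} (hκ : ∀ ω, ‖y ω‖ ≤ κ) (h0 : ∀ i, ∫ ω, y ω i ∂P = 0)
    (f f' : ℝ → ℝ) {η : ℝ} (hη : 0 ≤ η) {x : E 2}
    (h : ∀ v : E 2, ‖v‖ ≤ κ → |F (‖x + v‖ ^ 2) - F (‖x‖ ^ 2) - 2 * f (‖x‖ ^ 2) * inner ℝ x v -
        (f (‖x‖ ^ 2) * ‖v‖ ^ 2 + 2 * f' (‖x‖ ^ 2) * inner ℝ x v ^ 2)| ≤ η * ‖v‖ ^ 2) :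
    |∫ ω, (F (‖x + y ω‖ ^ 2) - F (‖x‖ ^ 2)) ∂P - ∑ ij : Fin 2 × Fin 2,
      radialHessian f f' ij.1 ij.2 x * ∫ ω, y ω ij.1 * y ω ij.2 ∂P| ≤ η * κ ^ 2 := by
  have i1 : Integrable (fun ω => F (‖x + y ω‖ ^ 2) - F (‖x‖ ^ 2)) P :=
    integrable_comp_of_norm_le (g := fun y => F (‖x + y‖ ^ 2) - F (‖x‖ ^ 2))
      (by fun_prop) hy hκ
  have i2 : Integrable (fun ω => 2 * f (‖x‖ ^ 2) * inner ℝ x (y ω)) P :=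
    integrable_comp_of_norm_le (g := fun y => 2 * f (‖x‖ ^ 2) * inner ℝ x y)
      (by fun_prop) hy hκ
  have i3 : ∀ ij : Fin 2 × Fin 2, Integrable (fun ω => radialHessian f f' ij.1 ij.2 x *
      (y ω ij.1 * y ω ij.2)) P := fun ij =>
    integrable_comp_of_norm_le (g := fun y => radialHessian f f' ij.1 ij.2 x *
      (y ij.1 * y ij.2)) (by fun_prop) hy hκ
  have e2 : ∫ ω, 2 * f (‖x‖ ^ 2) * inner ℝ x (y ω) ∂P = 0 := by
    rw [integral_const_mul, integral_inner_eq_zero hy hκ h0, mul_zero]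
  have e3 : ∫ ω, ∑ ij : Fin 2 × Fin 2, radialHessian f f' ij.1 ij.2 x *
      (y ω ij.1 * y ω ij.2) ∂P = ∑ ij : Fin 2 × Fin 2,
      radialHessian f f' ij.1 ij.2 x * ∫ ω, y ω ij.1 * y ω ij.2 ∂P := by
    rw [integral_finsetSum _ fun ij _ => i3 ij]
    exact Finset.sum_congr rfl fun ij _ => integral_const_mul _ _
  have i4 : Integrable (fun ω => ∑ ij : Fin 2 × Fin 2, radialHessian f f' ij.1 ij.2 x *
      (y ω ij.1 * y ω ij.2)) P := integrable_finsetSum _ fun ij _ => i3 ij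
  have e5 := integral_sub (i1.sub i2) i4
  have e6 := integral_sub i1 i2
  simp only [Pi.sub_apply] at e5
  rw [e2, sub_zero] at e6
  rw [e6, e3] at e5
  rw [← e5, ← Real.norm_eq_abs]
  refine (norm_integral_le_of_norm_le_const (C := η * κ ^ 2)
    (Eventually.of_forall fun ω => ?_)).trans (by simp)
  rw [radialHessian_quadratic, Real.norm_eq_abs]
  exact (h _ (hκ ω)).trans (mul_le_mul_of_nonneg_left
    (pow_le_pow_left₀ (norm_nonneg _) (hκ ω) 2) hη)

variable {q : lattice b → Ω → E 2}

set_option maxHeartbeats 1000000 in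
/-- The lattice sums of a smooth radial function are not modified, asymptotically, by centred
bounded perturbations whose covariances have no macroscopic fluctuations. -/
lemma tendsto_smooth_sum (hq : ∀ z, Measurable (q z)) {K : ℝ} (hK : ∀ z ω, ‖q z ω‖ ≤ K)
    (h0 : ∀ z i, ∫ ω, q z ω i ∂P = 0)
    (hcov : ∀ φ : E 2 → ℝ, HasCompactSupport φ → Continuous φ → ∫ x, φ x = 0 → ∀ i j,
      Tendsto (fun r => latticeAvg b φ r fun z => ∫ ω, q z ω i * q z ω j ∂P) atTop (𝓝 0))
    {σ : ℝ} (S : SmoothApprox σ) :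
    Tendsto (fun r : ℝ => ∑' z : lattice b, ∫ ω, (S.F (‖r⁻¹ • ((z : E 2) + q z ω)‖ ^ 2) -
      S.F (‖r⁻¹ • (z : E 2)‖ ^ 2)) ∂P) atTop (𝓝 0) := by
  obtain ⟨C, hC0, hC⟩ := exists_abs_tsum_le b
  obtain ⟨B, hB⟩ := S.bounded_f'
  have hcF : Continuous S.F :=
    continuous_iff_continuousAt.2 fun t => (S.hasDerivAt_F t).continuousAt
  have hcf : Continuous S.f :=
    continuous_iff_continuousAt.2 fun t => (S.hasDerivAt_f t).continuousAt
  have hint := integral_radialHessian (d := 2) S.hasDerivAt_f S.continuous_f'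
    S.f_eq_zero S.f'_eq_zero
  have hcs := hasCompactSupport_radialHessian (d := 2) S.f_eq_zero S.f'_eq_zero
  have hcc := continuous_radialHessian (d := 2) hcf S.continuous_f'
  set A : ℝ → ℝ := fun r => ∑ ij : Fin 2 × Fin 2, latticeAvg b (radialHessian S.f S.f' ij.1 ij.2) r
    fun z => ∫ ω, q z ω ij.1 * q z ω ij.2 ∂P with hA
  have hA0 : Tendsto A atTop (𝓝 0) := by
    have := tendsto_finsetSum Finset.univ fun (ij : Fin 2 × Fin 2) _ =>
      hcov _ (hcs ij.1 ij.2) (hcc ij.1 ij.2) (hint ij.1 ij.2) ij.1 ij.2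
    simpa using this
  rw [Metric.tendsto_atTop]
  intro ε hε
  set η := ε / (2 * (C * 9 * (K ^ 2 + 1))) with hη
  have hη0 : 0 < η := by positivity
  obtain ⟨δ, hδ0, hδ⟩ := exists_taylor_normSq (V := E 2) S.hasDerivAt_F S.hasDerivAt_f
    S.uniformContinuous_f' hB hη0
  obtain ⟨R, hR⟩ := Metric.tendsto_atTop.1 hA0 (ε / 2) (by positivity)
  refine ⟨max (max R 1) (max K (K / δ)), fun r hr => ?_⟩
  have hrR : R ≤ r := ((le_max_left _ _).trans (le_max_left _ _)).trans hr
  have hr1 : 1 ≤ r := ((le_max_right _ _).trans (le_max_left _ _)).trans hr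
  have hrK : K ≤ r := ((le_max_left _ _).trans (le_max_right _ _)).trans hr
  have hrδ : K / δ ≤ r := ((le_max_right _ _).trans (le_max_right _ _)).trans hr
  have hr0 : 0 < r := by linarith
  have hyK : ∀ z ω, ‖r⁻¹ • q z ω‖ ≤ K / r := fun z ω => by
    rw [norm_smul, norm_inv, Real.norm_of_nonneg hr0.le, ← div_eq_inv_mul]
    exact div_le_div_of_nonneg_right (hK z ω) hr0.le
  have hyi : ∀ z, Measurable fun ω : Ω => r⁻¹ • q z ω := fun z => (hq z).const_smul r⁻¹
  have hKr1 : K / r ≤ 1 := (div_le_one hr0).2 hrK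
  have hKrδ : K / r ≤ δ := by
    rw [div_le_iff₀ hδ0] at hrδ
    rw [div_le_iff₀ hr0]
    linarith
  set u : lattice b → ℝ := fun z => ∫ ω, (S.F (‖r⁻¹ • ((z : E 2) + q z ω)‖ ^ 2) -
      S.F (‖r⁻¹ • (z : E 2)‖ ^ 2)) ∂P with hu
  set w : lattice b → ℝ := fun z => ∑ ij : Fin 2 × Fin 2, radialHessian S.f S.f' ij.1 ij.2
    (r⁻¹ • (z : E 2)) * ∫ ω, q z ω ij.1 * q z ω ij.2 ∂P with hw
  have hnorm : ∀ z : lattice b, 3 * r < ‖(z : E 2)‖ → 3 < ‖r⁻¹ • (z : E 2)‖ := fun z hz => by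
    rw [norm_smul, norm_inv, Real.norm_of_nonneg hr0.le, ← div_eq_inv_mul, lt_div_iff₀ hr0]
    exact hz
  have hu0 : ∀ z : lattice b, 3 * r < ‖(z : E 2)‖ → u z = 0 := by
    intro z hz
    have h1 := hnorm z hz
    simp only [hu]
    refine (integral_congr_ae (Eventually.of_forall fun ω => ?_)).trans (integral_zero _ _)
    have h2 : 2 ≤ ‖r⁻¹ • ((z : E 2) + q z ω)‖ := by
      rw [smul_add]
      have := norm_sub_le_norm_add (r⁻¹ • (z : E 2)) (r⁻¹ • q z ω)
      linarith [hyK z ω]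
    rw [S.F_eq_zero _ (by nlinarith), S.F_eq_zero _ (by nlinarith), sub_zero]
  have hw0 : ∀ z : lattice b, 3 * r < ‖(z : E 2)‖ → w z = 0 := by
    intro z hz
    have h1 := hnorm z hz
    refine Finset.sum_eq_zero fun ij _ => ?_
    simp [radialHessian, S.f_eq_zero (‖r⁻¹ • (z : E 2)‖ ^ 2) (by nlinarith),
      S.f'_eq_zero (‖r⁻¹ • (z : E 2)‖ ^ 2) (by nlinarith)]
  have hwA : (r ^ 2)⁻¹ * ∑' z, w z = A r := by
    simp only [hw, hA, latticeAvg]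
    rw [Summable.tsum_finsetSum fun ij _ => summable_latticeAvg b (hcs ij.1 ij.2) hr0 _,
      Finset.mul_sum]
  have herr : ∀ z, |u z - (r ^ 2)⁻¹ * w z| ≤ η * (K / r) ^ 2 := by
    intro z
    by_cases hz : 3 * r < ‖(z : E 2)‖
    · rw [hu0 z hz, hw0 z hz]
      simp
      positivity
    set x := r⁻¹ • (z : E 2) with hx
    have hx3 : ‖x‖ ≤ 3 := by
      rw [hx, norm_smul, norm_inv, Real.norm_of_nonneg hr0.le, ← div_eq_inv_mul, div_le_iff₀ hr0]
      exact not_lt.1 hz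
    have e1 : u z = ∫ ω, (S.F (‖x + r⁻¹ • q z ω‖ ^ 2) - S.F (‖x‖ ^ 2)) ∂P := by
      simp only [hu, smul_add, hx]
    have e3 : (r ^ 2)⁻¹ * w z = ∑ ij : Fin 2 × Fin 2, radialHessian S.f S.f' ij.1 ij.2 x *
        ∫ ω, (r⁻¹ • q z ω) ij.1 * (r⁻¹ • q z ω) ij.2 ∂P := by
      simp only [hw, Finset.mul_sum]
      refine Finset.sum_congr rfl fun ij _ => ?_
      have e4 : ∀ ω, (r⁻¹ • q z ω) ij.1 * (r⁻¹ • q z ω) ij.2 =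
          (r ^ 2)⁻¹ * (q z ω ij.1 * q z ω ij.2) := fun ω => by
        rw [PiLp.smul_apply, PiLp.smul_apply, smul_eq_mul, smul_eq_mul]
        ring
      simp_rw [e4]
      rw [integral_const_mul]
      ring
    rw [e1, e3]
    refine abs_integral_sub_quadratic_le hcF (hyi z) (hyK z) (fun i => ?_) S.f S.f' hη0.le
      fun y hy => hδ x y hx3 (hy.trans hKrδ)
    simp only [PiLp.smul_apply, smul_eq_mul]
    rw [integral_const_mul, h0, mul_zero]
  have hsplit : ∑' z, u z = A r + ∑' z, (u z - (r ^ 2)⁻¹ * w z) := by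
    rw [← hwA, ← tsum_mul_left, ← Summable.tsum_add]
    · simp
    · exact summable_of_radius b (R := 3 * r) fun z hz => by rw [hw0 z hz, mul_zero]
    · exact summable_of_radius b (R := 3 * r) fun z hz => by rw [hw0 z hz, hu0 z hz]; simp
  have h1 := hC (3 * r) (η * (K / r) ^ 2) (fun z => u z - (r ^ 2)⁻¹ * w z) (by linarith)
    (by positivity) (fun z hz => by rw [hw0 z hz, hu0 z hz]; simp) herr
  have h2 := hR r hrR
  rw [dist_zero_right, Real.norm_eq_abs] at h2 ⊢
  have h3 : C * (3 * r) ^ 2 * (η * (K / r) ^ 2) < ε / 2 := by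
    have e : C * (3 * r) ^ 2 * (η * (K / r) ^ 2) = (C * 9 * K ^ 2) * η := by
      field_simp
      ring
    rw [e]
    calc C * 9 * K ^ 2 * η < C * 9 * (K ^ 2 + 1) * η := by gcongr; linarith
      _ = ε / 2 := by rw [hη]; field_simp
  calc |∑' z, u z| = |A r + ∑' z, (u z - (r ^ 2)⁻¹ * w z)| := by rw [hsplit]
    _ ≤ _ := abs_add_le _ _
    _ < ε := by linarith

end Cancellation

/-! ### Centred perturbations of lattice sums: the non-smooth part -/

section Cancellation

variable (b : Module.Basis (Fin 2) ℝ (E 2)) {Ω : Type u} [MeasurableSpace Ω] {P : Measure Ω}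
  [IsProbabilityMeasure P]

namespace SmoothApprox

variable {σ : ℝ} (S : SmoothApprox σ)

/-- The difference between `lensProfile` and its smooth approximation. -/
noncomputable def diff (s : ℝ) : ℝ := lensProfile s - S.F (s ^ 2)

/-- The opposite of the derivative of `SmoothApprox.diff`. -/
noncomputable def slope (s : ℝ) : ℝ := √(4 - s ^ 2) + 2 * s * S.f (s ^ 2)

lemma hasDerivAt_diff (s : ℝ) : HasDerivAt S.diff (-S.slope s) s := by
  have h1 := (S.hasDerivAt_F (s ^ 2)).comp s (hasDerivAt_pow 2 s)
  refine ((hasDerivAt_lensProfile s).sub h1).congr_deriv ?_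
  rw [slope]
  norm_num
  ring

lemma continuous_diff : Continuous S.diff :=
  continuous_iff_continuousAt.2 fun s => (S.hasDerivAt_diff s).continuousAt

lemma diff_eq_zero {s : ℝ} (hs : 2 ≤ s) : S.diff s = 0 := by
  rw [diff, lensProfile_of_two_le hs, S.F_eq_zero _ (by nlinarith), sub_zero]

/-- The total oscillation, on an interval of centre `s` and half-length `δ`, of the three monotone
functions of which the slope is made. -/
noncomputable def osc (s δ : ℝ) : ℝ :=
  (S.g₁ (s - δ) - S.g₁ (s + δ)) + (S.g₂ (s - δ) - S.g₂ (s + δ)) + (S.g₃ (s - δ) - S.g₃ (s + δ))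

lemma abs_slope_sub_le {s t δ : ℝ} (hs : 0 ≤ s) (ht : 0 ≤ t) (h : |t - s| ≤ δ) :
    |S.slope t - S.slope s| ≤ S.osc s δ := by
  have h1 := abs_le.1 h
  have key : ∀ g : ℝ → ℝ, Antitone g → |g t - g s| ≤ g (s - δ) - g (s + δ) := fun g hg => by
    have a1 := hg (show s - δ ≤ t by linarith [h1.1])
    have a2 := hg (show t ≤ s + δ by linarith [h1.2])
    have a3 := hg (show s - δ ≤ s by linarith [h1.1, h1.2])
    have a4 := hg (show s ≤ s + δ by linarith [h1.1, h1.2])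
    exact abs_le.2 ⟨by linarith, by linarith⟩
  have k1 := abs_le.1 (key _ S.antitone₁)
  have k2 := abs_le.1 (key _ S.antitone₂)
  have k3 := abs_le.1 (key _ S.antitone₃)
  rw [slope, slope, S.eq_sub t ht, S.eq_sub s hs, osc]
  exact abs_le.2 ⟨by linarith [k1.1, k2.1, k3.2], by linarith [k1.2, k2.2, k3.1]⟩

lemma abs_slope_le {s : ℝ} (hs : 0 ≤ s) : |S.slope s| ≤ S.g₁ s + 2 * σ := by
  rw [slope, S.eq_sub s hs]
  have a1 := S.nonneg₁ s
  have a2 := S.nonneg₂ s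
  have a3 := S.nonneg₃ s
  have b2 := S.le₂ s
  have b3 := S.le₃ s
  exact abs_le.2 ⟨by linarith, by linarith⟩

end SmoothApprox

/-- The error made in replacing the increment of the norm by its linear part, at scale `r`. The
maximum with `1` accounts for the lattice points near the origin. -/
lemma abs_curvature_le {z q : E 2} {r K : ℝ} (hr : 0 < r) (hK : 1 ≤ K) (hq : ‖q‖ ≤ K) :
    |‖r⁻¹ • z + r⁻¹ • q‖ - ‖r⁻¹ • z‖ - inner ℝ (r⁻¹ • z) (r⁻¹ • q) / ‖r⁻¹ • z‖| ≤
      2 * K ^ 2 / r * (max ‖z‖ 1)⁻¹ := by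
  have hn : ∀ v : E 2, ‖r⁻¹ • v‖ = ‖v‖ / r := fun v => by
    rw [norm_smul, norm_inv, Real.norm_of_nonneg hr.le, ← div_eq_inv_mul]
  rcases le_or_gt 1 ‖z‖ with hz | hz
  · have hz0 : 0 < ‖z‖ := by linarith
    have hx : r⁻¹ • z ≠ 0 := smul_ne_zero (inv_ne_zero hr.ne') (norm_pos_iff.1 hz0)
    refine (abs_norm_add_sub_le_sq hx _).trans ?_
    rw [hn, hn, max_eq_left hz]
    have e : (‖q‖ / r) ^ 2 / (2 * (‖z‖ / r)) = ‖q‖ ^ 2 / 2 * (r⁻¹ * ‖z‖⁻¹) := by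
      field_simp
    have e' : 2 * K ^ 2 / r * ‖z‖⁻¹ = 2 * K ^ 2 * (r⁻¹ * ‖z‖⁻¹) := by
      field_simp
    rw [e, e']
    have := pow_le_pow_left₀ (norm_nonneg _) hq 2
    refine mul_le_mul_of_nonneg_right ?_ (by positivity)
    nlinarith
  · refine (abs_norm_add_sub_le _ _).trans ?_
    rw [hn, max_eq_right hz.le, inv_one, mul_one, ← mul_div_assoc]
    refine div_le_div_of_nonneg_right ?_ hr.le
    nlinarith

/-- The expectation of the increment of the non-smooth part at a single lattice point. -/
lemma abs_integral_diff_le {σ : ℝ} (S : SmoothApprox σ) {q : Ω → E 2} (hq : Measurable q) {K : ℝ}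
    (hK1 : 1 ≤ K) (hK : ∀ ω, ‖q ω‖ ≤ K) (h0 : ∀ i, ∫ ω, q ω i ∂P = 0) {r : ℝ} (hr : 0 < r)
    (z : E 2) :
    |∫ ω, (S.diff ‖r⁻¹ • (z + q ω)‖ - S.diff ‖r⁻¹ • z‖) ∂P| ≤
      S.osc (‖z‖ / r) (K / r) * (K / r) +
        (S.g₁ (‖z‖ / r) + 2 * σ) * (2 * K ^ 2 / r * (max ‖z‖ 1)⁻¹) := by
  have hn : ∀ v : E 2, ‖r⁻¹ • v‖ = ‖v‖ / r := fun v => by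
    rw [norm_smul, norm_inv, Real.norm_of_nonneg hr.le, ← div_eq_inv_mul]
  have hy : Measurable fun ω => r⁻¹ • q ω := hq.const_smul r⁻¹
  have hyK : ∀ ω, ‖r⁻¹ • q ω‖ ≤ K / r := fun ω => by
    rw [hn]; exact div_le_div_of_nonneg_right (hK ω) hr.le
  have hxn := hn z
  set x := r⁻¹ • z with hx
  have hc := S.continuous_diff
  have i1 : Integrable (fun ω => S.diff ‖x + r⁻¹ • q ω‖ - S.diff ‖x‖) P :=
    integrable_comp_of_norm_le (g := fun y => S.diff ‖x + y‖ - S.diff ‖x‖) (by fun_prop) hy hyK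
  have i2 : Integrable (fun ω => S.slope ‖x‖ * (inner ℝ x (r⁻¹ • q ω) / ‖x‖)) P :=
    integrable_comp_of_norm_le (g := fun y => S.slope ‖x‖ * (inner ℝ x y / ‖x‖)) (by fun_prop)
      hy hyK
  have e2 : ∫ ω, S.slope ‖x‖ * (inner ℝ x (r⁻¹ • q ω) / ‖x‖) ∂P = 0 := by
    rw [integral_const_mul, integral_div, integral_inner_eq_zero hy hyK, zero_div, mul_zero]
    intro i
    simp only [PiLp.smul_apply, smul_eq_mul]
    rw [integral_const_mul, h0, mul_zero]
  have e1 : ∫ ω, (S.diff ‖r⁻¹ • (z + q ω)‖ - S.diff ‖x‖) ∂P =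
      ∫ ω, (S.diff ‖x + r⁻¹ • q ω‖ - S.diff ‖x‖ +
        S.slope ‖x‖ * (inner ℝ x (r⁻¹ • q ω) / ‖x‖)) ∂P := by
    rw [integral_add i1 i2, e2, add_zero]
    simp only [smul_add, hx]
  rw [e1, ← Real.norm_eq_abs]
  refine (norm_integral_le_of_norm_le_const (C := S.osc (‖z‖ / r) (K / r) * (K / r) +
        (S.g₁ (‖z‖ / r) + 2 * σ) * (2 * K ^ 2 / r * (max ‖z‖ 1)⁻¹))
    (Eventually.of_forall fun ω => ?_)).trans (by simp)
  rw [Real.norm_eq_abs]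
  refine (abs_radial_remainder_le S.hasDerivAt_diff (hyK ω)
    (fun t ht h => S.abs_slope_sub_le (norm_nonneg x) ht h)).trans ?_
  have h1 := S.abs_slope_le (norm_nonneg x)
  have h2 := abs_curvature_le (z := z) hr hK1 (hK ω)
  rw [← hx] at h2
  rw [hxn] at h1 ⊢
  rw [hxn] at h2
  exact add_le_add le_rfl (mul_le_mul h1 h2 (abs_nonneg _) ((abs_nonneg _).trans h1))

variable {q : lattice b → Ω → E 2}

/-- The non-smooth part contributes little: near the two singularities, the oscillations of the
derivative of the profile telescope and are small, or concern few points. -/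
lemma exists_eventually_diff_sum_le (hq : ∀ z, Measurable (q z)) {K : ℕ} (hK1 : 1 ≤ K)
    (hK : ∀ z ω, ‖q z ω‖ ≤ K) (h0 : ∀ z i, ∫ ω, q z ω i ∂P = 0) :
    ∃ C : ℝ, ∀ σ : ℝ, 0 < σ → σ ≤ 1 → ∀ S : SmoothApprox σ, ∀ᶠ r : ℝ in atTop,
      |∑' z : lattice b, ∫ ω, (S.diff ‖r⁻¹ • ((z : E 2) + q z ω)‖ -
        S.diff ‖r⁻¹ • (z : E 2)‖) ∂P| ≤ C * σ := by
  obtain ⟨C, hC0, hosc, hinv⟩ := exists_sum_osc_le b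
  have hK1' : (1 : ℝ) ≤ K := by exact_mod_cast hK1
  refine ⟨C * (14 * (2 * K + 1) * K + 56 * K ^ 2), fun σ hσ0 hσ1 S => ?_⟩
  filter_upwards [eventually_ge_atTop (1 : ℝ), eventually_ge_atTop (K : ℝ),
    eventually_ge_atTop ((K + 1) / σ)] with r hr1 hrK hrσ
  have hr0 : 0 < r := by linarith
  rw [div_le_iff₀ hσ0] at hrσ
  have hKr1 : (K : ℝ) / r ≤ 1 := (div_le_one hr0).2 hrK
  have hn : ∀ v : E 2, ‖r⁻¹ • v‖ = ‖v‖ / r := fun v => by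
    rw [norm_smul, norm_inv, Real.norm_of_nonneg hr0.le, ← div_eq_inv_mul]
  have hz0 : ∀ z : lattice b, 3 * r < ‖(z : E 2)‖ →
      ∫ ω, (S.diff ‖r⁻¹ • ((z : E 2) + q z ω)‖ - S.diff ‖r⁻¹ • (z : E 2)‖) ∂P = 0 := by
    intro z hz
    have h1 : 3 < ‖r⁻¹ • (z : E 2)‖ := by
      rw [hn, lt_div_iff₀ hr0]
      exact hz
    refine (integral_congr_ae (Eventually.of_forall fun ω => ?_)).trans (integral_zero _ _)
    have h2 : 2 ≤ ‖r⁻¹ • ((z : E 2) + q z ω)‖ := by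
      have h3 : ‖r⁻¹ • q z ω‖ ≤ 1 := by
        rw [hn]
        exact (div_le_div_of_nonneg_right (hK z ω) hr0.le).trans hKr1
      rw [smul_add]
      have := norm_sub_le_norm_add (r⁻¹ • (z : E 2)) (r⁻¹ • q z ω)
      linarith
    rw [S.diff_eq_zero h2, S.diff_eq_zero (by linarith), sub_zero]
  rw [tsum_eq_sum_latticeBall b hz0]
  set F := latticeBall b (3 * r) with hF
  set N := ⌈4 * r⌉₊ with hN
  have hN5 : (N : ℝ) ≤ 5 * r := by
    have := Nat.ceil_lt_add_one (show 0 ≤ 4 * r by positivity)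
    linarith
  have hFN : ∀ z ∈ F, ‖(z : E 2)‖ < N := fun z hz => by
    have h1 := (mem_latticeBall b).1 hz
    have h2 := Nat.le_ceil (4 * r)
    have : (3 : ℝ) * r < 4 * r := by linarith
    exact (h1.trans_lt this).trans_le h2
  set F' := F.filter fun z : lattice b => ‖(z : E 2)‖ < σ * r + K with hF'
  set N' := ⌈σ * r + K⌉₊ with hN'
  have hN2 : (N' : ℝ) ≤ 2 * (σ * r) := by
    have := Nat.ceil_lt_add_one (show 0 ≤ σ * r + K by positivity)
    linarith
  have hFN' : ∀ z ∈ F', ‖(z : E 2)‖ < N' := fun z hz =>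
    (Finset.mem_filter.1 hz).2.trans_le (Nat.le_ceil _)
  have hscale : ∀ g : ℝ → ℝ, Antitone g → Antitone fun t => g (t / r) := fun g hg s t hst =>
    hg (div_le_div_of_nonneg_right hst hr0.le)
  have ho : ∀ g : ℝ → ℝ, ∀ z : lattice b,
      g (‖(z : E 2)‖ / r - K / r) - g (‖(z : E 2)‖ / r + K / r) =
      (fun t => g (t / r)) (‖(z : E 2)‖ - K) - (fun t => g (t / r)) (‖(z : E 2)‖ + K) := by
    intro g z
    simp only [sub_div, add_div]
  -- outside `F'` the function `g₁` vanishes on the whole range of the perturbed norm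
  have hout : ∀ z ∈ F, z ∉ F' → ∀ t, ‖(z : E 2)‖ - K ≤ t → S.g₁ (t / r) = 0 := by
    intro z hz hz' t ht
    refine S.eq_zero₁ _ ?_
    rw [le_div_iff₀ hr0]
    have : ¬ ‖(z : E 2)‖ < σ * r + K := fun h => hz' (Finset.mem_filter.2 ⟨hz, h⟩)
    linarith
  have o1 : ∑ z ∈ F, (S.g₁ (‖(z : E 2)‖ / r - K / r) - S.g₁ (‖(z : E 2)‖ / r + K / r)) ≤
      C * N' * ((2 * K + 1) * 2) := by
    rw [← Finset.sum_subset (Finset.filter_subset _ F : F' ⊆ F) fun z hz hz' => ?_]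
    · rw [Finset.sum_congr rfl fun z _ => ho S.g₁ z]
      exact hosc N' K F' _ 2 hFN' (hscale _ S.antitone₁) (fun _ => S.nonneg₁ _) fun _ => S.le₁ _
    · rw [ho]
      simp only
      rw [hout z hz hz' _ le_rfl, hout z hz hz' _ (by linarith), sub_zero]
  have o2 : ∑ z ∈ F, (S.g₂ (‖(z : E 2)‖ / r - K / r) - S.g₂ (‖(z : E 2)‖ / r + K / r)) ≤
      C * N * ((2 * K + 1) * σ) := by
    rw [Finset.sum_congr rfl fun z _ => ho S.g₂ z]
    exact hosc N K F _ σ hFN (hscale _ S.antitone₂) (fun _ => S.nonneg₂ _) fun _ => S.le₂ _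
  have o3 : ∑ z ∈ F, (S.g₃ (‖(z : E 2)‖ / r - K / r) - S.g₃ (‖(z : E 2)‖ / r + K / r)) ≤
      C * N * ((2 * K + 1) * σ) := by
    rw [Finset.sum_congr rfl fun z _ => ho S.g₃ z]
    exact hosc N K F _ σ hFN (hscale _ S.antitone₃) (fun _ => S.nonneg₃ _) fun _ => S.le₃ _
  have c1 : ∑ z ∈ F, S.g₁ (‖(z : E 2)‖ / r) * (max ‖(z : E 2)‖ 1)⁻¹ ≤ 2 * (2 * C * N') := by
    rw [← Finset.sum_subset (Finset.filter_subset _ F : F' ⊆ F) fun z hz hz' => ?_]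
    · calc ∑ z ∈ F', S.g₁ (‖(z : E 2)‖ / r) * (max ‖(z : E 2)‖ 1)⁻¹
          ≤ ∑ z ∈ F', 2 * (max ‖(z : E 2)‖ 1)⁻¹ := Finset.sum_le_sum fun z _ =>
            mul_le_mul_of_nonneg_right (S.le₁ _) (by positivity)
        _ = 2 * ∑ z ∈ F', (max ‖(z : E 2)‖ 1)⁻¹ := by rw [Finset.mul_sum]
        _ ≤ _ := by
          have := hinv N' F' hFN'
          linarith
    · rw [hout z hz hz' _ (by linarith), zero_mul]
  have c2 := hinv N F hFN
  have hKr : 0 ≤ (K : ℝ) / r := by positivity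
  have hCN' : C * N' ≤ C * (2 * (σ * r)) := mul_le_mul_of_nonneg_left hN2 hC0.le
  have hCN : C * N ≤ C * (5 * r) := mul_le_mul_of_nonneg_left hN5 hC0.le
  calc |∑ z ∈ F, ∫ ω, (S.diff ‖r⁻¹ • ((z : E 2) + q z ω)‖ - S.diff ‖r⁻¹ • (z : E 2)‖) ∂P|
      ≤ ∑ z ∈ F, |∫ ω, (S.diff ‖r⁻¹ • ((z : E 2) + q z ω)‖ - S.diff ‖r⁻¹ • (z : E 2)‖) ∂P| :=
        Finset.abs_sum_le_sum_abs _ _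
    _ ≤ ∑ z ∈ F, (S.osc (‖(z : E 2)‖ / r) (K / r) * (K / r) +
        (S.g₁ (‖(z : E 2)‖ / r) + 2 * σ) * (2 * K ^ 2 / r * (max ‖(z : E 2)‖ 1)⁻¹)) :=
        Finset.sum_le_sum fun z _ => abs_integral_diff_le S (hq z) hK1' (hK z) (h0 z) hr0 z
    _ = (∑ z ∈ F, (S.g₁ (‖(z : E 2)‖ / r - K / r) - S.g₁ (‖(z : E 2)‖ / r + K / r)) +
          ∑ z ∈ F, (S.g₂ (‖(z : E 2)‖ / r - K / r) - S.g₂ (‖(z : E 2)‖ / r + K / r)) +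
          ∑ z ∈ F, (S.g₃ (‖(z : E 2)‖ / r - K / r) - S.g₃ (‖(z : E 2)‖ / r + K / r))) * (K / r) +
        2 * K ^ 2 / r * (∑ z ∈ F, S.g₁ (‖(z : E 2)‖ / r) * (max ‖(z : E 2)‖ 1)⁻¹ +
          2 * σ * ∑ z ∈ F, (max ‖(z : E 2)‖ 1)⁻¹) := by
        simp only [SmoothApprox.osc, Finset.sum_add_distrib, Finset.mul_sum, Finset.sum_mul,
          add_mul, mul_add]
        congr 2
        · refine Finset.sum_congr rfl fun z _ => by ring
        · refine Finset.sum_congr rfl fun z _ => by ring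
    _ ≤ (C * (2 * (σ * r)) * ((2 * K + 1) * 2) + C * (5 * r) * ((2 * K + 1) * σ) +
          C * (5 * r) * ((2 * K + 1) * σ)) * (K / r) +
        2 * K ^ 2 / r * (4 * (C * (2 * (σ * r))) + 2 * σ * (2 * (C * (5 * r)))) := by
        refine add_le_add (mul_le_mul_of_nonneg_right (add_le_add (add_le_add ?_ ?_) ?_) hKr)
          (mul_le_mul_of_nonneg_left (add_le_add ?_ ?_) (by positivity))
        · exact o1.trans (mul_le_mul_of_nonneg_right hCN' (by positivity))
        · exact o2.trans (mul_le_mul_of_nonneg_right hCN (by positivity))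
        · exact o3.trans (mul_le_mul_of_nonneg_right hCN (by positivity))
        · linarith
        · exact mul_le_mul_of_nonneg_left (by linarith) (by positivity)
    _ = _ := by
        field_simp
        ring

/-- The lattice sums of the lens area are not modified, asymptotically, by centred bounded
perturbations whose covariances have no macroscopic fluctuations. -/
theorem tendsto_lens_sum (hq : ∀ z, Measurable (q z)) {K : ℕ} (hK1 : 1 ≤ K)
    (hK : ∀ z ω, ‖q z ω‖ ≤ K) (h0 : ∀ z i, ∫ ω, q z ω i ∂P = 0)
    (hcov : ∀ φ : E 2 → ℝ, HasCompactSupport φ → Continuous φ → ∫ x, φ x = 0 → ∀ i j,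
      Tendsto (fun r => latticeAvg b φ r fun z => ∫ ω, q z ω i * q z ω j ∂P) atTop (𝓝 0)) :
    Tendsto (fun r : ℝ => ∑' z : lattice b, ∫ ω, (lensProfile ‖r⁻¹ • ((z : E 2) + q z ω)‖ -
      lensProfile ‖r⁻¹ • (z : E 2)‖) ∂P) atTop (𝓝 0) := by
  obtain ⟨C, hC⟩ := exists_eventually_diff_sum_le b hq hK1 hK h0
  rw [Metric.tendsto_nhds]
  intro ε hε
  set σ := min 1 (ε / (2 * (|C| + 1))) with hσ
  have hσ0 : 0 < σ := lt_min one_pos (by positivity)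
  obtain ⟨S⟩ := nonempty_smoothApprox hσ0 (min_le_left _ _)
  have hCσ : C * σ < ε / 2 := by
    have h1 : σ * (2 * (|C| + 1)) ≤ ε := by
      rw [← le_div_iff₀ (by positivity)]
      exact min_le_right _ _
    nlinarith [le_abs_self C, abs_nonneg C]
  filter_upwards [hC σ hσ0 (min_le_left _ _) S,
    Metric.tendsto_nhds.1 (tendsto_smooth_sum b hq hK h0 hcov S) (ε / 2) (by positivity),
    eventually_ge_atTop (K : ℝ), eventually_ge_atTop (1 : ℝ)] with r h1 h2 hrK hr1
  have hr0 : 0 < r := by linarith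
  rw [dist_zero_right, Real.norm_eq_abs] at h2 ⊢
  have hcF : Continuous S.F :=
    continuous_iff_continuousAt.2 fun t => (S.hasDerivAt_F t).continuousAt
  have hcd := S.continuous_diff
  have hfar : ∀ z : lattice b, 3 * r < ‖(z : E 2)‖ →
      (2 ≤ ‖r⁻¹ • (z : E 2)‖ ∧ ∀ ω, 2 ≤ ‖r⁻¹ • ((z : E 2) + q z ω)‖) := by
    have hn : ∀ v : E 2, ‖r⁻¹ • v‖ = ‖v‖ / r := fun v => by
      rw [norm_smul, norm_inv, Real.norm_of_nonneg hr0.le, ← div_eq_inv_mul]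
    intro z hz
    refine ⟨?_, fun ω => ?_⟩
    · rw [hn, le_div_iff₀ hr0]; linarith
    · rw [hn, le_div_iff₀ hr0]
      have := norm_sub_le_norm_add (z : E 2) (q z ω)
      linarith [hK z ω]
  have e : ∀ z : lattice b, ∫ ω, (lensProfile ‖r⁻¹ • ((z : E 2) + q z ω)‖ -
      lensProfile ‖r⁻¹ • (z : E 2)‖) ∂P =
      ∫ ω, (S.diff ‖r⁻¹ • ((z : E 2) + q z ω)‖ - S.diff ‖r⁻¹ • (z : E 2)‖) ∂P +
      ∫ ω, (S.F (‖r⁻¹ • ((z : E 2) + q z ω)‖ ^ 2) - S.F (‖r⁻¹ • (z : E 2)‖ ^ 2)) ∂P := by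
    intro z
    have i1 : Integrable (fun ω => S.diff ‖r⁻¹ • ((z : E 2) + q z ω)‖ -
        S.diff ‖r⁻¹ • (z : E 2)‖) P :=
      integrable_comp_of_norm_le (g := fun y => S.diff ‖r⁻¹ • ((z : E 2) + y)‖ -
        S.diff ‖r⁻¹ • (z : E 2)‖) (by fun_prop) (hq z) (hK z)
    have i2 : Integrable (fun ω => S.F (‖r⁻¹ • ((z : E 2) + q z ω)‖ ^ 2) -
        S.F (‖r⁻¹ • (z : E 2)‖ ^ 2)) P :=
      integrable_comp_of_norm_le (g := fun y => S.F (‖r⁻¹ • ((z : E 2) + y)‖ ^ 2) -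
        S.F (‖r⁻¹ • (z : E 2)‖ ^ 2)) (by fun_prop) (hq z) (hK z)
    rw [← integral_add i1 i2]
    refine integral_congr_ae (Eventually.of_forall fun ω => ?_)
    simp only [SmoothApprox.diff]
    ring
  rw [tsum_congr e, Summable.tsum_add]
  · exact (abs_add_le _ _).trans_lt (by linarith)
  · refine summable_of_radius b (R := 3 * r) fun z hz => ?_
    refine (integral_congr_ae (Eventually.of_forall fun ω => ?_)).trans (integral_zero _ _)
    rw [S.diff_eq_zero (hfar z hz).1, S.diff_eq_zero ((hfar z hz).2 ω), sub_zero]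
  · refine summable_of_radius b (R := 3 * r) fun z hz => ?_
    refine (integral_congr_ae (Eventually.of_forall fun ω => ?_)).trans (integral_zero _ _)
    have a1 := (hfar z hz).1
    have a2 := (hfar z hz).2 ω
    rw [S.F_eq_zero _ (by nlinarith), S.F_eq_zero _ (by nlinarith), sub_zero]

end Cancellation

/-! ### The intersection of two discs -/

section Lens

lemma lensProfile_nonneg (s : ℝ) : 0 ≤ lensProfile s := by
  rcases le_total s 2 with h | h
  · exact intervalIntegral.integral_nonneg h fun t _ => Real.sqrt_nonneg _
  · rw [lensProfile_of_two_le h]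

lemma volume_sq_le (c : ℝ) : volume {y : ℝ | y ^ 2 ≤ c} = ENNReal.ofReal (2 * √c) := by
  rcases le_or_gt 0 c with h | h
  · have : {y : ℝ | y ^ 2 ≤ c} = Set.Icc (-√c) (√c) := by
      ext y
      exact Real.sq_le h
    rw [this, Real.volume_Icc]
    congr 1
    ring
  · have : {y : ℝ | y ^ 2 ≤ c} = ∅ := by
      ext y
      simp only [Set.mem_ofPred_eq, Set.mem_empty_iff_false, iff_false, not_le]
      exact h.trans_le (sq_nonneg y)
    rw [this, Real.sqrt_eq_zero_of_nonpos h.le]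
    simp

/-- The area of a circular segment of a disc of radius `r`. Beyond the radius, `Real.sqrt` is zero
on negative numbers, which is what the formula requires. -/
lemma lintegral_Ioi_sqrt {r u : ℝ} (hr : 0 < r) :
    ∫⁻ a in Set.Ioi u, ENNReal.ofReal (2 * √(r ^ 2 - a ^ 2)) =
      ENNReal.ofReal (r ^ 2 / 2 * lensProfile (2 * u / r)) := by
  have hz : ∀ a, r ≤ a → √(r ^ 2 - a ^ 2) = 0 := fun a ha =>
    Real.sqrt_eq_zero_of_nonpos (by nlinarith)
  rcases le_or_gt u r with h | h
  · have e1 : ∫⁻ a in Set.Ioi u, ENNReal.ofReal (2 * √(r ^ 2 - a ^ 2)) =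
        ∫⁻ a in Set.Ioc u r, ENNReal.ofReal (2 * √(r ^ 2 - a ^ 2)) := by
      rw [← lintegral_indicator measurableSet_Ioi, ← lintegral_indicator measurableSet_Ioc]
      congr 1
      funext a
      by_cases h1 : a ≤ r
      · simp [Set.indicator, h1]
      · simp [Set.indicator, h1, hz a (not_le.1 h1).le]
    have hc : Continuous fun a : ℝ => 2 * √(r ^ 2 - a ^ 2) := by fun_prop
    rw [e1, ← ofReal_integral_eq_lintegral_ofReal
      ((hc.integrableOn_Icc (a := u) (b := r)).mono_set Set.Ioc_subset_Icc_self)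
      (Eventually.of_forall fun a => by positivity), ← intervalIntegral.integral_of_le h]
    congr 1
    have h2 := intervalIntegral.integral_comp_mul_left (a := 2 * u / r) (b := 2) (c := r / 2)
      (fun a => √(r ^ 2 - a ^ 2)) (by positivity)
    have h3 : ∀ t : ℝ, √(r ^ 2 - (r / 2 * t) ^ 2) = r / 2 * √(4 - t ^ 2) := fun t => by
      rw [show r ^ 2 - (r / 2 * t) ^ 2 = (r / 2) ^ 2 * (4 - t ^ 2) by ring,
        Real.sqrt_mul (by positivity), Real.sqrt_sq (by positivity)]
    simp only [h3] at h2
    rw [intervalIntegral.integral_const_mul, smul_eq_mul,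
      show r / 2 * (2 * u / r) = u by field_simp, show r / 2 * 2 = r by ring] at h2
    rw [intervalIntegral.integral_const_mul, lensProfile]
    have h4 : ∫ a in u..r, √(r ^ 2 - a ^ 2) =
        r / 2 * (r / 2 * ∫ t in 2 * u / r..2, √(4 - t ^ 2)) := by
      rw [h2]
      field_simp
    rw [h4]
    ring
  · rw [lensProfile_of_two_le (by rw [le_div_iff₀ hr]; linarith), mul_zero, ENNReal.ofReal_zero]
    refine setLIntegral_eq_zero measurableSet_Ioi fun a ha => ?_
    have ha' : u < a := ha
    simp [hz a (by linarith)]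

lemma measurableSet_lens (r s : ℝ) : MeasurableSet
    {q : ℝ × ℝ | q.1 ^ 2 + q.2 ^ 2 ≤ r ^ 2 ∧ (q.1 - s) ^ 2 + q.2 ^ 2 ≤ r ^ 2} := by
  have h1 : Measurable fun q : ℝ × ℝ => q.1 ^ 2 + q.2 ^ 2 := by fun_prop
  have h2 : Measurable fun q : ℝ × ℝ => (q.1 - s) ^ 2 + q.2 ^ 2 := by fun_prop
  exact (measurableSet_le h1 measurable_const).inter (measurableSet_le h2 measurable_const)

/-- The area of the intersection of two discs of radius `r`, in coordinates, by integration over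
the lines orthogonal to the axis of the centres. -/
lemma volume_lens_prod {r s : ℝ} (hr : 0 < r) (hs : 0 ≤ s) :
    volume {q : ℝ × ℝ | q.1 ^ 2 + q.2 ^ 2 ≤ r ^ 2 ∧ (q.1 - s) ^ 2 + q.2 ^ 2 ≤ r ^ 2} =
      ENNReal.ofReal (r ^ 2 * lensProfile (s / r)) := by
  set A := {q : ℝ × ℝ | q.1 ^ 2 + q.2 ^ 2 ≤ r ^ 2 ∧ (q.1 - s) ^ 2 + q.2 ^ 2 ≤ r ^ 2} with hA
  have hAm : MeasurableSet A := measurableSet_lens r s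
  rw [Measure.volume_eq_prod, Measure.prod_apply hAm]
  set k : ℝ → ℝ≥0∞ := fun a => ENNReal.ofReal (2 * √(r ^ 2 - max (a ^ 2) ((a - s) ^ 2))) with hk
  have hfib : ∀ a, volume (Prod.mk a ⁻¹' A) = k a := by
    intro a
    simp only [hk]
    rw [← volume_sq_le]
    congr 1
    ext y
    simp only [hA, Set.mem_preimage, Set.mem_ofPred_eq, le_sub_iff_add_le', ← max_add_add_right,
      max_le_iff]
  have hIoi : ∫⁻ a in Set.Ioi (s / 2), k a = ENNReal.ofReal (r ^ 2 / 2 * lensProfile (s / r)) := by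
    have h1 := lintegral_Ioi_sqrt (u := s / 2) hr
    rw [show 2 * (s / 2) = s by ring] at h1
    rw [← h1]
    refine setLIntegral_congr_fun measurableSet_Ioi fun a ha => ?_
    have ha' : s / 2 < a := ha
    simp only [hk]
    rw [max_eq_left]
    nlinarith
  have hsymm : ∀ a, k (s - a) = k a := fun a => by
    simp only [hk]
    rw [max_comm]
    congr 5 <;> ring
  have hIic : ∫⁻ a in (Set.Ioi (s / 2))ᶜ, k a = ∫⁻ a in Set.Ioi (s / 2), k a := by
    rw [Set.compl_Ioi, setLIntegral_congr (Ioi_ae_eq_Ici (a := s / 2) (μ := volume)),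
      ← lintegral_indicator measurableSet_Iic, ← lintegral_indicator measurableSet_Ici,
      ← lintegral_sub_left_eq_self _ s]
    congr 1
    funext a
    by_cases h : s / 2 ≤ a
    · have h' : s - a ≤ s / 2 := by linarith
      simp [Set.indicator, h, h', hsymm]
    · have h' : ¬ s - a ≤ s / 2 := by linarith
      simp [Set.indicator, h, h']
  simp_rw [hfib]
  rw [← lintegral_add_compl k (measurableSet_Ioi (a := s / 2)), hIic, hIoi]
  have := lensProfile_nonneg (s / r)
  rw [← ENNReal.ofReal_add (by positivity) (by positivity)]
  congr 1
  ring

lemma volume_lens {r : ℝ} (hr : 0 < r) (x : E 2) :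
    volume (Metric.closedBall 0 r ∩ Metric.closedBall x r) =
      ENNReal.ofReal (r ^ 2 * lensProfile (‖x‖ / r)) := by
  set y : E 2 := !₂[‖x‖, 0] with hy
  have hxy : ‖x‖ = ‖y‖ := by
    rw [hy, EuclideanSpace.norm_eq !₂[‖x‖, 0]]
    simp [Fin.sum_univ_two]
  set L := (Submodule.span ℝ {x - y})ᗮ.reflection with hL
  have hLx : L x = y := Submodule.reflection_sub hxy
  have h1 : L ⁻¹' (Metric.closedBall 0 r ∩ Metric.closedBall y r) =
      Metric.closedBall 0 r ∩ Metric.closedBall x r := by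
    rw [Set.preimage_inter, ← hLx]
    congr 1
    · have := L.preimage_closedBall 0 r
      rw [this, map_zero]
    · rw [L.preimage_closedBall, L.symm_apply_apply]
  rw [← h1, L.measurePreserving.measure_preimage
    (measurableSet_closedBall.inter measurableSet_closedBall).nullMeasurableSet,
    ← volume_lens_prod hr (norm_nonneg x)]
  have h2 := (volume_preserving_finTwoArrow ℝ).comp (PiLp.volume_preserving_ofLp (Fin 2))
  rw [← h2.measure_preimage (measurableSet_lens r ‖x‖).nullMeasurableSet]
  congr 1
  ext v
  have hn : ∀ w : E 2, ‖w‖ ≤ r ↔ w 0 ^ 2 + w 1 ^ 2 ≤ r ^ 2 := fun w => by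
    rw [← sq_le_sq₀ (norm_nonneg w) hr.le, EuclideanSpace.norm_sq_eq, Fin.sum_univ_two,
      Real.norm_eq_abs, Real.norm_eq_abs, sq_abs, sq_abs]
  rw [Set.mem_inter_iff, mem_closedBall_zero_iff, mem_closedBall_iff_norm, hn, hn]
  simp [hy]

end Lens

/-- The area of the intersection of two discs of radius `r` whose centres differ by `x`. -/
noncomputable def overlap (r : ℝ) (x : E 2) : ℝ≥0∞ :=
  ENNReal.ofReal (r ^ 2 * lensProfile ‖r⁻¹ • x‖)

lemma lintegral_indicator_mul_indicator {r : ℝ} (hr : 0 < r) (x : E 2) :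
    ∫⁻ v, (Metric.closedBall (0 : E 2) r).indicator (1 : E 2 → ℝ≥0∞) v *
      (Metric.closedBall (0 : E 2) r).indicator (1 : E 2 → ℝ≥0∞) (v + x) = overlap r x := by
  have h1 : ∀ v, (Metric.closedBall (0 : E 2) r).indicator (1 : E 2 → ℝ≥0∞) v *
      (Metric.closedBall (0 : E 2) r).indicator (1 : E 2 → ℝ≥0∞) (v + x) =
      (Metric.closedBall (0 : E 2) r ∩ Metric.closedBall (-x) r).indicator (1 : E 2 → ℝ≥0∞) v := by
    intro v
    have h2 : v ∈ Metric.closedBall (-x) r ↔ v + x ∈ Metric.closedBall (0 : E 2) r := by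
      rw [mem_closedBall_iff_norm, mem_closedBall_zero_iff, sub_neg_eq_add]
    rw [Set.inter_indicator_one, Pi.mul_apply]
    congr 1
    by_cases h4 : v + x ∈ Metric.closedBall (0 : E 2) r
    · rw [Set.indicator_of_mem h4, Set.indicator_of_mem (h2.2 h4)]
      rfl
    · rw [Set.indicator_of_notMem h4, Set.indicator_of_notMem fun h => h4 (h2.1 h)]
  simp_rw [h1]
  rw [lintegral_indicator_one (measurableSet_closedBall.inter measurableSet_closedBall),
    volume_lens hr, norm_neg, overlap, norm_smul, norm_inv, Real.norm_of_nonneg hr.le,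
    div_eq_inv_mul]

lemma measurable_overlap (r : ℝ) : Measurable (overlap r) := by
  have := continuous_lensProfile
  unfold overlap
  fun_prop

lemma lintegral_overlap {r : ℝ} (hr : 0 < r) :
    ∫⁻ x, overlap r x = volume (Metric.closedBall (0 : E 2) r) ^ 2 := by
  set B := Metric.closedBall (0 : E 2) r with hBdef
  have hB : MeasurableSet B := measurableSet_closedBall
  have hm : Measurable (B.indicator (1 : E 2 → ℝ≥0∞)) := measurable_one.indicator hB
  simp_rw [← lintegral_indicator_mul_indicator hr]
  rw [lintegral_lintegral_swap]
  · have h1 : ∀ v, ∫⁻ x, B.indicator (1 : E 2 → ℝ≥0∞) v * B.indicator 1 (v + x) =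
        B.indicator (1 : E 2 → ℝ≥0∞) v * volume B := fun v => by
      have hv : Measurable fun x => B.indicator (1 : E 2 → ℝ≥0∞) (v + x) :=
        hm.comp (measurable_const_add v)
      rw [lintegral_const_mul _ hv,
        lintegral_add_left_eq_self (B.indicator (1 : E 2 → ℝ≥0∞)), lintegral_indicator_one hB]
    simp_rw [← hBdef, h1]
    rw [lintegral_mul_const _ hm, lintegral_indicator_one hB, sq]
  · exact ((hm.comp measurable_snd).mul
      (hm.comp (measurable_snd.add measurable_fst))).aemeasurable

/-! ### The second moment in terms of lenses -/

section SecondMoment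

variable (b : Module.Basis (Fin 2) ℝ (E 2)) {Ω : Type u} [MeasurableSpace Ω] {P : Measure Ω}
  [IsProbabilityMeasure P]

/-- The second moment of the number of points in a disc. -/
lemma lintegral_sq_count {p : lattice b → Ω → E 2} {U : Ω → E 2} (h : IsPerturbation b P p U)
    {r : ℝ} (hr : 0 < r) :
    ∫⁻ ω, perturbedLattice b p U ω (Metric.closedBall 0 r) ^ 2 ∂P =
      (∑' z : lattice b, ∫⁻ ω, overlap r ((z : E 2) + (p z ω - p 0 ω)) ∂P) /
        volume (ZSpan.fundamentalDomain b) := by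
  set B := Metric.closedBall (0 : E 2) r with hBdef
  have hB : MeasurableSet B := measurableSet_closedBall
  have hm : Measurable (B.indicator (1 : E 2 → ℝ≥0∞)) := measurable_one.indicator hB
  simp_rw [perturbedLattice_apply b hB]
  have h1 := lintegral_sq_tsum b h (a := fun v u => B.indicator (1 : E 2 → ℝ≥0∞) (u + v))
    (hm.comp (measurable_snd.add measurable_fst))
  rw [h1]
  congr 1
  have hm1 : ∀ z : lattice b, Measurable fun ω => overlap r ((z : E 2) + (p z ω - p 0 ω)) :=
    fun z =>
    (measurable_overlap r).comp (((h.measurable_pert z).sub (h.measurable_pert 0)).const_add _)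
  rw [← lintegral_tsum fun z => (hm1 z).aemeasurable]
  refine lintegral_congr fun ω => ?_
  simp_rw [← ENNReal.tsum_mul_left]
  have hm2 : ∀ z : lattice b, Measurable fun u => B.indicator (1 : E 2 → ℝ≥0∞) (u + p 0 ω) *
      B.indicator (1 : E 2 → ℝ≥0∞) ((z : E 2) + u + p z ω) := fun z =>
    (hm.comp (measurable_add_const _)).mul (hm.comp ((measurable_const_add _).add_const _))
  rw [lintegral_tsum fun z => (hm2 z).aemeasurable]
  refine tsum_congr fun z => ?_
  rw [← lintegral_indicator_mul_indicator hr, ← lintegral_add_right_eq_self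
    (fun v => B.indicator (1 : E 2 → ℝ≥0∞) v *
      B.indicator (1 : E 2 → ℝ≥0∞) (v + ((z : E 2) + (p z ω - p 0 ω)))) (p 0 ω)]
  refine lintegral_congr fun u => ?_
  congr 2
  abel

/-- The squared mean of the number of points in a disc, written as a sum over the lattice. -/
lemma tsum_lintegral_overlap {r : ℝ} (hr : 0 < r) (c : E 2) :
    ∑' z : lattice b, ∫⁻ t, overlap r ((z : E 2) + (t - c))
      ∂(ProbabilityTheory.cond volume (ZSpan.fundamentalDomain b)) =
      volume (Metric.closedBall (0 : E 2) r) ^ 2 / volume (ZSpan.fundamentalDomain b) := by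
  simp_rw [ProbabilityTheory.cond, lintegral_smul_measure, smul_eq_mul]
  rw [ENNReal.tsum_mul_left, ← lintegral_overlap hr,
    ← lintegral_sub_right_eq_self (overlap r) c, lintegral_eq_tsum_lattice b, mul_comm,
    div_eq_mul_inv]
  simp_rw [add_sub_assoc]

lemma integral_lens_eq_zero {μ : Measure Ω} {q : lattice b → Ω → E 2} {K : ℝ}
    (hK : ∀ z ω, ‖q z ω‖ ≤ K) {r : ℝ} (hr : 0 < r) (hrK : K ≤ r)
    (z : lattice b) (hz : 3 * r < ‖(z : E 2)‖) :
    ∫ ω, lensProfile ‖r⁻¹ • ((z : E 2) + q z ω)‖ ∂μ = 0 := by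
  refine (integral_congr_ae (Eventually.of_forall fun ω => ?_)).trans (integral_zero _ _)
  refine lensProfile_of_two_le ?_
  rw [norm_smul, norm_inv, Real.norm_of_nonneg hr.le, ← div_eq_inv_mul, le_div_iff₀ hr]
  have := norm_sub_le_norm_add (z : E 2) (q z ω)
  linarith [hK z ω]

lemma integrable_lens {q : lattice b → Ω → E 2} (hq : ∀ z, Measurable (q z)) {K : ℝ}
    (hK : ∀ z ω, ‖q z ω‖ ≤ K) (r : ℝ) (z : lattice b) :
    Integrable (fun ω => lensProfile ‖r⁻¹ • ((z : E 2) + q z ω)‖) P := by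
  have hc := continuous_lensProfile
  exact integrable_comp_of_norm_le (g := fun y => lensProfile ‖r⁻¹ • ((z : E 2) + y)‖)
    (by fun_prop) (hq z) (hK z)

lemma tsum_lintegral_overlap_eq {q : lattice b → Ω → E 2} (hq : ∀ z, Measurable (q z)) {K : ℝ}
    (hK : ∀ z ω, ‖q z ω‖ ≤ K) {r : ℝ} (hr : 0 < r) (hrK : K ≤ r) :
    ∑' z : lattice b, ∫⁻ ω, overlap r ((z : E 2) + q z ω) ∂P =
      ENNReal.ofReal (r ^ 2 *
        ∑' z : lattice b, ∫ ω, lensProfile ‖r⁻¹ • ((z : E 2) + q z ω)‖ ∂P) := by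
  rw [← tsum_mul_left, ENNReal.ofReal_tsum_of_nonneg]
  · refine tsum_congr fun z => ?_
    rw [← integral_const_mul, ofReal_integral_eq_lintegral_ofReal]
    · rfl
    · exact (integrable_lens b hq hK r z).const_mul _
    · exact Eventually.of_forall fun ω => mul_nonneg (by positivity)
        (lensProfile_nonneg _)
  · exact fun z => mul_nonneg (by positivity) (integral_nonneg fun ω =>
      lensProfile_nonneg _)
  · exact summable_of_radius b (R := 3 * r) fun z hz => by
      rw [integral_lens_eq_zero b hK hr hrK z hz, mul_zero]

end SecondMoment

/-! ### Bounded perturbations in the plane -/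

section Plane

variable (b : Module.Basis (Fin 2) ℝ (E 2)) {Ω : Type u} [MeasurableSpace Ω] {P : Measure Ω}
  [IsProbabilityMeasure P] {p : lattice b → Ω → E 2} {U : Ω → E 2}

lemma integral_field_shift {μ : Measure Ω} (h : IsPerturbation b μ p U) {g : (lattice b → E 2) → ℝ}
    (hg : Measurable g) (a : lattice b) :
    ∫ ω, g (fun x => p (x + a) ω) ∂μ = ∫ ω, g (fun x => p x ω) ∂μ :=
  ((h.invariant a).comp hg).integral_eq.symm

lemma integrable_coord_mul (h : IsPerturbation b P p U) {K : ℝ} (hK : ∀ x ω, ‖p x ω‖ ≤ K)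
    (z w : lattice b) (i j : Fin 2) : Integrable (fun ω => p z ω i * p w ω j) P := by
  have hc : ∀ (x : lattice b) (i : Fin 2) ω, ‖p x ω i‖ ≤ K := fun x i ω =>
    (PiLp.norm_apply_le _ i).trans (hK x ω)
  have hm : ∀ (x : lattice b) (i : Fin 2), Measurable fun ω => p x ω i := fun x i =>
    (EuclideanSpace.proj i : E 2 →L[ℝ] ℝ).continuous.measurable.comp (h.measurable_pert x)
  refine Integrable.of_bound ((hm z i).mul (hm w j)).aestronglyMeasurable (K * K)
    (Eventually.of_forall fun ω => ?_)
  rw [norm_mul]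
  exact mul_le_mul (hc z i ω) (hc w j ω) (norm_nonneg _) ((norm_nonneg _).trans (hc z i ω))

/-- The covariances of a stationary bounded family have no macroscopic fluctuations. -/
lemma tendsto_latticeAvg_coord_mul (h : IsPerturbation b P p U) {K : ℝ}
    (hK : ∀ x ω, ‖p x ω‖ ≤ K) {φ : E 2 → ℝ} (hφ : HasCompactSupport φ) (hc : Continuous φ)
    (h0 : ∫ x, φ x = 0) (i j : Fin 2) :
    Tendsto (fun r => latticeAvg b φ r fun z => ∫ ω, p z ω i * p 0 ω j ∂P) atTop (𝓝 0) := by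
  have hm : ∀ (x : lattice b) (i : Fin 2), Measurable fun ω => p x ω i := fun x i =>
    (EuclideanSpace.proj i : E 2 →L[ℝ] ℝ).continuous.measurable.comp (h.measurable_pert x)
  have hL : ∀ (x : lattice b) (i : Fin 2), MemLp (fun ω => p x ω i) 2 P := fun x i =>
    MemLp.of_bound (hm x i).aestronglyMeasurable K
      (Eventually.of_forall fun ω => (PiLp.norm_apply_le _ i).trans (hK x ω))
  have hin : ∀ (z w : lattice b) (i j : Fin 2), inner ℝ ((hL z i).toLp _) ((hL w j).toLp _) =
      ∫ ω, p z ω i * p w ω j ∂P := by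
    intro z w i j
    rw [L2.inner_def]
    refine integral_congr_ae ?_
    filter_upwards [(hL z i).coeFn_toLp, (hL w j).coeFn_toLp] with ω h1 h2
    rw [h1, h2, RCLike.inner_apply, conj_trivial, mul_comm]
  have hg : ∀ (z w : lattice b), Measurable fun f : lattice b → E 2 => f z i * f w i := fun z w =>
    ((EuclideanSpace.proj i : E 2 →L[ℝ] ℝ).continuous.measurable.comp (measurable_pi_apply z)).mul
      ((EuclideanSpace.proj i : E 2 →L[ℝ] ℝ).continuous.measurable.comp (measurable_pi_apply w))
  have := tendsto_latticeAvg_inner b hφ hc h0 (fun z => (hL z i).toLp _)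
    (fun a z w => by rw [hin, hin]; exact integral_field_shift b h (hg z w) a) ((hL 0 j).toLp _)
  simpa only [hin] using this

lemma tendsto_latticeAvg_const {φ : E 2 → ℝ} (hφ : HasCompactSupport φ) (hc : Continuous φ)
    (h0 : ∫ x, φ x = 0) (m : ℝ) :
    Tendsto (fun r => latticeAvg b φ r fun _ => m) atTop (𝓝 0) := by
  have h1 := (tendsto_latticeAvg_one b hφ hc).mul_const m
  rw [h0, zero_div, zero_mul] at h1
  refine h1.congr fun r => ?_
  simp only [latticeAvg, mul_one]
  rw [tsum_mul_right, mul_assoc]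

/-- The lens sums are not modified by the differences of stationary bounded perturbations. -/
lemma tendsto_lens_sum_pert (h : IsPerturbation b P p U) {K : ℕ} (hK1 : 1 ≤ K)
    (hK : ∀ x ω, ‖p x ω‖ ≤ K) :
    Tendsto (fun r : ℝ => ∑' z : lattice b, ∫ ω, (lensProfile ‖r⁻¹ • ((z : E 2) +
      (p z ω - p 0 ω))‖ - lensProfile ‖r⁻¹ • (z : E 2)‖) ∂P) atTop (𝓝 0) := by
  have hcm : ∀ i : Fin 2, Measurable fun v : E 2 => v i := fun i =>
    (EuclideanSpace.proj i : E 2 →L[ℝ] ℝ).continuous.measurable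
  have hi : ∀ (z : lattice b) (i : Fin 2), Integrable (fun ω => p z ω i) P := fun z i =>
    integrable_comp_of_norm_le (g := fun x : E 2 => x i) (by fun_prop) (h.measurable_pert z) (hK z)
  refine tendsto_lens_sum b (K := 2 * K) (q := fun z ω => p z ω - p 0 ω)
    (fun z => (h.measurable_pert z).sub (h.measurable_pert 0)) (by omega) (fun z ω => ?_)
    (fun z i => ?_) (fun φ hφ hc h0 i j => ?_)
  · push_cast
    exact (norm_sub_le _ _).trans (by linarith [hK z ω, hK 0 ω])
  · simp only [PiLp.sub_apply]
    rw [integral_sub (hi z i) (hi 0 i), sub_eq_zero]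
    have := integral_field_shift b h (g := fun f => f 0 i) ((hcm i).comp (measurable_pi_apply 0)) z
    simpa using this
  · have e : ∀ z, ∫ ω, (p z ω - p 0 ω) i * (p z ω - p 0 ω) j ∂P =
        2 * ∫ ω, p 0 ω i * p 0 ω j ∂P - ∫ ω, p z ω i * p 0 ω j ∂P -
          ∫ ω, p z ω j * p 0 ω i ∂P := by
      intro z
      have hI := integrable_coord_mul b h hK
      have e1 : ∫ ω, p z ω i * p z ω j ∂P = ∫ ω, p 0 ω i * p 0 ω j ∂P := by
        have := integral_field_shift b h (g := fun f => f 0 i * f 0 j)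
          (((hcm i).comp (measurable_pi_apply 0)).mul ((hcm j).comp (measurable_pi_apply 0))) z
        simpa using this
      have e2 : ∀ ω, (p z ω - p 0 ω) i * (p z ω - p 0 ω) j = (p z ω i * p z ω j + p 0 ω i * p 0 ω j)
          - p z ω i * p 0 ω j - p z ω j * p 0 ω i := fun ω => by
        simp only [PiLp.sub_apply]
        ring
      simp_rw [e2]
      have i1 : Integrable (fun ω => p z ω i * p z ω j + p 0 ω i * p 0 ω j) P :=
        (hI z z i j).add (hI 0 0 i j)
      have i2 : Integrable (fun ω => p z ω i * p z ω j + p 0 ω i * p 0 ω j -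
          p z ω i * p 0 ω j) P := i1.sub (hI z 0 i j)
      rw [integral_sub i2 (hI z 0 j i), integral_sub i1 (hI z 0 i j),
        integral_add (hI z z i j) (hI 0 0 i j), e1]
      ring
    have h1 := ((tendsto_latticeAvg_const b hφ hc h0 (2 * ∫ ω, p 0 ω i * p 0 ω j ∂P)).sub
      (tendsto_latticeAvg_coord_mul b h hK hφ hc h0 i j)).sub
      (tendsto_latticeAvg_coord_mul b h hK hφ hc h0 j i)
    rw [sub_zero, sub_zero] at h1
    refine h1.congr' ?_
    filter_upwards [eventually_gt_atTop 0] with r hr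
    simp_rw [e]
    rw [latticeAvg_sub b hφ hr, latticeAvg_sub b hφ hr]

/-- The lens sums are not modified by one centred perturbation common to all points. -/
lemma tendsto_lens_sum_common {q : Ω → E 2} (hq : Measurable q) {K : ℕ} (hK1 : 1 ≤ K)
    (hK : ∀ ω, ‖q ω‖ ≤ K) (h0 : ∀ i, ∫ ω, q ω i ∂P = 0) :
    Tendsto (fun r : ℝ => ∑' z : lattice b, ∫ ω, (lensProfile ‖r⁻¹ • ((z : E 2) + q ω)‖ -
      lensProfile ‖r⁻¹ • (z : E 2)‖) ∂P) atTop (𝓝 0) :=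
  tendsto_lens_sum b (q := fun _ => q) (fun _ => hq) hK1 (fun _ => hK) (fun _ => h0)
    fun _ hφ hc hz _ _ => tendsto_latticeAvg_const b hφ hc hz _

lemma tsum_lens_sub {q : lattice b → Ω → E 2} (hq : ∀ z, Measurable (q z)) {K : ℝ} (hK0 : 0 ≤ K)
    (hK : ∀ z ω, ‖q z ω‖ ≤ K) {r : ℝ} (hr : 0 < r) (hrK : K ≤ r) :
    ∑' z : lattice b, ∫ ω, (lensProfile ‖r⁻¹ • ((z : E 2) + q z ω)‖ -
      lensProfile ‖r⁻¹ • (z : E 2)‖) ∂P =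
    ∑' z : lattice b, ∫ ω, lensProfile ‖r⁻¹ • ((z : E 2) + q z ω)‖ ∂P -
      ∑' z : lattice b, lensProfile ‖r⁻¹ • (z : E 2)‖ := by
  rw [← Summable.tsum_sub]
  · refine tsum_congr fun z => ?_
    rw [integral_sub (integrable_lens b hq hK r z) (integrable_const _)]
    simp
  · exact summable_of_radius b (R := 3 * r) fun z hz => integral_lens_eq_zero b hK hr hrK z hz
  · refine summable_of_radius b (R := 3 * r) fun z hz => ?_
    have := integral_lens_eq_zero (μ := P) b (q := fun _ _ => 0) (K := K)
      (fun _ _ => by simpa using hK0) hr hrK z hz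
    simpa using this

/-- The number variance is the difference of the second moment and of the squared mean. -/
lemma numberVariance_eq (h : IsPerturbation b P p U) {B : Set (E 2)} (hB : MeasurableSet B)
    (hBt : volume B ≠ ∞) :
    numberVariance b P p U B = ∫⁻ ω, perturbedLattice b p U ω B ^ 2 ∂P -
      (volume B / volume (ZSpan.fundamentalDomain b)) ^ 2 := by
  have hmeas := (measurable_count b h hB).ennreal_toReal.aestronglyMeasurable (μ := P)
  rw [numberVariance, evariance_def' hmeas, integral_count b h hB hBt]
  congr 1
  · refine lintegral_congr_ae ?_
    filter_upwards [count_ae_lt_top b h hB hBt] with ω hω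
    rw [Real.enorm_of_nonneg ENNReal.toReal_nonneg, ENNReal.ofReal_toReal hω.ne]
  · rw [ENNReal.ofReal_pow ENNReal.toReal_nonneg, ENNReal.ofReal_toReal
      (ENNReal.div_ne_top hBt (volume_fundamentalDomain_ne_zero b))]

/-- Bounded perturbations of planar lattices are hyperuniform. -/
lemma hyperuniform_two (h : IsPerturbation b P p U) {K : ℕ} (hK1 : 1 ≤ K)
    (hK : ∀ x ω, ‖p x ω‖ ≤ K) : Hyperuniform b P p U := by
  set D := volume (ZSpan.fundamentalDomain b) with hD
  have hD0 : D ≠ 0 := volume_fundamentalDomain_ne_zero b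
  have hDt : D ≠ ∞ := volume_fundamentalDomain_ne_top b
  set w := volume (Metric.closedBall (0 : E 2) 1) with hw
  have hw0 : w ≠ 0 := (Metric.measure_closedBall_pos volume _ one_pos).ne'
  have hwt : w ≠ ∞ := measure_closedBall_lt_top.ne
  -- the fundamental domain, centred at its mean, serves as the perturbation giving the mean
  set μ : Measure (E 2) := ProbabilityTheory.cond volume (ZSpan.fundamentalDomain b) with hμ
  have hμP : IsProbabilityMeasure μ := isProbabilityMeasure_cond b
  have hρ := cellRadius_nonneg b
  set ρ := cellRadius b with hρdef
  set τ : E 2 → E 2 := truncate ρ with hτ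
  have hτm : Measurable τ := measurable_truncate ρ
  have hτn : ∀ t, ‖τ t‖ ≤ ρ := norm_truncate_le hρ
  set c : E 2 := WithLp.toLp 2 fun i => ∫ t, τ t i ∂μ with hc
  set L : ℕ := ⌈ρ + ‖c‖ + 1⌉₊ with hL
  have hL' : ρ + ‖c‖ + 1 ≤ L := Nat.le_ceil _
  have hL1 : 1 ≤ L := by
    have : (1 : ℝ) ≤ L := by linarith [norm_nonneg c]
    exact_mod_cast this
  have hqm : Measurable fun t => τ t - c := hτm.sub_const c
  have hqL : ∀ t, ‖τ t - c‖ ≤ L := fun t => (norm_sub_le _ _).trans (by linarith [hτn t])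
  have hq0 : ∀ i, ∫ t, (τ t - c) i ∂μ = 0 := by
    intro i
    have hi : Integrable (fun t => τ t i) μ :=
      integrable_comp_of_norm_le (g := fun x : E 2 => x i) (by fun_prop) hτm hτn
    simp only [PiLp.sub_apply]
    rw [integral_sub hi (integrable_const _)]
    simp [hc]
  have hT := (tendsto_lens_sum_pert b h hK1 hK).sub
    (tendsto_lens_sum_common (P := μ) b hqm hL1 hqL hq0)
  rw [sub_zero] at hT
  set X : ℝ → ℝ := fun r => ∑' z : lattice b, ∫ ω, lensProfile
    ‖r⁻¹ • ((z : E 2) + (p z ω - p 0 ω))‖ ∂P with hX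
  set Y : ℝ → ℝ := fun r => ∑' z : lattice b, ∫ t, lensProfile
    ‖r⁻¹ • ((z : E 2) + (τ t - c))‖ ∂μ with hY
  have hpm : ∀ z, Measurable fun ω => p z ω - p 0 ω := fun z =>
    (h.measurable_pert z).sub (h.measurable_pert 0)
  have hpK : ∀ z ω, ‖p z ω - p 0 ω‖ ≤ 2 * K := fun z ω =>
    (norm_sub_le _ _).trans (by linarith [hK z ω, hK 0 ω])
  have hXY : Tendsto (fun r => X r - Y r) atTop (𝓝 0) := by
    refine hT.congr' ?_
    filter_upwards [eventually_gt_atTop 0, eventually_ge_atTop (2 * K : ℝ),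
      eventually_ge_atTop (L : ℝ)] with r hr0 hrK hrL
    rw [tsum_lens_sub b hpm (by positivity) hpK hr0 hrK,
      tsum_lens_sub b (fun _ => hqm) (by positivity) (fun _ => hqL) hr0 hrL]
    ring
  have hfin : Tendsto (fun r => ENNReal.ofReal (X r - Y r) * (D⁻¹ * w⁻¹)) atTop (𝓝 0) := by
    have h1 := ENNReal.tendsto_ofReal hXY
    rw [ENNReal.ofReal_zero] at h1
    have h2 := ENNReal.Tendsto.mul_const h1 (b := D⁻¹ * w⁻¹)
      (Or.inr (ENNReal.mul_ne_top (ENNReal.inv_ne_top.2 hD0) (ENNReal.inv_ne_top.2 hw0)))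
    rwa [zero_mul] at h2
  refine tendsto_of_tendsto_of_tendsto_of_le_of_le' tendsto_const_nhds hfin
    (Eventually.of_forall fun _ => zero_le) ?_
  filter_upwards [eventually_gt_atTop 0, eventually_ge_atTop (2 * K : ℝ),
    eventually_ge_atTop (L : ℝ)] with r hr0 hrK hrL
  have hBt : volume (Metric.closedBall (0 : E 2) r) ≠ ∞ := measure_closedBall_lt_top.ne
  have hY' : volume (Metric.closedBall (0 : E 2) r) ^ 2 / D = ENNReal.ofReal (r ^ 2 * Y r) := by
    rw [hD, ← tsum_lintegral_overlap b hr0 c,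
      ← tsum_lintegral_overlap_eq b (fun _ => hqm) (fun _ => hqL) hr0 hrL]
    refine tsum_congr fun z => ?_
    simp only [hμ, ProbabilityTheory.cond, lintegral_smul_measure]
    congr 1
    refine setLIntegral_congr_fun (ZSpan.fundamentalDomain_measurableSet b) fun t ht => ?_
    have e : τ t = t := if_pos (norm_le_cellRadius b ht)
    rw [e]
  have hvar : numberVariance b P p U (Metric.closedBall 0 r) ≤
      ENNReal.ofReal (r ^ 2 * (X r - Y r)) / D := by
    rw [numberVariance_eq b h measurableSet_closedBall hBt, lintegral_sq_count b h hr0,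
      tsum_lintegral_overlap_eq b hpm hpK hr0 hrK, tsub_le_iff_right]
    have e : (volume (Metric.closedBall (0 : E 2) r) / D) ^ 2 =
        ENNReal.ofReal (r ^ 2 * Y r) / D := by
      rw [← hY']
      simp only [div_eq_mul_inv]
      ring
    rw [e, ← ENNReal.add_div]
    refine ENNReal.div_le_div_right ?_ _
    refine le_trans (le_of_eq ?_) ENNReal.ofReal_add_le
    congr 1
    ring
  rw [rescaledVariance, volume_closedBall_eq _ hr0.le, ← hw]
  have hr2 : ENNReal.ofReal r ^ 2 ≠ 0 := pow_ne_zero _ (by simpa using hr0)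
  have hr2t : ENNReal.ofReal r ^ 2 ≠ ∞ := ENNReal.pow_ne_top ENNReal.ofReal_ne_top
  refine (ENNReal.div_le_div_right hvar _).trans (le_of_eq ?_)
  rw [ENNReal.ofReal_mul (by positivity), ENNReal.ofReal_pow hr0.le]
  simp only [div_eq_mul_inv]
  rw [ENNReal.mul_inv (Or.inl hr2) (Or.inl hr2t)]
  calc ENNReal.ofReal r ^ 2 * ENNReal.ofReal (X r - Y r) * D⁻¹ *
        ((ENNReal.ofReal r ^ 2)⁻¹ * w⁻¹)
      = ENNReal.ofReal r ^ 2 * (ENNReal.ofReal r ^ 2)⁻¹ *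
        (ENNReal.ofReal (X r - Y r) * (D⁻¹ * w⁻¹)) := by ring
    _ = _ := by rw [ENNReal.mul_inv_cancel hr2 hr2t, one_mul]

end Plane

/-- In dimensions one and two, a finite moment of order `d` implies hyperuniformity. -/
theorem hyperuniform_of_moment {d : ℕ} (hd : d = 1 ∨ d = 2) (b : Module.Basis (Fin d) ℝ (E d))
    {Ω : Type u} [MeasurableSpace Ω] {P : Measure Ω} [IsProbabilityMeasure P]
    {p : lattice b → Ω → E d} {U : Ω → E d} (h : IsPerturbation b P p U)
    (hint : ∫⁻ ω, ‖p 0 ω‖ₑ ^ d ∂P < ∞) : Hyperuniform b P p U := by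
  refine hyperuniform_of_truncate b h hd hint fun K hK => ?_
  have h' := h.comp b (measurable_truncate K)
  rcases hd with rfl | rfl
  · exact hyperuniform_one b h' hK fun x ω => norm_truncate_le hK.le _
  · have hc : K ≤ (⌈K⌉₊ : ℝ) := Nat.le_ceil K
    exact hyperuniform_two b h' (K := ⌈K⌉₊) (Nat.one_le_ceil_iff.2 hK) fun x ω =>
      (norm_truncate_le hK.le _).trans hc

end PertLattice

theorem theorem1p1 :
    -- finite `d`-th moment implies finite number variance in all balls
    (∀ (d : ℕ), 1 ≤ d → ∀ (b : Module.Basis (Fin d) ℝ (PertLattice.E d))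
      (Ω : Type u) [MeasurableSpace Ω] (P : Measure Ω) [IsProbabilityMeasure P]
      (p : PertLattice.lattice b → Ω → PertLattice.E d) (U : Ω → PertLattice.E d),
      PertLattice.IsPerturbation b P p U →
      ∫⁻ ω, ‖p 0 ω‖ₑ ^ d ∂P < ∞ →
      ∀ (c : PertLattice.E d) (r : ℝ), 0 < r →
        PertLattice.numberVariance b P p U (Metric.closedBall c r) < ∞) ∧
    -- in dimension one and two, finite `d`-th moment implies hyperuniformity
    (∀ (d : ℕ), d = 1 ∨ d = 2 → ∀ (b : Module.Basis (Fin d) ℝ (PertLattice.E d))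
      (Ω : Type u) [MeasurableSpace Ω] (P : Measure Ω) [IsProbabilityMeasure P]
      (p : PertLattice.lattice b → Ω → PertLattice.E d) (U : Ω → PertLattice.E d),
      PertLattice.IsPerturbation b P p U →
      ∫⁻ ω, ‖p 0 ω‖ₑ ^ d ∂P < ∞ →
      PertLattice.Hyperuniform b P p U) ∧
    -- perturbations of `ℤ^d` dominated by `X` (on an extension `π` of the probability space
    -- on which `X` is defined) with infinite number variance in all balls
    (∀ (d : ℕ), 1 ≤ d → ∀ (Ω₀ : Type v) [MeasurableSpace Ω₀] (P₀ : Measure Ω₀)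
      [IsProbabilityMeasure P₀] (X : Ω₀ → ℝ), Measurable X → (∀ᵐ ω ∂P₀, 0 ≤ X ω) →
      ∫⁻ ω, ENNReal.ofReal (X ω) ^ d ∂P₀ = ∞ →
      ∃ (Ω : Type v) (_ : MeasurableSpace Ω) (P : Measure Ω) (_ : IsProbabilityMeasure P)
        (π : Ω → Ω₀)
        (p : PertLattice.lattice (PertLattice.stdBasis d) → Ω → PertLattice.E d)
        (U : Ω → PertLattice.E d),
        MeasurePreserving π P P₀ ∧
        PertLattice.IsPerturbation (PertLattice.stdBasis d) P p U ∧
        (∀ᵐ ω ∂P, ‖p 0 ω‖ ≤ X (π ω)) ∧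
        ∀ (c : PertLattice.E d) (r : ℝ), 0 < r →
          PertLattice.numberVariance (PertLattice.stdBasis d) P p U
            (Metric.closedBall c r) = ∞) ∧
    -- arbitrarily small perturbations of `ℤ^d`, `d ≥ 3`, with `σ(r) → +∞`
    (∀ (d : ℕ), 3 ≤ d → ∀ ε : ℝ, 0 < ε →
      ∃ (Ω : Type) (_ : MeasurableSpace Ω) (P : Measure Ω) (_ : IsProbabilityMeasure P)
        (p : PertLattice.lattice (PertLattice.stdBasis d) → Ω → PertLattice.E d)
        (U : Ω → PertLattice.E d),
        PertLattice.IsPerturbation (PertLattice.stdBasis d) P p U ∧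
        (∀ᵐ ω ∂P, ‖p 0 ω‖ ≤ ε) ∧
        Tendsto (PertLattice.rescaledVariance (PertLattice.stdBasis d) P p U) atTop
          (𝓝 ∞)) := by
  exact ⟨fun _ _ b _ _ _ _ _ _ h hp c _ hr =>
      PertLattice.numberVariance_closedBall_lt_top b h hp c hr,
    fun _ hd b _ _ _ _ _ _ h hp => PertLattice.hyperuniform_of_moment hd b h hp,
    fun _ hd Ω₀ _ P₀ _ X hX hX0 hint =>
      PertLattice.exists_dominated_infinite_variance hd Ω₀ P₀ X hX hX0 hint,
    fun _ hd _ hε => PertLattice.exists_small_large_variance hd hε⟩
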